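/- **Setting.** Let $d,n_1\ge 1$, $r,\lambda\ge 0$ be integers, $f\ge 1$, and let $A\in\mathbb C^{N\times N}$. A full $2^d$-ary spatial tree of depth $\lambda$ (the dyadic grids on a cube in $\mathbb R^d$; level $l=1,\dots,\lambda$ has $2^{d(\lambda-l+1)}$ cells, and level $1$ is the finest) places exactly $n_1$ indices of $\{1,\dots,N\}$ in each finest cell, so $N=2^{d\lambda}n_1$. Two cells of a level are near if all their grid coordinates differ by at most $1$. A depth-$\lambda$ hierarchically block separable (HBS) representation of $A$ with rank $r$, tolerance $\tau$ and strong rank-revealing QR parameter $f$ is obtained as follows. Put $S_0=A$. At level $l$, $D_l$ consists of the blocks of $S_{l-1}$ between near cells. For each cell $p$, a row interpolative decomposition of the block of $S_{l-1}$ with rows in $p$ and columns in cells not near $p$ selects $r$ skeleton rows and a basis $U_p$, and a column interpolative decomposition of the block with columns in $p$ and rows in cells not near $p$ selects $r$ skeleton columns and a basis $V_p$. Each interpolation matrix is the identity on the skeleton, has entries of modulus at most $f$, and reproduces its block up to $\tau$ in spectral norm. Put $L_l=\mathrm{blkdiag}(U_p)$, $R_l=\mathrm{blkdiag}(V_p)$,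 and let $S_l$ be the submatrix of $S_{l-1}-D_l$ on the skeleton rows and columns, whose indices are grouped by the parent cells at the next level. Finally $D_{\lambda+1}=S_\lambda$. The extended sparsification $A_{\rm sp}$, of size $N_{\rm sp}\times N_{\rm sp}$, is the block tridiagonal matrix with diagonal blocks $D_1,0,D_2,0,\dots,D_\lambda,0,D_{\lambda+1}$, superdiagonal blocks $L_1,-I,L_2,-I,\dots,L_\lambda,-I$ and subdiagonal blocks $R_1,-I,R_2,-I,\dots,R_\lambda,-I$. Let $c_{\rm sp}$ be any number with $c_{\rm sp}\ge f$ and $c_{\rm sp}\ge\max_{i,j}|A_{ij}|$. **Theorem.** 1. There is a constant $K$ depending only on $d,n_1,r$ such that, for every such $A$, $\lambda$, $f$, $\tau$ and HBS representation, $N_{\rm sp}\le KN$, every row and every column of $A_{\rm sp}$ has at most $K$ nonzero entries, and $A_{\rm sp}$ (also when padded by zeros to size $2^n\times 2^n$, as accessed by the oracles below) has at most $KN$ nonzero entries. All entries of $A_{\rm sp}$ have modulus at most $c_{\rm sp}$. 2. There are universal constants $C,k$ such that the following holds for all integers $n,m\ge 0$ and $1\le s_r,s_c\le 2^n$, all $c_{\rm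 sp}\ge 1$ and all $\varepsilon>0$. Put $\alpha=c_{\rm sp}\sqrt{s_rs_c}$ and $b=2(m+1)$. There is a quantum circuit, depending only on $n,m,s_r,s_c,c_{\rm sp},\varepsilon$, on $n$ system qubits, $a\le C(n+1)$ block-encoding ancillas and $w\le C\,(b+\log^k(2+\alpha/\varepsilon))$ further ancilla qubits. It consists of one query to $\mathcal O_r$, one query to $\mathcal O_c$, two queries to $\mathcal O_A$ (a query may be to the inverse of the oracle) and at most $C\,(n+\log^k(2+\alpha/\varepsilon))$ one- and two-qubit gates. For every $A_{\rm sp}$ as above with $N_{\rm sp}\le 2^n$ and entry bound $c_{\rm sp}$ that is $s_r$-row-sparse and $s_c$-column-sparse, padded by zeros to a $2^n\times 2^n$ matrix $(a_{ij})$ (under any numbering of its indices), and for all oracles as below, the circuit implements a unitary $U$ on the $n+a$ qubits, returning the $w$ further ancillas from $|0\rangle$ to $|0\rangle$, that is an $(\alpha,a,\varepsilon)$-block-encoding of the padded matrix: $$\|A_{\rm sp}\|\le\alpha,\qquad \bigl\|A_{\rm sp}-\alpha(\langle 0|^{\otimes a}\otimes I)\,U\,(|0\rangle^{\otimes a}\otimes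 I)\bigr\|\le\varepsilon .$$ The oracles are arbitrary unitaries such that, for $0\le i,j<2^n$, $0\le k'<s_r$, $0\le l<s_c$, $$\mathcal O_r|i\rangle|k'\rangle=|i\rangle|r_{ik'}\rangle,\qquad \mathcal O_c|l\rangle|j\rangle=|c_{lj}\rangle|j\rangle,\qquad \mathcal O_A|i\rangle|j\rangle|0\rangle^{\otimes b}=|i\rangle|j\rangle|\tilde a_{ij}\rangle .$$ The registers of $\mathcal O_r,\mathcal O_c$ have $n+1$ qubits each, and the index registers of $\mathcal O_A$ have $n$ qubits each. Here $r_{ik'}$ is the column index of the $k'$-th nonzero entry of row $i$ (counted from $0$), or $2^n+k'$ if there is none; $c_{lj}$ is defined likewise for the columns; and $\tilde a_{ij}$ is a $b$-qubit fixed-point complex number (real and imaginary part in two's complement, with $m$ fractional bits each) with $|\tilde a_{ij}-a_{ij}/c_{\rm sp}|\le\varepsilon/(2\alpha)$. -/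

import Mathlib

/-! ## Norms, sparsity and padding -/

section Norms
open scoped Matrix.Norms.L2Operator

/-- The spectral norm (operator `2`-norm) of a complex, possibly rectangular, matrix. -/
noncomputable def specNorm {ι κ : Type} [Fintype ι] [Fintype κ] [DecidableEq κ]
    (M : Matrix ι κ ℂ) : ℝ := ‖M‖

end Norms

/-- Every row of `M` has at most `s` nonzero entries. -/
def RowSparse {ι κ : Type} (s : ℕ) (M : Matrix ι κ ℂ) : Prop :=
  ∀ i, {j | M i j ≠ 0}.encard ≤ (s : ℕ∞)

/-- Every column of `M` has at most `s` nonzero entries. -/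
def ColSparse {ι κ : Type} (s : ℕ) (M : Matrix ι κ ℂ) : Prop :=
  ∀ j, {i | M i j ≠ 0}.encard ≤ (s : ℕ∞)

/-- The number of nonzero entries of `M`. -/
noncomputable def numNonzero {ι κ : Type} (M : Matrix ι κ ℂ) : ℕ∞ :=
  {p : ι × κ | M p.1 p.2 ≠ 0}.encard

/-- The matrix `M` written as a `2^n × 2^n` matrix by numbering its index set with `e`;
all remaining rows and columns are zero. -/
noncomputable def padMatrix {ι : Type} {n : ℕ} (e : ι ↪ Fin (2 ^ n)) (M : Matrix ι ι ℂ) :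
    Matrix (Fin (2 ^ n)) (Fin (2 ^ n)) ℂ :=
  fun i j => Function.extend (Prod.map e e) (fun p => M p.1 p.2) 0 (i, j)

/-! ## Hierarchically block separable (HBS) factorizations -/

/-- The cells of the regular dyadic grid with `2^h` cells in each of `d` directions, that is, the
nodes of a full `2^d`-ary spatial tree at distance `h` from its root. -/
abbrev Cell (d h : ℕ) : Type := Fin d → Fin (2 ^ h)

/-- The parent of a cell: halve all coordinates. -/
def Cell.parent {d h : ℕ} (c : Cell d (h + 1)) : Cell d h :=
  fun t => ⟨(c t : ℕ) / 2, by
    have h₁ := (c t).isLt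
    have h₂ := pow_succ 2 h
    omega⟩

/-- Two cells are near if they are equal or touch: all coordinates differ by at most one. -/
def Cell.Near {d h : ℕ} (c c' : Cell d h) : Prop :=
  ∀ t, (c t : ℕ) ≤ c' t + 1 ∧ (c' t : ℕ) ≤ c t + 1

/-- Interpolative decomposition `M ≈ M(:, s) P` with tolerance `tol`: `s` selects the skeleton
columns of `M`, and the interpolation matrix `P` is the identity on them. All entries of `P` are
bounded by the parameter `f` of the strong rank-revealing QR factorization. -/
def IsColumnID {α β κ : Type} [Fintype α] [Fintype β] [Fintype κ] [DecidableEq β]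
    [DecidableEq κ] (f tol : ℝ) (M : Matrix α β ℂ) (s : κ → β) (P : Matrix κ β ℂ) : Prop :=
  Function.Injective s ∧ P.submatrix id s = 1 ∧ (∀ k j, ‖P k j‖ ≤ f) ∧
    specNorm (M - M.submatrix id s * P) ≤ tol

/-- Interpolative decomposition `M ≈ U M(s, :)` of the rows of `M`. -/
def IsRowID {α β κ : Type} [Fintype α] [Fintype β] [Fintype κ] [DecidableEq α]
    [DecidableEq κ] (f tol : ℝ) (M : Matrix α β ℂ) (s : κ → α) (U : Matrix α κ ℂ) : Prop :=
  IsColumnID f tol M.transpose s U.transpose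

open scoped Classical in
/-- The bases computed at one level. The current matrix is `S`, and `blk` assigns to each active
(row or column) index the cell that contains it. For every cell `p`, the submatrix of `S` with
rows in `p` and columns in the far field of `p` has a row ID with `r` skeleton rows and basis
`U p`; the submatrix with columns in `p` and rows in the far field has a column ID with `r`
skeleton columns and basis `V p`. -/
structure HBSLevel (d r : ℕ) (f tol : ℝ) {h : ℕ} {ι : Type} [Fintype ι]
    (blk : ι → Cell d h) (S : Matrix ι ι ℂ) where
  rowSkel : (p : Cell d h) → Fin r → {i // blk i = p}
  colSkel : (p : Cell d h) → Fin r → {j // blk j = p}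
  U : (p : Cell d h) → Matrix {i // blk i = p} (Fin r) ℂ
  V : (p : Cell d h) → Matrix (Fin r) {j // blk j = p} ℂ
  rowID : ∀ p, IsRowID f tol
    (S.submatrix Subtype.val Subtype.val :
      Matrix {i // blk i = p} {j // ¬ Cell.Near p (blk j)} ℂ) (rowSkel p) (U p)
  colID : ∀ p, IsColumnID f tol
    (S.submatrix Subtype.val Subtype.val :
      Matrix {i // ¬ Cell.Near (blk i) p} {j // blk j = p} ℂ) (colSkel p) (V p)

open scoped Classical in
/-- The factor `D`: all near-field blocks of `S`. -/
noncomputable def nearField {d h : ℕ} {ι : Type} (blk : ι → Cell d h) (S : Matrix ι ι ℂ) :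
    Matrix ι ι ℂ :=
  fun i j => if Cell.Near (blk i) (blk j) then S i j else 0

namespace HBSLevel

variable {d r : ℕ} {f tol : ℝ} {h : ℕ} {ι : Type} [Fintype ι]
  {blk : ι → Cell d h} {S : Matrix ι ι ℂ}

open scoped Classical in
/-- The factor `L = blkdiag (U p)`. -/
noncomputable def L (B : HBSLevel d r f tol blk S) : Matrix ι (Cell d h × Fin r) ℂ :=
  fun i q => if hi : blk i = q.1 then B.U q.1 ⟨i, hi⟩ q.2 else 0

open scoped Classical in
/-- The factor `R = blkdiag (V p)`. -/
noncomputable def R (B : HBSLevel d r f tol blk S) : Matrix (Cell d h × Fin r) ι ℂ :=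
  fun q j => if hj : blk j = q.1 then B.V q.1 q.2 ⟨j, hj⟩ else 0

/-- The skeleton matrix: the submatrix of `S - D` on the skeleton rows and columns. -/
noncomputable def skeleton (B : HBSLevel d r f tol blk S) :
    Matrix (Cell d h × Fin r) (Cell d h × Fin r) ℂ :=
  (S - nearField blk S).submatrix
    (fun q => (B.rowSkel q.1 q.2 : ι)) (fun q => (B.colSkel q.1 q.2 : ι))

end HBSLevel

/-- The output of the recursive compression of `S` when `h` levels are still to be processed.
At each level the skeleton matrix is passed on, and its active indices are grouped by the
parents of their cells. When no level is left, `S` itself is the last diagonal factor. -/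
def HBSFactors (d r : ℕ) (f tol : ℝ) :
    (h : ℕ) → (ι : Type) → [Fintype ι] → (ι → Cell d h) → Matrix ι ι ℂ → Type
  | 0, _, _, _, _ => Unit
  | h + 1, _, _, blk, S =>
      (B : HBSLevel d r f tol blk S) ×
        HBSFactors d r f tol h (Cell d (h + 1) × Fin r) (fun q => q.1.parent) B.skeleton

/-- The index set of the extended system: the variables `x` (indexed by `ι`), then `y` of the
first level, then the variables of the extended system for the skeleton matrix (whose first
block is `z` of the first level). -/
def SpIndex (d r : ℕ) : (h : ℕ) → (ι : Type) → Type
  | 0, ι => ι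
  | h + 1, ι => ι ⊕ ((Cell d (h + 1) × Fin r) ⊕ SpIndex d r h (Cell d (h + 1) × Fin r))

/-- The position of the first block of variables in the extended system. -/
def SpIndex.first (d r : ℕ) : (h : ℕ) → (ι : Type) → ι → SpIndex d r h ι
  | 0, _, i => i
  | _ + 1, _, i => Sum.inl i

open scoped Classical in
/-- The block `-I` that couples `y` to the first block of the remaining system. -/
noncomputable def couple (d r h : ℕ) (κ : Type) : Matrix κ (SpIndex d r h κ) ℂ :=
  fun k b => if b = SpIndex.first d r h κ k then -1 else 0

/-- The extended sparse matrix, by the recursion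
```
        D   L   0
        R   0  -I
        0  -I   S'
```
where `S'` is the extended sparse matrix of the skeleton matrix and `-I` couples to its first
block. Written out, this is the block tridiagonal matrix with diagonal blocks
`D₁, 0, D₂, 0, …, D_λ, 0, D_{λ+1}`, superdiagonal blocks `L₁, -I, L₂, -I, …, L_λ, -I` and
subdiagonal blocks `R₁, -I, R₂, -I, …, R_λ, -I`. -/
noncomputable def extSparse (d r : ℕ) (f tol : ℝ) :
    (h : ℕ) → (ι : Type) → [Fintype ι] → (blk : ι → Cell d h) → (S : Matrix ι ι ℂ) →
      HBSFactors d r f tol h ι blk S → Matrix (SpIndex d r h ι) (SpIndex d r h ι) ℂ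
  | 0, _, _, _, S, _ => S
  | h + 1, _, _, blk, S, ⟨B, F⟩ =>
      let S' := extSparse d r f tol h (Cell d (h + 1) × Fin r) (fun q => q.1.parent) B.skeleton F
      let J := couple d r h (Cell d (h + 1) × Fin r)
      Matrix.fromBlocks
        (nearField blk S) (Matrix.fromCols B.L 0)
        (Matrix.fromRows B.R 0) (Matrix.fromBlocks 0 J J.transpose S')

/-- A hierarchical representation of depth `depth` of an `N × N` matrix `A`: a spatial tree that
places `n₁` indices in each of its `2^(d * depth)` leaves, and the factors produced by the
recursive compression with rank `r`, tolerance `tol` and strong RRQR parameter `f`. -/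
structure HBSRep (d n₁ r depth N : ℕ) (f tol : ℝ) (A : Matrix (Fin N) (Fin N) ℂ) where
  leaf : Fin N → Cell d depth
  leaf_card : ∀ c, Nat.card {i // leaf i = c} = n₁
  factors : HBSFactors d r f tol depth (Fin N) leaf A

/-- The extended sparsification `A_sp` of a hierarchically represented matrix. -/
noncomputable def HBSRep.Asp {d n₁ r depth N : ℕ} {f tol : ℝ} {A : Matrix (Fin N) (Fin N) ℂ}
    (H : HBSRep d n₁ r depth N f tol A) :
    Matrix (SpIndex d r depth (Fin N)) (SpIndex d r depth (Fin N)) ℂ :=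
  extSparse d r f tol depth (Fin N) H.leaf A H.factors

/-! ## Quantum circuits with oracle queries -/

/-- Unitary operators on the qubits labelled by `Q`; computational basis states are `Q → Bool`. -/
abbrev QUnitary (Q : Type) [Fintype Q] [DecidableEq Q] : Type :=
  Matrix.unitaryGroup (Q → Bool) ℂ

/-- The computational basis vector `|x⟩`. -/
def ket {Q : Type} [Fintype Q] [DecidableEq Q] (x : Q → Bool) : (Q → Bool) → ℂ := Pi.single x 1

/-- The `m`-bit binary expansion of `x` (bit `t` has weight `2^t`). -/
def bits (m x : ℕ) : Fin m → Bool := fun t => x.testBit t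

open scoped Classical in
/-- `U` applied to the qubits selected by `e`, tensored with the identity on all others. -/
noncomputable def applyOn {K Q : Type} (e : K ↪ Q) (U : Matrix (K → Bool) (K → Bool) ℂ) :
    Matrix (Q → Bool) (Q → Bool) ℂ :=
  fun x y => if ∀ q, q ∉ Set.range e → x q = y q then U (x ∘ e) (y ∘ e) else 0

/-- Qubits of the index oracles: two registers of `n + 1` qubits. -/
abbrev IndexQubits (n : ℕ) : Type := Fin (n + 1) ⊕ Fin (n + 1)

/-- Qubits that hold a fixed-point complex number: two signed numbers (real and imaginary part)
with `m` fractional bits and a sign bit, so `2 * (m + 1)` qubits in all. -/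
abbrev ValueQubits (m : ℕ) : Type := Fin (m + 1) ⊕ Fin (m + 1)

/-- Qubits of the entry oracle: two index registers of `n` qubits, and a value register. -/
abbrev EntryQubits (n m : ℕ) : Type := (Fin n ⊕ Fin n) ⊕ ValueQubits m

/-- One step of a circuit on the qubits `Q`: an arbitrary one- or two-qubit gate, or a query to
one of the three oracles or (if the flag is set) to its inverse. -/
inductive Instr (n m : ℕ) (Q : Type) : Type
  | gate1 (e : Fin 1 ↪ Q) (U : QUnitary (Fin 1))
  | gate2 (e : Fin 2 ↪ Q) (U : QUnitary (Fin 2))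
  | queryR (inverse : Bool) (e : IndexQubits n ↪ Q)
  | queryC (inverse : Bool) (e : IndexQubits n ↪ Q)
  | queryA (inverse : Bool) (e : EntryQubits n m ↪ Q)

/-- The three oracles. -/
structure Oracles (n m : ℕ) where
  Or : QUnitary (IndexQubits n)
  Oc : QUnitary (IndexQubits n)
  OA : QUnitary (EntryQubits n m)

namespace Instr

variable {n m : ℕ} {Q : Type}

/-- The operator performed by a step. -/
noncomputable def matrix (O : Oracles n m) : Instr n m Q → Matrix (Q → Bool) (Q → Bool) ℂ
  | gate1 e U => applyOn e U.val
  | gate2 e U => applyOn e U.val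
  | queryR inv e => applyOn e (if inv then (O.Or⁻¹).val else O.Or.val)
  | queryC inv e => applyOn e (if inv then (O.Oc⁻¹).val else O.Oc.val)
  | queryA inv e => applyOn e (if inv then (O.OA⁻¹).val else O.OA.val)

def isGate : Instr n m Q → Bool
  | gate1 _ _ => true
  | gate2 _ _ => true
  | _ => false

def isQueryR : Instr n m Q → Bool
  | queryR _ _ => true
  | _ => false

def isQueryC : Instr n m Q → Bool
  | queryC _ _ => true
  | _ => false

def isQueryA : Instr n m Q → Bool
  | queryA _ _ => true
  | _ => false

end Instr

/-- The operator performed by a circuit; the head of the list is applied first. -/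
noncomputable def circuitMatrix {n m : ℕ} {Q : Type} [Fintype Q] [DecidableEq Q]
    (O : Oracles n m) : List (Instr n m Q) → Matrix (Q → Bool) (Q → Bool) ℂ
  | [] => 1
  | g :: gs => circuitMatrix O gs * g.matrix O

/-- A circuit with operator `W` on the qubits `Q` and `w` additional workspace qubits implements
`U`: if the workspace starts in `|0⟩`, then `U` is applied to `Q` and the workspace ends
in `|0⟩`. -/
def Implements {Q : Type} [Fintype Q] [DecidableEq Q] {w : ℕ}
    (W : Matrix (Q ⊕ Fin w → Bool) (Q ⊕ Fin w → Bool) ℂ) (U : QUnitary Q) : Prop :=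
  ∀ (x y : Q → Bool) (u : Fin w → Bool),
    W (Sum.elim x u) (Sum.elim y (fun _ => false)) =
      if u = (fun _ => false) then U.val x y else 0

/-- The block `(⟨0|^a ⊗ I) U (|0⟩^a ⊗ I)` of an `(a + n)`-qubit unitary. -/
def topBlock {n a : ℕ} (U : QUnitary (Fin a ⊕ Fin n)) : Matrix (Fin (2 ^ n)) (Fin (2 ^ n)) ℂ :=
  fun i j => U.val (Sum.elim (fun _ => false) (bits n i)) (Sum.elim (fun _ => false) (bits n j))

/-- `U` is an `(α, a, ε)`-block-encoding of the `2^n × 2^n` matrix `A`. -/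
def IsBlockEncoding {n : ℕ} (α : ℝ) (a : ℕ) (ε : ℝ) (A : Matrix (Fin (2 ^ n)) (Fin (2 ^ n)) ℂ)
    (U : QUnitary (Fin a ⊕ Fin n)) : Prop :=
  specNorm A ≤ α ∧ specNorm (A - (α : ℂ) • topBlock U) ≤ ε

/-! ## Sparse-access oracles -/

open scoped Classical in
/-- The column index of the `k`-th nonzero entry (counted from `0`, from left to right) in row `i`
of `A`, and `2^n + k` if there is no such entry. -/
noncomputable def rowIndex {n : ℕ} (A : Matrix (Fin (2 ^ n)) (Fin (2 ^ n)) ℂ)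
    (i : Fin (2 ^ n)) (k : ℕ) : ℕ :=
  let T : Finset (Fin (2 ^ n)) := Finset.univ.filter (fun j => A i j ≠ 0)
  if hk : k < T.card then (T.orderEmbOfFin rfl ⟨k, hk⟩ : ℕ) else 2 ^ n + k

/-- The row index of the `l`-th nonzero entry in column `j` of `A`, and `2^n + l` if there is no
such entry. -/
noncomputable def colIndex {n : ℕ} (A : Matrix (Fin (2 ^ n)) (Fin (2 ^ n)) ℂ)
    (l : ℕ) (j : Fin (2 ^ n)) : ℕ := rowIndex A.transpose j l

/-- `|i⟩|k⟩ ↦ |i⟩|r_{ik}⟩` for `k < s`. -/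
def IsRowOracle {n : ℕ} (s : ℕ) (A : Matrix (Fin (2 ^ n)) (Fin (2 ^ n)) ℂ)
    (O : QUnitary (IndexQubits n)) : Prop :=
  ∀ (i : Fin (2 ^ n)) (k : ℕ), k < s →
    O.val.mulVec (ket (Sum.elim (bits (n + 1) i) (bits (n + 1) k))) =
      ket (Sum.elim (bits (n + 1) i) (bits (n + 1) (rowIndex A i k)))

/-- `|l⟩|j⟩ ↦ |c_{lj}⟩|j⟩` for `l < s`. -/
def IsColOracle {n : ℕ} (s : ℕ) (A : Matrix (Fin (2 ^ n)) (Fin (2 ^ n)) ℂ)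
    (O : QUnitary (IndexQubits n)) : Prop :=
  ∀ (j : Fin (2 ^ n)) (l : ℕ), l < s →
    O.val.mulVec (ket (Sum.elim (bits (n + 1) l) (bits (n + 1) j))) =
      ket (Sum.elim (bits (n + 1) (colIndex A l j)) (bits (n + 1) j))

/-- The two's complement fixed-point number in `[-1, 1)` with `m` fractional bits. -/
noncomputable def fixedReal {m : ℕ} (v : Fin (m + 1) → Bool) : ℝ :=
  ((∑ t : Fin m, if v t.castSucc then (2 : ℝ) ^ (t : ℕ) else 0) -
    (if v (Fin.last m) then (2 : ℝ) ^ m else 0)) / 2 ^ m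

/-- The complex number held by a value register. -/
noncomputable def fixedComplex {m : ℕ} (v : ValueQubits m → Bool) : ℂ :=
  ⟨fixedReal (fun t => v (Sum.inl t)), fixedReal (fun t => v (Sum.inr t))⟩

/-- `|i⟩|j⟩|0⟩ ↦ |i⟩|j⟩|ã_{ij}⟩`, where `ã_{ij}` is a fixed-point number that represents
`A i j / c` up to the rounding error `δ`. -/
def IsEntryOracle {n m : ℕ} (c δ : ℝ) (A : Matrix (Fin (2 ^ n)) (Fin (2 ^ n)) ℂ)
    (O : QUnitary (EntryQubits n m)) : Prop :=
  ∀ i j : Fin (2 ^ n), ∃ v : ValueQubits m → Bool,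
    ‖fixedComplex v - A i j / (c : ℂ)‖ ≤ δ ∧
    O.val.mulVec (ket (Sum.elim (Sum.elim (bits n i) (bits n j)) (fun _ => false))) =
      ket (Sum.elim (Sum.elim (bits n i) (bits n j)) v)

set_option linter.unusedSectionVars false

/-! ## Operators on selected qubits -/

section ApplyOn

variable {K K' Q : Type} [Fintype K] [DecidableEq K] [Fintype K'] [DecidableEq K']
  [Fintype Q] [DecidableEq Q]

/-! The sparsity statement is an induction over the levels of the tree. In a row of the `x` block
the near field contributes at most `3^d` cells of bounded occupancy, and `L` contributes `r`
entries. A row of the `y` block meets one block of `R` and a single `-1`. A row of the skeleton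
system gains at most one `-1`, and only if it lies in the first block. A cell holds `n₁` indices at
the finest level and at most `2^d r` afterwards, so all bounds are uniform in the depth. Columns
follow by transposition. The size is a geometric sum. Entries do not grow, because each skeleton
matrix is a submatrix of `S - D` and interpolation matrices are bounded by `f` (`extSparse_sparse`,
`card_spIndex_le`, `norm_extSparse_le`).

The block encoding is an overlap of two superpositions. From `|j⟩` one prepares the uniform
superposition of `|c_{lj}⟩|j⟩`, from `|i⟩` that of `|i⟩|r_{ik}⟩`, and in between a flag qubit is
rotated so that its `00` amplitude `D i j` approximates `A i j / c`. If `A i j ≠ 0`, exactly one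
pair `(k, l)` makes the two basis states agree; otherwise none does (`sum_sum_ite_rowIndex`). The
encoded entry is therefore `D i j / √(sr sc)`, and exactly zero where `A` is zero. The error matrix
inherits the sparsity of `A`, and the Schur-type bound `specNorm_le_of_sparse` turns an entrywise
error into a spectral one without loss.

The remaining work is the rotation, with cost polylogarithmic in `α / ε` and independent of `m`. A
number in the unit disc is `cos a + i sin a cos b`, an entry of a product of one-qubit rotations
(`amplitudeGate_apply`). The angles are written as subset sums of `2 arctan 2^(-k)`. Their cosines
and sines are rational, so a greedy search for the digits runs in exact integer arithmetic
(`cordicSum_bounds`). The vertical component left by the search for `a` serves as the radius of the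
search for `b`, so no square root is taken (`cordic_amplitude`). Only the leading `O(log (2 + α /
ε))` bits of the value register are read. With `T` digits there are `O(T^2)` operations on registers
of `O(T^2)` bits, hence a NAND program of length `O(T^4)` (`exists_angleProgram`). It is evaluated
reversibly, its digits control fixed rotations, and it is then uncomputed. -/

theorem mulVec_ket (M : Matrix (Q → Bool) (Q → Bool) ℂ) (x : Q → Bool) :
    M.mulVec (ket x) = fun y => M y x := by
  unfold ket
  rw [Matrix.mulVec_single_one]
  rfl

theorem ket_apply (x y : Q → Bool) : ket x y = if y = x then 1 else 0 := by
  unfold ket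
  rw [Pi.single_apply]

theorem matrix_ext_ket {M N : Matrix (Q → Bool) (Q → Bool) ℂ}
    (h : ∀ x, M.mulVec (ket x) = N.mulVec (ket x)) : M = N := by
  ext y x
  have := congrFun (h x) y
  rwa [mulVec_ket, mulVec_ket] at this

theorem eq_extend_iff (e : K ↪ Q) (k : K → Bool) (x y : Q → Bool) :
    y = Function.extend e k x ↔ k = y ∘ e ∧ ∀ q, q ∉ Set.range e → y q = x q := by
  constructor
  · rintro rfl
    refine ⟨?_, fun q hq => ?_⟩
    · funext a; simp [e.injective.extend_apply]
    · exact Function.extend_apply' _ _ _ (fun ⟨a, ha⟩ => hq ⟨a, ha⟩)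
  · rintro ⟨rfl, h⟩
    funext q
    by_cases hq : q ∈ Set.range e
    · obtain ⟨a, rfl⟩ := hq
      simp [e.injective.extend_apply]
    · rw [h q hq, Function.extend_apply' _ _ _ (fun ⟨a, ha⟩ => hq ⟨a, ha⟩)]

theorem extend_comp_self (e : K ↪ Q) (k : K → Bool) (x : Q → Bool) :
    Function.extend e k x ∘ e = k := by
  funext a; simp [e.injective.extend_apply]

theorem extend_extend (e : K ↪ Q) (k l : K → Bool) (x : Q → Bool) :
    Function.extend e l (Function.extend e k x) = Function.extend e l x := by
  rw [eq_extend_iff]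
  refine ⟨(extend_comp_self e l _).symm, fun q hq => ?_⟩
  rw [Function.extend_apply' _ _ _ (fun ⟨a, ha⟩ => hq ⟨a, ha⟩),
    Function.extend_apply' _ _ _ (fun ⟨a, ha⟩ => hq ⟨a, ha⟩)]

theorem extend_comp_eq (e : K ↪ Q) (x : Q → Bool) : Function.extend e (x ∘ e) x = x :=
  ((eq_extend_iff e _ x x).2 ⟨rfl, fun _ _ => rfl⟩).symm

/-- Operators are compared column by column, that is, on basis states. Almost every circuit identity
below is reduced to this formula. -/
theorem applyOn_mulVec_ket (e : K ↪ Q) (U : Matrix (K → Bool) (K → Bool) ℂ) (x : Q → Bool) :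
    (applyOn e U).mulVec (ket x) = ∑ k, U k (x ∘ e) • ket (Function.extend e k x) := by
  rw [mulVec_ket]
  funext y
  rw [Finset.sum_apply]
  simp only [Pi.smul_apply, ket_apply, smul_eq_mul, eq_extend_iff, applyOn, mul_ite, mul_one,
    mul_zero]
  by_cases h : ∀ q, q ∉ Set.range e → y q = x q
  · rw [if_pos h, Finset.sum_eq_single (y ∘ e)]
    · rw [if_pos ⟨rfl, h⟩]
    · intro k _ hk
      rw [if_neg (fun h' => hk h'.1)]
    · simp
  · rw [if_neg h, Finset.sum_eq_zero]
    intro k _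
    rw [if_neg (fun h' => h h'.2)]

theorem applyOn_one (e : K ↪ Q) : applyOn e (1 : Matrix (K → Bool) (K → Bool) ℂ) = 1 := by
  apply matrix_ext_ket
  intro x
  rw [applyOn_mulVec_ket, Matrix.one_mulVec, Finset.sum_eq_single (x ∘ e)]
  · rw [extend_comp_eq]; simp
  · intro k _ hk; simp [Matrix.one_apply_ne hk]
  · simp

theorem mulVec_finsetSum {ι : Type} (s : Finset ι) (M : Matrix (Q → Bool) (Q → Bool) ℂ)
    (c : ι → ℂ) (v : ι → (Q → Bool) → ℂ) :
    M.mulVec (∑ i ∈ s, c i • v i) = ∑ i ∈ s, c i • M.mulVec (v i) := by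
  rw [Matrix.mulVec_sum]
  simp [Matrix.mulVec_smul]

theorem applyOn_mul (e : K ↪ Q) (U V : Matrix (K → Bool) (K → Bool) ℂ) :
    applyOn e (U * V) = applyOn e U * applyOn e V := by
  apply matrix_ext_ket
  intro x
  rw [← Matrix.mulVec_mulVec, applyOn_mulVec_ket, applyOn_mulVec_ket, mulVec_finsetSum]
  simp only [applyOn_mulVec_ket, extend_comp_self, extend_extend, Finset.smul_sum, smul_smul]
  rw [Finset.sum_comm]
  refine Finset.sum_congr rfl fun l _ => ?_
  rw [← Finset.sum_smul, Matrix.mul_apply]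
  congr 1
  exact Finset.sum_congr rfl fun k _ => mul_comm _ _

theorem applyOn_conjTranspose (e : K ↪ Q) (U : Matrix (K → Bool) (K → Bool) ℂ) :
    applyOn e U.conjTranspose = (applyOn e U).conjTranspose := by
  ext x y
  simp only [applyOn, Matrix.conjTranspose_apply]
  have : (∀ q, q ∉ Set.range e → x q = y q) ↔ (∀ q, q ∉ Set.range e → y q = x q) :=
    ⟨fun h q hq => (h q hq).symm, fun h q hq => (h q hq).symm⟩
  by_cases h : ∀ q, q ∉ Set.range e → x q = y q
  · rw [if_pos h, if_pos (this.1 h)]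
  · rw [if_neg h, if_neg (fun h' => h (this.2 h')), star_zero]

theorem applyOn_trans (e : K ↪ K') (e' : K' ↪ Q) (U : Matrix (K → Bool) (K → Bool) ℂ) :
    applyOn (e.trans e') U = applyOn e' (applyOn e U) := by
  ext x y
  simp only [applyOn]
  have : (∀ q, q ∉ Set.range (e.trans e') → x q = y q) ↔
      (∀ q, q ∉ Set.range e' → x q = y q) ∧
        ∀ k, k ∉ Set.range e → (x ∘ e') k = (y ∘ e') k := by
    constructor
    · intro h
      refine ⟨fun q hq => h q ?_, fun k hk => h (e' k) ?_⟩
      · rintro ⟨a, rfl⟩; exact hq ⟨e a, rfl⟩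
      · rintro ⟨a, ha⟩; exact hk ⟨a, e'.injective ha⟩
    · rintro ⟨h1, h2⟩ q hq
      by_cases hq' : q ∈ Set.range e'
      · obtain ⟨k, rfl⟩ := hq'
        exact h2 k (fun ⟨a, ha⟩ => hq ⟨a, by simp [ha]⟩)
      · exact h1 q hq'
  by_cases h1 : ∀ q, q ∉ Set.range e' → x q = y q
  · by_cases h2 : ∀ k, k ∉ Set.range e → (x ∘ e') k = (y ∘ e') k
    · rw [if_pos (this.2 ⟨h1, h2⟩), if_pos h1, if_pos h2]; rfl
    · rw [if_neg (fun h => h2 (this.1 h).2), if_pos h1, if_neg h2]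
  · rw [if_neg (fun h => h1 (this.1 h).1), if_neg h1]

theorem applyOn_equiv (σ : K ≃ Q) (U : Matrix (K → Bool) (K → Bool) ℂ) (x y : Q → Bool) :
    applyOn σ.toEmbedding U x y = U (x ∘ σ) (y ∘ σ) := by
  unfold applyOn
  rw [if_pos]
  · rfl
  · intro q hq
    exact absurd ⟨σ.symm q, by simp⟩ hq

/-- A gate that maps a basis state to a basis state does so on a larger set of qubits. -/
theorem applyOn_mulVec_ket_of (e : K ↪ Q) {U : Matrix (K → Bool) (K → Bool) ℂ} {x : Q → Bool}
    {k : K → Bool} (h : U.mulVec (ket (x ∘ e)) = ket k) :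
    (applyOn e U).mulVec (ket x) = ket (Function.extend e k x) := by
  rw [applyOn_mulVec_ket, Finset.sum_eq_single k]
  · have : U k (x ∘ e) = ket k k := by
      have := congrFun h k
      rwa [mulVec_ket] at this
    rw [this, ket_apply, if_pos rfl, one_smul]
  · intro l _ hl
    have : U l (x ∘ e) = ket k l := by
      have := congrFun h l
      rwa [mulVec_ket] at this
    rw [this, ket_apply, if_neg hl, zero_smul]
  · simp

end ApplyOn

/-! ## Circuits -/

section Circuit

variable {n m : ℕ} {K Q : Type} [Fintype K] [DecidableEq K] [Fintype Q] [DecidableEq Q]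

namespace Instr

/-- The inverse of a step. -/
def inv : Instr n m Q → Instr n m Q
  | gate1 e U => gate1 e U⁻¹
  | gate2 e U => gate2 e U⁻¹
  | queryR b e => queryR (!b) e
  | queryC b e => queryC (!b) e
  | queryA b e => queryA (!b) e

/-- The same step on the qubits selected by `σ`. -/
def mapQubits (σ : K ↪ Q) : Instr n m K → Instr n m Q
  | gate1 e U => gate1 (e.trans σ) U
  | gate2 e U => gate2 (e.trans σ) U
  | queryR b e => queryR b (e.trans σ)
  | queryC b e => queryC b (e.trans σ)
  | queryA b e => queryA b (e.trans σ)

theorem matrix_mapQubits (O : Oracles n m) (σ : K ↪ Q) (g : Instr n m K) :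
    (g.mapQubits σ).matrix O = applyOn σ (g.matrix O) := by
  cases g <;> simp only [mapQubits, matrix, applyOn_trans]

theorem matrix_inv (O : Oracles n m) (g : Instr n m Q) :
    g.inv.matrix O = (g.matrix O).conjTranspose := by
  have key : ∀ {K : Type} [Fintype K] [DecidableEq K] (U : QUnitary K),
      (U⁻¹).val = U.val.conjTranspose := fun U => rfl
  cases g with
  | gate1 e U => simp only [inv, matrix, ← applyOn_conjTranspose]; rfl
  | gate2 e U => simp only [inv, matrix, ← applyOn_conjTranspose]; rfl
  | queryR b e => cases b <;> simp [inv, matrix, ← applyOn_conjTranspose, key]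
  | queryC b e => cases b <;> simp [inv, matrix, ← applyOn_conjTranspose, key]
  | queryA b e => cases b <;> simp [inv, matrix, ← applyOn_conjTranspose, key]

theorem matrix_conjTranspose_mul (O : Oracles n m) (g : Instr n m Q) :
    (g.matrix O).conjTranspose * g.matrix O = 1 := by
  have key : ∀ {K : Type} [Fintype K] [DecidableEq K] (e : K ↪ Q) (U : QUnitary K),
      (applyOn e U.val).conjTranspose * applyOn e U.val = 1 := by
    intro K _ _ e U
    rw [← applyOn_conjTranspose, ← applyOn_mul]
    have : U.val.conjTranspose * U.val = 1 := Unitary.star_mul_self_of_mem U.2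
    rw [this, applyOn_one]
  cases g with
  | gate1 e U => exact key e U
  | gate2 e U => exact key e U
  | queryR b e => cases b; exacts [key e O.Or, key e O.Or⁻¹]
  | queryC b e => cases b; exacts [key e O.Oc, key e O.Oc⁻¹]
  | queryA b e => cases b; exacts [key e O.OA, key e O.OA⁻¹]

end Instr

theorem circuitMatrix_append (O : Oracles n m) (gs hs : List (Instr n m Q)) :
    circuitMatrix O (gs ++ hs) = circuitMatrix O hs * circuitMatrix O gs := by
  induction gs with
  | nil => simp [circuitMatrix]
  | cons g gs ih => simp [circuitMatrix, ih, Matrix.mul_assoc]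

theorem circuitMatrix_mapQubits (O : Oracles n m) (σ : K ↪ Q) (gs : List (Instr n m K)) :
    circuitMatrix O (gs.map (Instr.mapQubits σ)) = applyOn σ (circuitMatrix O gs) := by
  induction gs with
  | nil => simp [circuitMatrix, applyOn_one]
  | cons g gs ih => simp [circuitMatrix, ih, applyOn_mul, Instr.matrix_mapQubits]

theorem circuitMatrix_conjTranspose_mul (O : Oracles n m) (gs : List (Instr n m Q)) :
    (circuitMatrix O gs).conjTranspose * circuitMatrix O gs = 1 := by
  induction gs with
  | nil => simp [circuitMatrix]
  | cons g gs ih =>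
    rw [circuitMatrix, Matrix.conjTranspose_mul, Matrix.mul_assoc,
      ← Matrix.mul_assoc _ (circuitMatrix O gs), ih, Matrix.one_mul,
      Instr.matrix_conjTranspose_mul]

/-- The inverse of a circuit. -/
def adjCircuit (gs : List (Instr n m Q)) : List (Instr n m Q) := (gs.map Instr.inv).reverse

theorem circuitMatrix_adjCircuit (O : Oracles n m) (gs : List (Instr n m Q)) :
    circuitMatrix O (adjCircuit gs) = (circuitMatrix O gs).conjTranspose := by
  induction gs with
  | nil => simp [circuitMatrix, adjCircuit]
  | cons g gs ih =>
    have : adjCircuit (g :: gs) = adjCircuit gs ++ [g.inv] := by simp [adjCircuit]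
    rw [this, circuitMatrix_append, ih]
    simp [circuitMatrix, Instr.matrix_inv, Matrix.conjTranspose_mul]

theorem countP_mapQubits (σ : K ↪ Q) (gs : List (Instr n m K)) :
    (gs.map (Instr.mapQubits σ)).countP Instr.isGate = gs.countP Instr.isGate ∧
    (gs.map (Instr.mapQubits σ)).countP Instr.isQueryR = gs.countP Instr.isQueryR ∧
    (gs.map (Instr.mapQubits σ)).countP Instr.isQueryC = gs.countP Instr.isQueryC ∧
    (gs.map (Instr.mapQubits σ)).countP Instr.isQueryA = gs.countP Instr.isQueryA := by
  simp only [List.countP_map]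
  refine ⟨?_, ?_, ?_, ?_⟩ <;> congr 1 <;> funext g <;> cases g <;> rfl

theorem countP_adjCircuit (gs : List (Instr n m Q)) :
    (adjCircuit gs).countP Instr.isGate = gs.countP Instr.isGate ∧
    (adjCircuit gs).countP Instr.isQueryR = gs.countP Instr.isQueryR ∧
    (adjCircuit gs).countP Instr.isQueryC = gs.countP Instr.isQueryC ∧
    (adjCircuit gs).countP Instr.isQueryA = gs.countP Instr.isQueryA := by
  simp only [adjCircuit, List.countP_reverse, List.countP_map]
  refine ⟨?_, ?_, ?_, ?_⟩ <;> congr 1 <;> funext g <;> cases g <;> rfl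

/-- A circuit without oracle queries. -/
def GatesOnly (gs : List (Instr n m Q)) : Prop := ∀ g ∈ gs, g.isGate = true

theorem GatesOnly.append {gs hs : List (Instr n m Q)} (h₁ : GatesOnly gs) (h₂ : GatesOnly hs) :
    GatesOnly (gs ++ hs) := by
  intro g hg
  rcases List.mem_append.1 hg with h | h
  exacts [h₁ g h, h₂ g h]

theorem GatesOnly.mapQubits {gs : List (Instr n m K)} (h : GatesOnly gs) (σ : K ↪ Q) :
    GatesOnly (gs.map (Instr.mapQubits σ)) := by
  intro g hg
  obtain ⟨g', hg', rfl⟩ := List.mem_map.1 hg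
  have := h g' hg'
  cases g' <;> simp_all [Instr.isGate, Instr.mapQubits]

theorem GatesOnly.adjCircuit {gs : List (Instr n m Q)} (h : GatesOnly gs) :
    GatesOnly (adjCircuit gs) := by
  intro g hg
  simp only [_root_.adjCircuit, List.mem_reverse] at hg
  obtain ⟨g', hg', rfl⟩ := List.mem_map.1 hg
  have := h g' hg'
  cases g' <;> simp_all [Instr.isGate, Instr.inv]

theorem GatesOnly.countP {gs : List (Instr n m Q)} (h : GatesOnly gs) :
    gs.countP Instr.isGate = gs.length ∧ gs.countP Instr.isQueryR = 0 ∧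
    gs.countP Instr.isQueryC = 0 ∧ gs.countP Instr.isQueryA = 0 := by
  refine ⟨List.countP_eq_length.2 h, ?_, ?_, ?_⟩ <;>
  · rw [List.countP_eq_zero]
    intro g hg
    have := h g hg
    cases g <;> simp_all [Instr.isGate, Instr.isQueryR, Instr.isQueryC, Instr.isQueryA]

theorem length_adjCircuit (gs : List (Instr n m Q)) : (adjCircuit gs).length = gs.length := by
  simp [adjCircuit]

/-- Circuits are isometries, so an uncomputation is verified by running the circuit forwards on the
desired final state. No inverse circuit is ever traced gate by gate. -/
theorem circuitMatrix_adjCircuit_mulVec {O : Oracles n m} {gs : List (Instr n m Q)}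
    {u v : (Q → Bool) → ℂ} (h : (circuitMatrix O gs).mulVec u = v) :
    (circuitMatrix O (adjCircuit gs)).mulVec v = u := by
  rw [← h, circuitMatrix_adjCircuit, Matrix.mulVec_mulVec, circuitMatrix_conjTranspose_mul,
    Matrix.one_mulVec]

theorem circuitMatrix_append_mulVec (O : Oracles n m) (gs hs : List (Instr n m Q))
    (v : (Q → Bool) → ℂ) :
    (circuitMatrix O (gs ++ hs)).mulVec v =
      (circuitMatrix O hs).mulVec ((circuitMatrix O gs).mulVec v) := by
  rw [circuitMatrix_append, Matrix.mulVec_mulVec]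

theorem circuitMatrix_cons_mulVec (O : Oracles n m) (g : Instr n m Q) (hs : List (Instr n m Q))
    (v : (Q → Bool) → ℂ) :
    (circuitMatrix O (g :: hs)).mulVec v =
      (circuitMatrix O hs).mulVec ((g.matrix O).mulVec v) := by
  rw [circuitMatrix, Matrix.mulVec_mulVec]

end Circuit

/-! ## Boolean straight-line programs -/

section SLP

variable {V : Type}

/-- The function `f` is an input bit or has been computed by the program `fs`. -/
def Avail (fs : List ((V → Bool) → Bool)) (f : (V → Bool) → Bool) : Prop :=
  f ∈ fs ∨ ∃ k, f = fun v => v k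

/-- A straight-line program of NAND gates, given by the list of the functions that it computes
(the last one first). -/
inductive IsSLP : List ((V → Bool) → Bool) → Prop
  | nil : IsSLP []
  | nand {fs f g} : IsSLP fs → Avail fs f → Avail fs g → IsSLP ((fun v => !(f v && g v)) :: fs)

/-- A straight-line program that has the constant `false` at its disposal. -/
structure Ready (fs : List ((V → Bool) → Bool)) : Prop where
  slp : IsSLP fs
  const : Avail fs fun _ => false

/-- The program `gs` computes at least what `fs` does, with at most `c` additional gates. -/
structure SLPExt (c : ℕ) (fs gs : List ((V → Bool) → Bool)) : Prop where
  ready : Ready gs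
  mono : ∀ f, Avail fs f → Avail gs f
  len : gs.length ≤ fs.length + c

variable {fs gs hs : List ((V → Bool) → Bool)} {f g h : (V → Bool) → Bool}

theorem Ready.ext_refl (hf : Ready fs) (c : ℕ) : SLPExt c fs fs := ⟨hf, fun _ h => h, by omega⟩

theorem SLPExt.trans {c d e : ℕ} (h₁ : SLPExt c fs gs) (h₂ : SLPExt d gs hs) (hcd : c + d ≤ e) :
    SLPExt e fs hs :=
  ⟨h₂.ready, fun f hf => h₂.mono f (h₁.mono f hf), by have := h₁.len; have := h₂.len; omega⟩

theorem SLPExt.weaken {c d : ℕ} (h₁ : SLPExt c fs gs) (hcd : c ≤ d) : SLPExt d fs gs :=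
  ⟨h₁.ready, h₁.mono, by have := h₁.len; omega⟩

theorem Avail.cons (hf : Avail fs f) : Avail (g :: fs) f :=
  hf.imp (fun h => List.mem_cons_of_mem _ h) id

/-- NAND gates have no constants to start from, but one input bit suffices: three gates give `¬x`,
then `¬(x ∧ ¬x) = true`, then `¬true = false`. -/
theorem IsSLP.ready_of_nonempty [Nonempty V] :
    ∃ gs : List ((V → Bool) → Bool), Ready gs ∧ gs.length ≤ 3 := by
  obtain ⟨k⟩ := ‹Nonempty V›
  have h0 : ∀ fs, Avail fs (fun v : V → Bool => v k) := fun fs => Or.inr ⟨k, rfl⟩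
  have h1 := IsSLP.nand IsSLP.nil (h0 _) (h0 _)
  have h2 := IsSLP.nand h1 (h0 _) (Or.inl List.mem_cons_self)
  have h3 := IsSLP.nand h2 (Or.inl List.mem_cons_self) (Or.inl List.mem_cons_self)
  refine ⟨_, ⟨h3, Or.inl ?_⟩, by simp⟩
  convert List.mem_cons_self using 1
  funext v
  cases v k <;> rfl

theorem Ready.nand (hr : Ready fs) (hf : Avail fs f) (hg : Avail fs g) :
    ∃ gs, SLPExt 1 fs gs ∧ Avail gs fun v => !(f v && g v) :=
  ⟨_, ⟨⟨IsSLP.nand hr.slp hf hg, hr.const.cons⟩, fun _ h => h.cons, by simp⟩,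
    Or.inl List.mem_cons_self⟩

theorem Avail.congr (hf : Avail fs f) (h : ∀ v, f v = g v) : Avail fs g := by
  rwa [← funext h]

theorem Ready.not (hr : Ready fs) (hf : Avail fs f) :
    ∃ gs, SLPExt 1 fs gs ∧ Avail gs fun v => !(f v) := by
  obtain ⟨gs, h1, h2⟩ := hr.nand hf hf
  exact ⟨gs, h1, h2.congr fun v => by simp⟩

theorem Ready.and (hr : Ready fs) (hf : Avail fs f) (hg : Avail fs g) :
    ∃ gs, SLPExt 2 fs gs ∧ Avail gs fun v => f v && g v := by
  obtain ⟨gs, h1, h2⟩ := hr.nand hf hg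
  obtain ⟨hs, h3, h4⟩ := h1.ready.not h2
  exact ⟨hs, h1.trans h3 le_rfl, h4.congr fun v => by simp⟩

theorem Ready.or (hr : Ready fs) (hf : Avail fs f) (hg : Avail fs g) :
    ∃ gs, SLPExt 3 fs gs ∧ Avail gs fun v => f v || g v := by
  obtain ⟨gs, h1, h2⟩ := hr.not hf
  obtain ⟨hs, h3, h4⟩ := h1.ready.not (h1.mono _ hg)
  obtain ⟨is, h5, h6⟩ := h3.ready.nand (h3.mono _ h2) h4
  exact ⟨is, (h1.trans h3 le_rfl).trans h5 le_rfl, h6.congr fun v => by simp⟩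

theorem Ready.xor (hr : Ready fs) (hf : Avail fs f) (hg : Avail fs g) :
    ∃ gs, SLPExt 4 fs gs ∧ Avail gs fun v => f v ^^ g v := by
  obtain ⟨gs, h1, h2⟩ := hr.nand hf hg
  obtain ⟨hs, h3, h4⟩ := h1.ready.nand (h1.mono _ hf) h2
  obtain ⟨is, h5, h6⟩ := h3.ready.nand (h3.mono _ (h1.mono _ hg)) (h3.mono _ h2)
  obtain ⟨js, h7, h8⟩ := h5.ready.nand (h5.mono _ h4) h6
  exact ⟨js, ((h1.trans h3 le_rfl).trans h5 le_rfl).trans h7 le_rfl,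
    h8.congr fun v => by cases f v <;> cases g v <;> rfl⟩

theorem Ready.ite (hr : Ready fs) {d : (V → Bool) → Bool} (hd : Avail fs d) (hf : Avail fs f)
    (hg : Avail fs g) : ∃ gs, SLPExt 4 fs gs ∧ Avail gs fun v => if d v then f v else g v := by
  obtain ⟨gs, h1, h2⟩ := hr.not hd
  obtain ⟨hs, h3, h4⟩ := h1.ready.nand (h1.mono _ hd) (h1.mono _ hf)
  obtain ⟨is, h5, h6⟩ := h3.ready.nand (h3.mono _ h2) (h3.mono _ (h1.mono _ hg))
  obtain ⟨js, h7, h8⟩ := h5.ready.nand (h5.mono _ h4) h6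
  exact ⟨js, ((h1.trans h3 le_rfl).trans h5 le_rfl).trans h7 le_rfl,
    h8.congr fun v => by cases d v <;> cases f v <;> cases g v <;> rfl⟩

theorem Ready.atLeastTwo (hr : Ready fs) (hf : Avail fs f) (hg : Avail fs g) (hh : Avail fs h) :
    ∃ gs, SLPExt 12 fs gs ∧ Avail gs fun v => Bool.atLeastTwo (f v) (g v) (h v) := by
  obtain ⟨gs, h1, h2⟩ := hr.and hf hg
  obtain ⟨hs, h3, h4⟩ := h1.ready.and (h1.mono _ hf) (h1.mono _ hh)
  obtain ⟨is, h5, h6⟩ := h3.ready.and (h3.mono _ (h1.mono _ hg)) (h3.mono _ (h1.mono _ hh))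
  obtain ⟨js, h7, h8⟩ := h5.ready.or (h5.mono _ (h3.mono _ h2)) (h5.mono _ h4)
  obtain ⟨ks, h9, h10⟩ := h7.ready.or h8 (h7.mono _ h6)
  exact ⟨ks, (((h1.trans h3 le_rfl).trans h5 le_rfl).trans h7 le_rfl).trans h9 le_rfl, h10⟩

/-- If each of `B` wires can be computed at cost `c`, so can all of them at cost `c * B`. -/
theorem Ready.all (hr : Ready fs) (B c : ℕ) (F : ℕ → (V → Bool) → Bool)
    (step : ∀ i < B, ∀ gs, SLPExt (c * i) fs gs → ∃ hs, SLPExt c gs hs ∧ Avail hs (F i)) :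
    ∃ gs, SLPExt (c * B) fs gs ∧ ∀ i < B, Avail gs (F i) := by
  induction B with
  | zero => exact ⟨fs, hr.ext_refl _, by simp⟩
  | succ B ih =>
    obtain ⟨gs, h1, h2⟩ := ih fun i hi => step i (by omega)
    obtain ⟨hs, h3, h4⟩ := step B (by omega) gs h1
    refine ⟨hs, h1.trans h3 (by rw [Nat.mul_succ]), fun i hi => ?_⟩
    rcases Nat.lt_succ_iff_lt_or_eq.1 hi with h | rfl
    exacts [h3.mono _ (h2 i h), h4]

/-! ### Integer registers -/

/-- All bits of the `B`-bit two's complement representation of the integer `a` are available. -/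
def Holds (B : ℕ) (fs : List ((V → Bool) → Bool)) (a : (V → Bool) → ℤ) : Prop :=
  ∀ i < B, Avail fs fun v => (BitVec.ofInt B (a v)).getLsbD i

variable {B : ℕ} {a b : (V → Bool) → ℤ}

theorem Holds.mono {c : ℕ} (ha : Holds B fs a) (h : SLPExt c fs gs) : Holds B gs a :=
  fun i hi => h.mono _ (ha i hi)

theorem Holds.congr (ha : Holds B fs a) (h : ∀ v, a v = b v) : Holds B fs b := by
  rwa [← funext h]

/-- No gate is needed: a bit of the register is either the condition itself or the constant `false`.
-/
theorem Ready.holds_condConst (hr : Ready fs) (hf : Avail fs f) (c : ℤ) :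
    Holds B fs fun v => if f v then c else 0 := by
  intro i _
  by_cases hb : (BitVec.ofInt B c).getLsbD i = true
  · exact hf.congr fun v => by by_cases hv : f v = true <;> simp [hv, hb]
  · exact hr.const.congr fun v => by by_cases hv : f v = true <;> simp [hv, hb]

/-- Ripple-carry addition. The induction keeps the current carry available along with the sum bits
already found; each position costs two XORs and one majority, `4 + 4 + 12 = 20` gates. The result is
correct modulo `2^B`, so intermediate overflow is harmless. -/
theorem Ready.holds_add (hr : Ready fs) (ha : Holds B fs a) (hb : Holds B fs b) :
    ∃ gs, SLPExt (20 * B) fs gs ∧ Holds B gs fun v => a v + b v := by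
  have key : ∀ j ≤ B, ∃ gs, SLPExt (20 * j) fs gs ∧
      Avail gs (fun v => BitVec.carry j (BitVec.ofInt B (a v)) (BitVec.ofInt B (b v)) false) ∧
      ∀ i < j, Avail gs fun v => (BitVec.ofInt B (a v + b v)).getLsbD i := by
    intro j hj
    induction j with
    | zero => exact ⟨fs, hr.ext_refl _, hr.const.congr fun v => by simp, by simp⟩
    | succ j ih =>
      obtain ⟨gs, h1, hc, h2⟩ := ih (by omega)
      have haj := h1.mono _ (ha j hj)
      have hbj := h1.mono _ (hb j hj)
      obtain ⟨g1, e1, x1⟩ := h1.ready.xor hbj hc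
      obtain ⟨g2, e2, x2⟩ := e1.ready.xor (e1.mono _ haj) x1
      have e12 := e1.trans e2 le_rfl
      obtain ⟨g3, e3, x3⟩ := e2.ready.atLeastTwo (e12.mono _ haj) (e12.mono _ hbj)
        (e12.mono _ hc)
      refine ⟨g3, h1.trans (e12.trans e3 le_rfl) (by omega),
        x3.congr fun v => (BitVec.carry_succ _ _ _ _).symm, fun i hi => ?_⟩
      rcases Nat.lt_succ_iff_lt_or_eq.1 hi with h | rfl
      · exact (e12.trans e3 le_rfl).mono _ (h2 i h)
      · refine (e3.mono _ x2).congr fun v => ?_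
        rw [BitVec.ofInt_add, BitVec.getLsbD_add hj]
  obtain ⟨gs, h1, -, h2⟩ := key B le_rfl
  exact ⟨gs, h1, h2⟩

/-- In two's complement the bitwise complement of `a` represents `-a - 1`. -/
theorem Ready.holds_not (hr : Ready fs) (ha : Holds B fs a) :
    ∃ gs, SLPExt (1 * B) fs gs ∧ Holds B gs fun v => -a v - 1 := by
  refine hr.all B 1 _ fun i hi gs h1 => ?_
  obtain ⟨hs, h2, h3⟩ := h1.ready.not (h1.mono _ (ha i hi))
  refine ⟨hs, h2, h3.congr fun v => ?_⟩
  have : BitVec.ofInt B (-a v - 1) = ~~~ BitVec.ofInt B (a v) := by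
    rw [BitVec.not_eq_neg_add, sub_eq_add_neg, BitVec.ofInt_add, BitVec.ofInt_neg,
      BitVec.ofInt_neg, BitVec.sub_eq_add_neg]
    rfl
  rw [this, BitVec.getLsbD_not]
  simp [hi]

/-- With `~a = -a - 1` one has `a - b = ~(~a + b)`, which reuses the adder. -/
theorem Ready.holds_sub (hr : Ready fs) (ha : Holds B fs a) (hb : Holds B fs b) :
    ∃ gs, SLPExt (22 * B) fs gs ∧ Holds B gs fun v => a v - b v := by
  obtain ⟨g1, e1, x1⟩ := hr.holds_not ha
  obtain ⟨g2, e2, x2⟩ := e1.ready.holds_add x1 (hb.mono e1)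
  obtain ⟨g3, e3, x3⟩ := e2.ready.holds_not x2
  exact ⟨g3, (e1.trans e2 le_rfl).trans e3 (by omega), x3.congr fun v => by ring⟩

theorem Ready.holds_ite (hr : Ready fs) (hf : Avail fs f) (ha : Holds B fs a)
    (hb : Holds B fs b) :
    ∃ gs, SLPExt (4 * B) fs gs ∧ Holds B gs fun v => if f v then a v else b v := by
  refine hr.all B 4 _ fun i hi gs h1 => ?_
  obtain ⟨hs, h2, h3⟩ := h1.ready.ite (h1.mono _ hf) (h1.mono _ (ha i hi)) (h1.mono _ (hb i hi))
  exact ⟨hs, h2, h3.congr fun v => by dsimp only; split_ifs <;> rfl⟩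

theorem Ready.holds_mul_two_pow (hr : Ready fs) (ha : Holds B fs a) (j : ℕ) :
    ∃ gs, SLPExt (20 * B * j) fs gs ∧ Holds B gs fun v => 2 ^ j * a v := by
  induction j with
  | zero => exact ⟨fs, hr.ext_refl _, ha.congr fun v => by ring⟩
  | succ j ih =>
    obtain ⟨gs, h1, h2⟩ := ih
    obtain ⟨hs, h3, h4⟩ := h1.ready.holds_add h2 h2
    exact ⟨hs, h1.trans h3 (by ring_nf; rfl), h4.congr fun v => by ring⟩

/-- The answer is the complement of the sign bit. This is where a range condition is needed: reading
a sign is the only operation here that is not compatible with reduction modulo a power of two. -/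
theorem Avail.isNonneg (hr : Ready fs) (ha : Holds (B + 1) fs a)
    (hB : ∀ v, -2 ^ B ≤ a v ∧ a v < 2 ^ B) :
    ∃ gs, SLPExt 1 fs gs ∧ Avail gs fun v => decide (0 ≤ a v) := by
  obtain ⟨gs, h1, h2⟩ := hr.not (ha B (by omega))
  refine ⟨gs, h1, h2.congr fun v => ?_⟩
  have h3 := BitVec.toInt_ofInt_eq_self (w := B + 1) (by omega) (n := a v)
    (by simpa using (hB v).1) (by simpa using (hB v).2)
  have h4 : (BitVec.ofInt (B + 1) (a v)).getLsbD B = (BitVec.ofInt (B + 1) (a v)).msb := by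
    rw [BitVec.msb_eq_getLsbD_last]; simp
  rw [h4, BitVec.msb_eq_toInt, h3]
  by_cases h : a v < 0
  · simp [h]
  · simp [h, not_lt.1 h]

end SLP

/-! ## Exact binary search for angles with rational rotations -/

section Cordic

/-- The angle of the rational rotation with cosine `(4^k - 1) / (4^k + 1)` and sine
`2^(k+1) / (4^k + 1)`. -/
noncomputable def cordicAngle (k : ℕ) : ℝ := 2 * Real.arctan ((1 / 2) ^ k)

theorem cordicAngle_cos (k : ℕ) : (4 ^ k + 1) * Real.cos (cordicAngle k) = 4 ^ k - 1 := by
  have h4 : (4 : ℝ) ^ k = (2 ^ k) ^ 2 := by rw [← pow_mul, mul_comm, pow_mul]; norm_num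
  have h2 : (2 : ℝ) ^ k ≠ 0 := by positivity
  rw [cordicAngle, Real.cos_two_mul, Real.cos_sq_arctan, h4, one_div_pow]
  have : (1 : ℝ) + (2 ^ k) ^ 2 ≠ 0 := by positivity
  field_simp
  ring

theorem cordicAngle_sin (k : ℕ) : (4 ^ k + 1) * Real.sin (cordicAngle k) = 2 ^ (k + 1) := by
  have h4 : (4 : ℝ) ^ k = (2 ^ k) ^ 2 := by rw [← pow_mul, mul_comm, pow_mul]; norm_num
  have h2 : (2 : ℝ) ^ k ≠ 0 := by positivity
  have hs : Real.sin (cordicAngle k) = 2 * (1 / 2) ^ k / (1 + ((1 / 2 : ℝ) ^ k) ^ 2) := by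
    rw [cordicAngle, Real.sin_two_mul, Real.sin_arctan, Real.cos_arctan]
    have hp : (0 : ℝ) ≤ 1 + ((1 / 2 : ℝ) ^ k) ^ 2 := by positivity
    have hq : √(1 + ((1 / 2 : ℝ) ^ k) ^ 2) ≠ 0 := by positivity
    have hq2 := Real.mul_self_sqrt hp
    generalize √(1 + ((1 / 2 : ℝ) ^ k) ^ 2) = q at hq hq2
    rw [← hq2]
    field_simp
  rw [hs, h4, one_div_pow, pow_succ]
  have : (1 : ℝ) + (2 ^ k) ^ 2 ≠ 0 := by positivity
  field_simp
  ring

theorem cordicAngle_pos (k : ℕ) : 0 < cordicAngle k := by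
  have : 0 < Real.arctan ((1 / 2) ^ k) := Real.arctan_pos.2 (by positivity)
  unfold cordicAngle; linarith

theorem cordicAngle_zero : cordicAngle 0 = Real.pi / 2 := by
  rw [cordicAngle, pow_zero, Real.arctan_one]; ring

theorem cordicAngle_le (k : ℕ) : cordicAngle k ≤ Real.pi / 2 := by
  have : Real.arctan ((1 / 2) ^ k) ≤ Real.arctan 1 :=
    Real.arctan_strictMono.monotone (pow_le_one₀ (by norm_num) (by norm_num))
  rw [Real.arctan_one] at this
  unfold cordicAngle; linarith

/-- Since `tan (2 arctan x) = 2x / (1 - x^2) ≥ 2x` for `0 < x < 1`, halving the tangent at most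
halves the angle. Hence the later angles are never too small to close the gap left by step `k`. -/
theorem cordicAngle_le_two_mul (k : ℕ) : cordicAngle k ≤ 2 * cordicAngle (k + 1) := by
  have hx : (0 : ℝ) < (1 / 2) ^ (k + 1) := by positivity
  have hx1 : (1 / 2 : ℝ) ^ (k + 1) < 1 := pow_lt_one₀ (by norm_num) (by norm_num) (by omega)
  have h := Real.two_mul_arctan (x := (1 / 2 : ℝ) ^ (k + 1)) (by linarith) hx1
  have h2 : Real.arctan ((1 / 2 : ℝ) ^ k) ≤ 2 * Real.arctan ((1 / 2 : ℝ) ^ (k + 1)) := by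
    rw [h]
    apply Real.arctan_strictMono.monotone
    have : (1 / 2 : ℝ) ^ k = 2 * (1 / 2) ^ (k + 1) := by rw [pow_succ]; ring
    rw [this]
    have h3 : 0 < 1 - ((1 / 2 : ℝ) ^ (k + 1)) ^ 2 := by nlinarith
    rw [le_div_iff₀ h3]
    nlinarith [sq_nonneg ((1 / 2 : ℝ) ^ (k + 1))]
  unfold cordicAngle; linarith

theorem cordicAngle_le_pow (k : ℕ) : cordicAngle k ≤ 2 * (1 / 2) ^ k := by
  have h0 : (0 : ℝ) ≤ (1 / 2) ^ k := by positivity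
  have h : Real.arctan ((1 / 2) ^ k) ≤ (1 / 2) ^ k := by
    have := Real.le_tan (Real.arctan_nonneg.2 h0) (Real.arctan_lt_pi_div_two _)
    rwa [Real.tan_arctan] at this
  unfold cordicAngle; linarith

/-- The vector `(X, Y)` rotated by `cordicAngle k` and multiplied by `4^k + 1`. -/
def cordicCand (k : ℕ) (s : ℤ × ℤ × ℤ) : ℤ × ℤ :=
  ((4 ^ k - 1) * s.1 - 2 ^ (k + 1) * s.2.1, 2 ^ (k + 1) * s.1 + (4 ^ k - 1) * s.2.1)

/-- Whether the rotated vector is still in the upper half plane and to the right of the target. -/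
def cordicDigit (k : ℕ) (s : ℤ × ℤ × ℤ) : Bool :=
  decide (0 ≤ (cordicCand k s).1 - (4 ^ k + 1) * s.2.2) && decide (0 ≤ (cordicCand k s).2)

/-- One step of the search for an angle; all components are multiplied by `4^k + 1`. -/
def cordicStep (k : ℕ) (s : ℤ × ℤ × ℤ) : ℤ × ℤ × ℤ :=
  (if cordicDigit k s then (cordicCand k s).1 else (4 ^ k + 1) * s.1,
    if cordicDigit k s then (cordicCand k s).2 else (4 ^ k + 1) * s.2.1,
    (4 ^ k + 1) * s.2.2)

/-- The vector and the target after `k` steps, starting from the vector `(R, 0)`. -/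
def cordicState (R t : ℤ) : ℕ → ℤ × ℤ × ℤ
  | 0 => (R, 0, t)
  | k + 1 => cordicStep k (cordicState R t k)

/-- The scaling factor of the first `k` steps. -/
def cordicScale (k : ℕ) : ℤ := ∏ j ∈ Finset.range k, (4 ^ j + 1)

theorem cordicScale_pos (k : ℕ) : 0 < cordicScale k :=
  Finset.prod_pos fun _ _ => by positivity

theorem cordicScale_succ (k : ℕ) : cordicScale (k + 1) = cordicScale k * (4 ^ k + 1) :=
  Finset.prod_range_succ _ _

theorem cordicScale_le (k : ℕ) : cordicScale k ≤ 4 ^ k ^ 2 := by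
  induction k with
  | zero => simp [cordicScale]
  | succ k ih =>
    rw [cordicScale_succ]
    have h1 : (4 : ℤ) ^ k + 1 ≤ 4 ^ (2 * k + 1) := by
      have : (1 : ℤ) ≤ 4 ^ k := one_le_pow₀ (by norm_num)
      have h2 : (4 : ℤ) ^ (2 * k + 1) = 4 * (4 ^ k * 4 ^ k) := by ring
      nlinarith
    calc cordicScale k * (4 ^ k + 1) ≤ 4 ^ k ^ 2 * 4 ^ (2 * k + 1) :=
          mul_le_mul ih h1 (by positivity) (by positivity)
      _ = 4 ^ (k + 1) ^ 2 := by rw [← pow_add]; congr 1; ring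

/-- The `k`-th digit of the angle. -/
def cordicBit (R t : ℤ) (k : ℕ) : Bool := cordicDigit k (cordicState R t k)

/-- The sum of the angles selected by the first `k` digits. -/
noncomputable def cordicSum (c : ℕ → Bool) (T : ℕ) : ℝ :=
  ∑ k ∈ Finset.range T, if c k then cordicAngle k else 0

theorem cordicSum_succ (c : ℕ → Bool) (T : ℕ) :
    cordicSum c (T + 1) = cordicSum c T + if c T then cordicAngle T else 0 :=
  Finset.sum_range_succ _ _

theorem cordicState_target (R t : ℤ) (k : ℕ) :
    (cordicState R t k).2.2 = cordicScale k * t := by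
  induction k with
  | zero => simp [cordicState, cordicScale]
  | succ k ih => rw [cordicState, cordicStep, cordicScale_succ, ih]; ring

theorem cordicCand_eq {k : ℕ} {s : ℤ × ℤ × ℤ} {R φ : ℝ} (h1 : (s.1 : ℝ) = R * Real.cos φ)
    (h2 : (s.2.1 : ℝ) = R * Real.sin φ) :
    ((cordicCand k s).1 : ℝ) = R * (4 ^ k + 1) * Real.cos (φ + cordicAngle k) ∧
    ((cordicCand k s).2 : ℝ) = R * (4 ^ k + 1) * Real.sin (φ + cordicAngle k) := by
  have hc := cordicAngle_cos k
  have hs := cordicAngle_sin k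
  simp only [cordicCand]
  push_cast
  rw [h1, h2, Real.cos_add, Real.sin_add, ← hc, ← hs]
  constructor <;> ring

theorem cordicState_eq (R t : ℤ) (k : ℕ) :
    ((cordicState R t k).1 : ℝ) =
      R * cordicScale k * Real.cos (cordicSum (cordicBit R t) k) ∧
    ((cordicState R t k).2.1 : ℝ) =
      R * cordicScale k * Real.sin (cordicSum (cordicBit R t) k) := by
  induction k with
  | zero => simp [cordicState, cordicScale, cordicSum]
  | succ k ih =>
    obtain ⟨h1, h2⟩ := cordicCand_eq (k := k) ih.1 ih.2
    rw [cordicState, cordicStep, cordicSum_succ, cordicScale_succ]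
    have hb : cordicBit R t k = cordicDigit k (cordicState R t k) := rfl
    rw [hb]
    by_cases h : cordicDigit k (cordicState R t k) = true
    · simp only [h, if_true]
      rw [h1, h2]
      push_cast
      constructor <;> ring
    · rw [Bool.not_eq_true] at h
      simp only [h, Bool.false_eq_true, if_false, add_zero]
      push_cast
      rw [ih.1, ih.2]
      constructor <;> ring

/-- Bisection invariant: the target angle lies between the current sum `φ` and `φ + 2 θ_k`.
Initially `2 θ_0 = π`. If `ψ = φ + θ_k` is accepted, the remainder is at most `θ_k`; if it is
rejected, the target is at most `ψ`. In both cases `θ_k ≤ 2 θ_{k+1}` restores the invariant. -/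
theorem cordicSum_bounds {R t : ℤ} (hR : 0 < R) (ht : |t| ≤ R) (k : ℕ) :
    0 ≤ cordicSum (cordicBit R t) k ∧
    cordicSum (cordicBit R t) k ≤ Real.arccos (t / R) ∧
    Real.arccos (t / R) ≤ cordicSum (cordicBit R t) k + 2 * cordicAngle k := by
  have hR' : (0 : ℝ) < R := by exact_mod_cast hR
  have ht' : |(t : ℝ)| ≤ R := by exact_mod_cast ht
  have hcos : Real.cos (Real.arccos (t / R)) = t / R := by
    rw [abs_le] at ht'
    apply Real.cos_arccos
    · rw [le_div_iff₀ hR']; linarith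
    · rw [div_le_one hR']; linarith
  have hle := Real.arccos_le_pi (t / R)
  have hnn := Real.arccos_nonneg (t / R)
  induction k with
  | zero =>
    simp only [cordicSum, Finset.range_zero, Finset.sum_empty, cordicAngle_zero]
    exact ⟨le_rfl, hnn, by linarith⟩
  | succ k ih =>
    obtain ⟨ih0, ih1, ih2⟩ := ih
    obtain ⟨e1, e2⟩ := cordicState_eq R t k
    obtain ⟨h1, h2⟩ := cordicCand_eq (k := k) e1 e2
    have hsc : (0 : ℝ) < cordicScale k := by exact_mod_cast cordicScale_pos k
    have hpos : (0 : ℝ) < R * cordicScale k * (4 ^ k + 1) := by positivity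
    have hp := cordicAngle_pos k
    have hpi := cordicAngle_le k
    have hdbl := cordicAngle_le_two_mul k
    rw [cordicSum_succ]
    set φ := cordicSum (cordicBit R t) k with hφ
    set ψ := φ + cordicAngle k with hψ
    have hψ0 : 0 < ψ := by linarith
    have hdig : cordicBit R t k = true ↔ (t / R : ℝ) ≤ Real.cos ψ ∧ 0 ≤ Real.sin ψ := by
      have hd1 : 0 ≤ (cordicCand k (cordicState R t k)).1 -
          (4 ^ k + 1) * (cordicState R t k).2.2 ↔ (t / R : ℝ) ≤ Real.cos ψ := by
        rw [← Int.cast_le (R := ℝ)]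
        push_cast
        rw [h1, cordicState_target, div_le_iff₀ hR']
        push_cast
        have : R * cordicScale k * (4 ^ k + 1) * Real.cos ψ -
            (4 ^ k + 1) * (cordicScale k * t) =
            (cordicScale k * (4 ^ k + 1)) * (Real.cos ψ * R - t) := by ring
        rw [this, mul_nonneg_iff_of_pos_left (by positivity), sub_nonneg]
      have hd2 : 0 ≤ (cordicCand k (cordicState R t k)).2 ↔ 0 ≤ Real.sin ψ := by
        rw [← Int.cast_le (R := ℝ), h2, Int.cast_zero, mul_nonneg_iff_of_pos_left hpos]
      rw [cordicBit, cordicDigit, Bool.and_eq_true, decide_eq_true_iff, decide_eq_true_iff,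
        hd1, hd2]
    by_cases hb : cordicBit R t k = true
    · rw [if_pos hb]
      obtain ⟨hc, hs⟩ := hdig.1 hb
      -- The candidate may exceed `π`, where the cosine is no longer decreasing and its comparison
      -- means nothing. It stays below `2π`, so the sign of the sine detects this case.
      have hψpi : ψ ≤ Real.pi := by
        by_contra hcon
        push Not at hcon
        have := Real.sin_neg_of_neg_of_neg_pi_lt (x := ψ - 2 * Real.pi) (by linarith) (by linarith)
        rw [Real.sin_sub_two_pi] at this
        linarith
      have : ψ ≤ Real.arccos (t / R) := by
        rw [← Real.strictAntiOn_cos.le_iff_ge ⟨hnn, hle⟩ ⟨hψ0.le, hψpi⟩, hcos]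
        exact hc
      exact ⟨hψ0.le, this, by linarith⟩
    · rw [if_neg hb, add_zero]
      refine ⟨ih0, ih1, ?_⟩
      have : Real.arccos (t / R) ≤ ψ := by
        by_contra hcon
        push Not at hcon
        refine hb (hdig.2 ⟨?_, Real.sin_nonneg_of_nonneg_of_le_pi hψ0.le (by linarith)⟩)
        have := Real.strictAntiOn_cos ⟨hψ0.le, by linarith⟩ ⟨hnn, hle⟩ hcon
        rw [hcos] at this
        exact this.le
      linarith

theorem cordicSum_mem {R t : ℤ} (hR : 0 < R) (ht : |t| ≤ R) (T : ℕ) :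
    0 ≤ cordicSum (cordicBit R t) T ∧ cordicSum (cordicBit R t) T ≤ Real.pi := by
  obtain ⟨h0, h1, -⟩ := cordicSum_bounds hR ht T
  exact ⟨h0, h1.trans (Real.arccos_le_pi _)⟩

/-- The cosine is 1-Lipschitz and the angle is off by at most `2 θ_T ≤ 4 · 2^(-T)`. -/
theorem cordicSum_cos {R t : ℤ} (hR : 0 < R) (ht : |t| ≤ R) (T : ℕ) :
    |R * Real.cos (cordicSum (cordicBit R t) T) - t| ≤ R * (4 * (1 / 2) ^ T) := by
  have hR' : (0 : ℝ) < R := by exact_mod_cast hR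
  have ht' : |(t : ℝ)| ≤ R := by exact_mod_cast ht
  have hcos : Real.cos (Real.arccos (t / R)) = t / R := by
    rw [abs_le] at ht'
    apply Real.cos_arccos
    · rw [le_div_iff₀ hR']; linarith
    · rw [div_le_one hR']; linarith
  obtain ⟨h0, h1, h2⟩ := cordicSum_bounds hR ht T
  have h3 := cordicAngle_le_pow T
  have h4 := Real.abs_cos_sub_cos_le (cordicSum (cordicBit R t) T) (Real.arccos (t / R))
  rw [hcos] at h4
  have h5 : |cordicSum (cordicBit R t) T - Real.arccos (t / R)| ≤ 4 * (1 / 2) ^ T := by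
    rw [abs_le]; constructor <;> linarith
  have h6 : R * Real.cos (cordicSum (cordicBit R t) T) - t =
      R * (Real.cos (cordicSum (cordicBit R t) T) - t / R) := by field_simp
  rw [h6, abs_mul, abs_of_pos hR']
  exact mul_le_mul_of_nonneg_left (h4.trans h5) hR'.le

end Cordic

/-! ## Boolean programs for the digits -/

section DigitProgram

variable {V : Type} {B : ℕ} {fs gs hs : List ((V → Bool) → Bool)}

/-- A bound for the cost of an operation on registers of `B` bits. -/
def regCost (B : ℕ) : ℕ := 22 * B

/-- The function `f` can be computed from `fs` with `c` register operations. -/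
def CanBit (B c : ℕ) (fs : List ((V → Bool) → Bool)) (f : (V → Bool) → Bool) : Prop :=
  ∀ gs, Ready gs → (∀ g, Avail fs g → Avail gs g) →
    ∃ hs, SLPExt (regCost B * c) gs hs ∧ Avail hs f

/-- The integer `a` can be computed from `fs` with `c` register operations. -/
def CanHold (B c : ℕ) (fs : List ((V → Bool) → Bool)) (a : (V → Bool) → ℤ) : Prop :=
  ∀ gs, Ready gs → (∀ g, Avail fs g → Avail gs g) →
    ∃ hs, SLPExt (regCost B * c) gs hs ∧ Holds B hs a

variable {c d : ℕ} {f g : (V → Bool) → Bool} {a b : (V → Bool) → ℤ}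

theorem Holds.canHold (ha : Holds B fs a) : CanHold B 0 fs a :=
  fun gs hr hm => ⟨gs, hr.ext_refl _, fun i hi => hm _ (ha i hi)⟩

theorem CanHold.congr (ha : CanHold B c fs a) (h : ∀ v, a v = b v) : CanHold B c fs b := by
  rwa [← funext h]

theorem CanHold.weaken (ha : CanHold B c fs a) (h : c ≤ d) : CanHold B d fs a := by
  intro gs hr hm
  obtain ⟨hs, h1, h2⟩ := ha gs hr hm
  exact ⟨hs, h1.weaken (Nat.mul_le_mul_left _ h), h2⟩

theorem CanHold.map₂ {F : ℤ → ℤ → ℤ} (ha : CanHold B c fs a) (hb : CanHold B d fs b)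
    (hF : ∀ gs, Ready gs → Holds B gs a → Holds B gs b →
      ∃ hs, SLPExt (regCost B) gs hs ∧ Holds B hs fun v => F (a v) (b v)) :
    CanHold B (c + d + 1) fs fun v => F (a v) (b v) := by
  intro gs hr hm
  obtain ⟨g1, h1, h2⟩ := ha gs hr hm
  obtain ⟨g2, h3, h4⟩ := hb g1 h1.ready fun f hf => h1.mono _ (hm f hf)
  obtain ⟨g3, h5, h6⟩ := hF g2 h3.ready (h2.mono h3) h4
  exact ⟨g3, (h1.trans h3 le_rfl).trans h5 (by ring_nf; rfl), h6⟩

theorem CanHold.add (ha : CanHold B c fs a) (hb : CanHold B d fs b) :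
    CanHold B (c + d + 1) fs fun v => a v + b v :=
  CanHold.map₂ ha hb fun _ hr h1 h2 => by
    obtain ⟨hs, h3, h4⟩ := hr.holds_add h1 h2
    exact ⟨hs, h3.weaken (by unfold regCost; omega), h4⟩

theorem CanHold.sub (ha : CanHold B c fs a) (hb : CanHold B d fs b) :
    CanHold B (c + d + 1) fs fun v => a v - b v :=
  CanHold.map₂ ha hb fun _ hr h1 h2 => by
    obtain ⟨hs, h3, h4⟩ := hr.holds_sub h1 h2
    exact ⟨hs, h3.weaken (by unfold regCost; omega), h4⟩

theorem CanHold.ite (hf : Avail fs f) (ha : CanHold B c fs a) (hb : CanHold B d fs b) :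
    CanHold B (c + d + 1) fs fun v => if f v then a v else b v := by
  intro gs hr hm
  obtain ⟨g1, h1, h2⟩ := ha gs hr hm
  obtain ⟨g2, h3, h4⟩ := hb g1 h1.ready fun f hf => h1.mono _ (hm f hf)
  obtain ⟨g3, h5, h6⟩ := h3.ready.holds_ite (h3.mono _ (h1.mono _ (hm _ hf))) (h2.mono h3) h4
  refine ⟨g3, (h1.trans h3 le_rfl).trans h5 ?_, h6⟩
  have : 4 * B ≤ regCost B := by unfold regCost; omega
  calc _ ≤ regCost B * c + regCost B * d + regCost B := by omega
    _ = _ := by ring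

theorem CanHold.two_pow (ha : CanHold B c fs a) (j : ℕ) :
    CanHold B (c + j) fs fun v => 2 ^ j * a v := by
  intro gs hr hm
  obtain ⟨g1, h1, h2⟩ := ha gs hr hm
  obtain ⟨g2, h3, h4⟩ := h1.ready.holds_mul_two_pow h2 j
  refine ⟨g2, h1.trans h3 ?_, h4⟩
  rw [Nat.mul_add]
  exact Nat.add_le_add_left (Nat.mul_le_mul_right _ (by unfold regCost; omega)) _

theorem CanHold.four_pow (ha : CanHold B c fs a) (j : ℕ) :
    CanHold B (c + 2 * j) fs fun v => 4 ^ j * a v :=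
  (ha.two_pow (2 * j)).congr fun v => by rw [pow_mul]; norm_num

theorem CanHold.isNonneg (ha : CanHold (B + 1) c fs a) (hB : ∀ v, |a v| < 2 ^ B) :
    CanBit (B + 1) (c + 1) fs fun v => decide (0 ≤ a v) := by
  intro gs hr hm
  obtain ⟨g1, h1, h2⟩ := ha gs hr hm
  obtain ⟨g2, h3, h4⟩ := Avail.isNonneg h1.ready h2 fun v =>
    ⟨(abs_lt.1 (hB v)).1.le, (abs_lt.1 (hB v)).2⟩
  refine ⟨g2, h1.trans h3 ?_, h4⟩
  rw [Nat.mul_add]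
  exact Nat.add_le_add_left (by unfold regCost; omega) _

theorem CanBit.and (hf : CanBit (B + 1) c fs f) (hg : CanBit (B + 1) d fs g) :
    CanBit (B + 1) (c + d + 1) fs fun v => f v && g v := by
  intro gs hr hm
  obtain ⟨g1, h1, h2⟩ := hf gs hr hm
  obtain ⟨g2, h3, h4⟩ := hg g1 h1.ready fun f hf => h1.mono _ (hm f hf)
  obtain ⟨g3, h5, h6⟩ := h3.ready.and (h3.mono _ h2) h4
  refine ⟨g3, (h1.trans h3 le_rfl).trans h5 ?_, h6⟩
  have : 2 ≤ regCost (B + 1) := by unfold regCost; omega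
  calc _ ≤ regCost (B + 1) * c + regCost (B + 1) * d + regCost (B + 1) := by omega
    _ = _ := by ring

/-- All three components of a search state are available. -/
def HoldsState (B : ℕ) (fs : List ((V → Bool) → Bool)) (s : (V → Bool) → ℤ × ℤ × ℤ) : Prop :=
  Holds B fs (fun v => (s v).1) ∧ Holds B fs (fun v => (s v).2.1) ∧
    Holds B fs (fun v => (s v).2.2)

theorem HoldsState.mono {s : (V → Bool) → ℤ × ℤ × ℤ} (h : HoldsState B fs s)
    (h' : SLPExt c fs gs) : HoldsState B gs s :=
  ⟨h.1.mono h', h.2.1.mono h', h.2.2.mono h'⟩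

/-- Multiplications by `2^(k+1)` and `4^k ± 1` are repeated doublings and one addition or
subtraction. The two sign tests and their conjunction take `8k + 11` register operations, the two
selected components `10k + 10`, the rescaled target `2k + 1`. Range bounds are required only for the
two integers whose signs are read. -/
theorem Ready.holdsState_step (hr : Ready fs) {s : (V → Bool) → ℤ × ℤ × ℤ}
    (hs : HoldsState (B + 1) fs s) (k : ℕ)
    (h1 : ∀ v, |(cordicCand k (s v)).1 - (4 ^ k + 1) * (s v).2.2| < 2 ^ B)
    (h2 : ∀ v, |(cordicCand k (s v)).2| < 2 ^ B) :
    ∃ gs, SLPExt (regCost (B + 1) * (20 * k + 22)) fs gs ∧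
      Avail gs (fun v => cordicDigit k (s v)) ∧
      HoldsState (B + 1) gs fun v => cordicStep k (s v) := by
  have cX : ∀ gs, HoldsState (B + 1) gs s →
      CanHold (B + 1) (3 * k + 3) gs (fun v => (cordicCand k (s v)).1) := fun gs hs =>
    ((((hs.1.canHold.four_pow k).sub hs.1.canHold).sub
      (hs.2.1.canHold.two_pow (k + 1))).weaken (by omega)).congr
        fun v => by simp only [cordicCand]; ring
  have cY : ∀ gs, HoldsState (B + 1) gs s →
      CanHold (B + 1) (3 * k + 3) gs (fun v => (cordicCand k (s v)).2) := fun gs hs =>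
    (((hs.1.canHold.two_pow (k + 1)).add
      ((hs.2.1.canHold.four_pow k).sub hs.2.1.canHold)).weaken (by omega)).congr
        fun v => by simp only [cordicCand]; ring
  have scale : ∀ gs (a : (V → Bool) → ℤ), Holds (B + 1) gs a →
      CanHold (B + 1) (2 * k + 1) gs (fun v => (4 ^ k + 1) * a v) := fun gs a ha =>
    (((ha.canHold.four_pow k).add ha.canHold).weaken (by omega)).congr fun v => by ring
  obtain ⟨g1, e1, x1⟩ := (CanBit.and ((((cX fs hs)).sub (scale fs _ hs.2.2)).isNonneg h1)
    ((cY fs hs).isNonneg h2)) fs hr fun _ h => h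
  have hs1 := hs.mono e1
  obtain ⟨g2, e2, x2⟩ := CanHold.ite x1 (cX g1 hs1) (scale g1 _ hs1.1) g1 e1.ready fun _ h => h
  have hs2 := hs1.mono e2
  obtain ⟨g3, e3, x3⟩ := CanHold.ite (e2.mono _ x1) (cY g2 hs2) (scale g2 _ hs2.2.1) g2
    e2.ready fun _ h => h
  have hs3 := hs2.mono e3
  obtain ⟨g4, e4, x4⟩ := scale g3 _ hs3.2.2 g3 e3.ready fun _ h => h
  have e24 := (e2.trans e3 le_rfl).trans e4 le_rfl
  refine ⟨g4, e1.trans e24 ?_, e24.mono _ x1, (x2.mono e3).mono e4, x3.mono e4, x4⟩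
  simp only [← Nat.mul_add]
  exact Nat.mul_le_mul_left _ (by omega)

/-- Apart from the known factor `cordicScale k ≤ 4^(k^2)`, the steps are rotations and preserve
length. Exact arithmetic thus costs only `2 k^2` additional bits. -/
theorem abs_cordicState_le {R t : ℤ} {b : ℕ} (hR : |R| ≤ 2 ^ b) (k : ℕ) :
    |(cordicState R t k).1| ≤ 2 ^ (b + 2 * k ^ 2) ∧
    |(cordicState R t k).2.1| ≤ 2 ^ (b + 2 * k ^ 2) := by
  obtain ⟨h1, h2⟩ := cordicState_eq R t k
  have hR' : |(R : ℝ)| ≤ 2 ^ b := by exact_mod_cast hR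
  have hs : (cordicScale k : ℝ) ≤ 4 ^ k ^ 2 := by exact_mod_cast cordicScale_le k
  have hs0 : (0 : ℝ) < cordicScale k := by exact_mod_cast cordicScale_pos k
  have key : ∀ x : ℝ, |x| ≤ 1 → |R * cordicScale k * x| ≤ 2 ^ (b + 2 * k ^ 2) := by
    intro x hx
    rw [abs_mul, abs_mul, abs_of_pos hs0, pow_add, pow_mul]
    norm_num only
    calc |(R : ℝ)| * cordicScale k * |x| ≤ (2 ^ b * 4 ^ k ^ 2) * 1 := by gcongr
      _ = _ := mul_one _
  constructor
  · rw [← Int.cast_le (R := ℝ)]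
    push_cast
    rw [h1]
    exact key _ (Real.abs_cos_le_one _)
  · rw [← Int.cast_le (R := ℝ)]
    push_cast
    rw [h2]
    exact key _ (Real.abs_sin_le_one _)

/-- As for the state, but one step ahead. Two extra bits absorb the difference of two terms and make
the bound strict. -/
theorem abs_cordicCand_le {R t : ℤ} {b : ℕ} (hR : |R| ≤ 2 ^ b) (ht : |t| ≤ 2 ^ b) (k : ℕ) :
    |(cordicCand k (cordicState R t k)).1 - (4 ^ k + 1) * (cordicState R t k).2.2|
      < 2 ^ (b + 2 + 2 * (k + 1) ^ 2) ∧
    |(cordicCand k (cordicState R t k)).2| < 2 ^ (b + 2 + 2 * (k + 1) ^ 2) := by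
  obtain ⟨e1, e2⟩ := cordicState_eq R t k
  obtain ⟨h1, h2⟩ := cordicCand_eq (k := k) e1 e2
  have hs : (cordicScale k * (4 ^ k + 1) : ℝ) ≤ 4 ^ (k + 1) ^ 2 := by
    have := cordicScale_le (k + 1)
    rw [cordicScale_succ] at this
    exact_mod_cast this
  have hs0 : (0 : ℝ) < cordicScale k * (4 ^ k + 1) := by
    have : (0 : ℝ) < cordicScale k := by exact_mod_cast cordicScale_pos k
    positivity
  have key : ∀ (r : ℤ) (x : ℝ), |r| ≤ 2 ^ b → |x| ≤ 1 →
      |r * (cordicScale k * (4 ^ k + 1)) * x| ≤ (2 : ℝ) ^ (b + 2 * (k + 1) ^ 2) := by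
    intro r x hr hx
    have hr' : |(r : ℝ)| ≤ 2 ^ b := by exact_mod_cast hr
    rw [abs_mul, abs_mul, abs_of_pos hs0, pow_add, pow_mul]
    norm_num only
    calc |(r : ℝ)| * (cordicScale k * (4 ^ k + 1)) * |x| ≤ (2 ^ b * 4 ^ (k + 1) ^ 2) * 1 := by
          gcongr
      _ = _ := mul_one _
  have hpow : (2 : ℝ) ^ (b + 2 + 2 * (k + 1) ^ 2) = 4 * 2 ^ (b + 2 * (k + 1) ^ 2) := by ring
  have hpos : (0 : ℝ) < 2 ^ (b + 2 * (k + 1) ^ 2) := by positivity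
  constructor
  · rw [← Int.cast_lt (R := ℝ)]
    push_cast
    rw [h1, cordicState_target, hpow]
    push_cast
    have k1 := key R _ hR (Real.abs_cos_le_one (cordicSum (cordicBit R t) k + cordicAngle k))
    have k2 := key t 1 ht (by simp)
    have : (4 ^ k + 1) * ((cordicScale k : ℝ) * t) = t * (cordicScale k * (4 ^ k + 1)) * 1 := by
      ring
    rw [this, mul_assoc (R : ℝ)]
    refine (abs_sub _ _).trans_lt ?_
    linarith
  · rw [← Int.cast_lt (R := ℝ)]
    push_cast
    rw [h2, hpow, mul_assoc (R : ℝ)]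
    have k1 := key R _ hR (Real.abs_sin_le_one (cordicSum (cordicBit R t) k + cordicAngle k))
    linarith

theorem Ready.holdsState_cordic (hr : Ready fs) {R t : (V → Bool) → ℤ} {b T : ℕ}
    (hB : b + 2 + 2 * T ^ 2 ≤ B) (hR : Holds (B + 1) fs R) (ht : Holds (B + 1) fs t)
    (hRb : ∀ v, |R v| ≤ 2 ^ b) (htb : ∀ v, |t v| ≤ 2 ^ b) :
    ∃ gs, SLPExt (regCost (B + 1) * (T * (20 * T + 22))) fs gs ∧
      (∀ k < T, Avail gs fun v => cordicBit (R v) (t v) k) ∧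
      HoldsState (B + 1) gs fun v => cordicState (R v) (t v) T := by
  have key : ∀ j ≤ T, ∃ gs, SLPExt (regCost (B + 1) * (j * (20 * T + 22))) fs gs ∧
      (∀ k < j, Avail gs fun v => cordicBit (R v) (t v) k) ∧
      HoldsState (B + 1) gs fun v => cordicState (R v) (t v) j := by
    intro j hj
    induction j with
    | zero =>
      refine ⟨fs, hr.ext_refl _, by simp, hR, ?_, ht⟩
      exact (hr.holds_condConst hr.const 0).congr fun v => by simp [cordicState]
    | succ j ih =>
      obtain ⟨gs, h1, h2, h3⟩ := ih (by omega)
      have hpow : (2 : ℤ) ^ (b + 2 + 2 * (j + 1) ^ 2) ≤ 2 ^ B := by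
        refine pow_le_pow_right₀ (by norm_num) (le_trans ?_ hB)
        have : (j + 1) ^ 2 ≤ T ^ 2 := Nat.pow_le_pow_left hj 2
        omega
      obtain ⟨hs, e1, x1, x2⟩ := h1.ready.holdsState_step h3 j
        (fun v => (abs_cordicCand_le (hRb v) (htb v) j).1.trans_le hpow)
        (fun v => (abs_cordicCand_le (hRb v) (htb v) j).2.trans_le hpow)
      refine ⟨hs, h1.trans e1 ?_, fun k hk => ?_, x2⟩
      · have : (j + 1) * (20 * T + 22) = j * (20 * T + 22) + (20 * T + 22) := Nat.succ_mul _ _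
        rw [← Nat.mul_add, this]
        exact Nat.mul_le_mul_left _ (by omega)
      · rcases Nat.lt_succ_iff_lt_or_eq.1 hk with h | rfl
        exacts [e1.mono _ (h2 k h), x1]
  exact key T le_rfl

theorem Ready.canHold_sum (hr : Ready fs) (F : ℕ → (V → Bool) → Bool) (w : ℕ → ℤ) (p : ℕ)
    (hF : ∀ j < p, Avail fs (F j)) :
    CanHold B p fs fun v => ∑ j ∈ Finset.range p, if F j v then w j else 0 := by
  induction p with
  | zero =>
    exact (hr.holds_condConst hr.const 0).canHold.congr fun v => by simp
  | succ p ih =>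
    refine (((ih fun j hj => hF j (by omega)).add
      (hr.holds_condConst (hF p (by omega)) (w p)).canHold).weaken (by omega)).congr fun v => ?_
    rw [Finset.sum_range_succ]

end DigitProgram

/-! ## Angles of the fixed-point number in a value register -/

section FixedPoint

variable {m : ℕ}

/-- The fractional bits from the most significant one, followed by zeros. -/
def leadBit (u : Fin (m + 1) → Bool) (j : ℕ) : Bool :=
  if h : j < m then u ⟨m - 1 - j, by omega⟩ else false

/-- The fixed-point number truncated to `p` fractional bits, times `2^p`. -/
def topBits (p : ℕ) (u : Fin (m + 1) → Bool) : ℤ :=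
  (∑ j ∈ Finset.range p, if leadBit u j then 2 ^ (p - 1 - j) else 0) -
    if u (Fin.last m) then 2 ^ p else 0

/-- The value of the first `M` fractional bits. -/
noncomputable def leadSum (u : Fin (m + 1) → Bool) (M : ℕ) : ℝ :=
  ∑ j ∈ Finset.range M, if leadBit u j then (1 / 2 : ℝ) ^ (j + 1) else 0

/-- The omitted bits form part of a geometric series, so truncation changes the number by less than
one unit in the last retained place. -/
theorem leadSum_sub (u : Fin (m + 1) → Bool) (M k : ℕ) :
    0 ≤ leadSum u (M + k) - leadSum u M ∧
      leadSum u (M + k) - leadSum u M ≤ (1 / 2) ^ M - (1 / 2) ^ (M + k) := by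
  induction k with
  | zero => simp
  | succ k ih =>
    have h : leadSum u (M + (k + 1)) = leadSum u (M + k) +
        if leadBit u (M + k) then (1 / 2 : ℝ) ^ (M + k + 1) else 0 :=
      Finset.sum_range_succ _ _
    have hp : (0 : ℝ) < (1 / 2) ^ (M + k + 1) := by positivity
    have h2 : (1 / 2 : ℝ) ^ (M + k) = 2 * (1 / 2) ^ (M + k + 1) := by rw [pow_succ]; ring
    rw [h, ← add_assoc M k 1]
    split_ifs <;> constructor <;> linarith [ih.1, ih.2]

theorem leadSum_eq (u : Fin (m + 1) → Bool) (k : ℕ) : leadSum u (m + k) = leadSum u m := by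
  induction k with
  | zero => rfl
  | succ k ih =>
    rw [← ih]
    have : leadBit u (m + k) = false := by simp [leadBit]
    exact (Finset.sum_range_succ _ _).trans (by simp [this, leadSum])

theorem fixedReal_eq (u : Fin (m + 1) → Bool) :
    fixedReal u = leadSum u m - if u (Fin.last m) then 1 else 0 := by
  have h2 : (2 : ℝ) ^ m ≠ 0 := by positivity
  have h : (∑ t : Fin m, if u t.castSucc then (2 : ℝ) ^ (t : ℕ) else 0) =
      2 ^ m * leadSum u m := by
    have h1 : (∑ t : Fin m, if u t.castSucc then (2 : ℝ) ^ (t : ℕ) else 0) =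
        ∑ j ∈ Finset.range m, if leadBit u (m - 1 - j) then (2 : ℝ) ^ j else 0 := by
      rw [Finset.sum_range]
      refine Finset.sum_congr rfl fun t _ => ?_
      have ht := t.isLt
      have : leadBit u (m - 1 - t) = u t.castSucc := by
        rw [leadBit, dif_pos (by omega)]
        congr 1
        ext
        simp
        omega
      rw [this]
    rw [h1, ← Finset.sum_range_reflect, leadSum, Finset.mul_sum]
    refine Finset.sum_congr rfl fun j hj => ?_
    rw [Finset.mem_range] at hj
    have e : m - 1 - (m - 1 - j) = j := by omega
    rw [e]
    split_ifs
    · rw [one_div_pow, mul_one_div, eq_div_iff (by positivity), ← pow_add]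
      congr 1; omega
    · simp
  rw [fixedReal, h]
  split_ifs
  · field_simp
  · field_simp; ring

theorem topBits_eq (p : ℕ) (u : Fin (m + 1) → Bool) :
    (topBits p u : ℝ) = 2 ^ p * (leadSum u p - if u (Fin.last m) then 1 else 0) := by
  rw [topBits, mul_sub, leadSum, Finset.mul_sum]
  push_cast
  congr 1
  · refine Finset.sum_congr rfl fun j hj => ?_
    rw [Finset.mem_range] at hj
    split_ifs
    · rw [one_div_pow, mul_one_div, eq_div_iff (by positivity)]
      rw [← pow_add]
      congr 1; omega
    · simp
  · split_ifs <;> simp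

theorem fixedReal_sub_topBits (p : ℕ) (u : Fin (m + 1) → Bool) :
    0 ≤ fixedReal u - topBits p u / 2 ^ p ∧
      fixedReal u - topBits p u / 2 ^ p ≤ (1 / 2) ^ p := by
  have h2 : (2 : ℝ) ^ p ≠ 0 := by positivity
  have h := leadSum_sub u p m
  have hpos : (0 : ℝ) < (1 / 2) ^ (p + m) := by positivity
  rw [topBits_eq, mul_div_cancel_left₀ _ h2, fixedReal_eq, ← leadSum_eq u p, add_comm m p]
  -- Both sums are now compared inside the expansion with `p + m` bits, whose bits beyond `m`
  -- vanish. This covers truncation and padding alike, with no distinction between `p ≤ m` and `p >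
  -- m`.
  constructor <;> linarith [h.1, h.2]

theorem abs_leadSum_sub_le (u : Fin (m + 1) → Bool) (M : ℕ) :
    |leadSum u M - if u (Fin.last m) then 1 else 0| ≤ 1 := by
  have h := leadSum_sub u 0 M
  have h0 : leadSum u 0 = 0 := by simp [leadSum]
  have hpos : (0 : ℝ) < (1 / 2) ^ M := by positivity
  rw [h0, zero_add, pow_zero] at h
  rw [abs_le]
  split_ifs <;> constructor <;> linarith [h.1, h.2]

theorem abs_fixedReal_le (u : Fin (m + 1) → Bool) : |fixedReal u| ≤ 1 := by
  rw [fixedReal_eq]; exact abs_leadSum_sub_le u m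

theorem abs_topBits_le (p : ℕ) (u : Fin (m + 1) → Bool) : |topBits p u| ≤ 2 ^ p := by
  have : |(topBits p u : ℝ)| ≤ 2 ^ p := by
    rw [topBits_eq, abs_mul, abs_of_pos (by positivity : (0 : ℝ) < 2 ^ p)]
    exact mul_le_of_le_one_right (by positivity) (abs_leadSum_sub_le u p)
  exact_mod_cast this

/-- The truncated real part in a value register. -/
def reBits (p : ℕ) (v : ValueQubits m → Bool) : ℤ := topBits p fun t => v (Sum.inl t)

/-- The truncated imaginary part in a value register. -/
def imBits (p : ℕ) (v : ValueQubits m → Bool) : ℤ := topBits p fun t => v (Sum.inr t)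

/-- Digits of an angle whose cosine, times `P`, is the truncated real part. -/
def reDigit (p : ℕ) (P : ℤ) (v : ValueQubits m → Bool) (k : ℕ) : Bool :=
  cordicBit P (reBits p v) k

/-- Digits of an angle whose cosine, times the vertical component of the vector found by the first
search, is the truncated imaginary part. -/
def imDigit (p : ℕ) (P : ℤ) (T : ℕ) (v : ValueQubits m → Bool) (k : ℕ) : Bool :=
  cordicBit (cordicState P (reBits p v) T).2.1 (cordicScale T * imBits p v) k

theorem Ready.canHold_topBits {V : Type} {B : ℕ} {fs : List ((V → Bool) → Bool)}
    (hr : Ready fs) (p : ℕ) (e : Fin (m + 1) → V) :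
    CanHold B (p + 1) fs fun v => topBits p fun t => v (e t) := by
  have h1 := hr.canHold_sum (B := B) (fun j v => leadBit (fun t => v (e t)) j)
    (fun j => 2 ^ (p - 1 - j)) p (fun j _ => by
      by_cases h : j < m
      · refine Avail.congr (Or.inr ⟨e ⟨m - 1 - j, by omega⟩, rfl⟩) fun v => ?_
        rw [leadBit, dif_pos h]
      · refine hr.const.congr fun v => ?_
        rw [leadBit, dif_neg h])
  exact h1.sub (hr.holds_condConst (Or.inr ⟨e (Fin.last m), rfl⟩) (2 ^ p)).canHold

theorem exists_digitProgram (m p T : ℕ) (P : ℤ) (hP0 : 0 ≤ P) (hP : P ≤ 2 ^ (p + 2)) :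
    ∃ fs : List ((ValueQubits m → Bool) → Bool), IsSLP fs ∧
      fs.length ≤ 4 + 22 * (p + 5 + 4 * T ^ 2) * (2 * p + 2 + 3 * (T * (20 * T + 22))) ∧
      ∀ k < T, Avail fs (fun v => reDigit p P v k) ∧ Avail fs fun v => imDigit p P T v k := by
  have : Nonempty (ValueQubits m) := ⟨Sum.inl 0⟩
  -- The last search starts from numbers of `p + 2 + 2 T^2` bits, the output of the first one, and
  -- needs another `2 + 2 T^2` bits.
  set B := p + 4 + 4 * T ^ 2 with hB
  have hpow : (2 : ℤ) ^ p ≤ 2 ^ (p + 2) := pow_le_pow_right₀ (by norm_num) (by omega)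
  obtain ⟨f0, hr0, hl0⟩ := IsSLP.ready_of_nonempty (V := ValueQubits m)
  obtain ⟨f1, e1, x1⟩ := hr0.not hr0.const
  have cP : Holds (B + 1) f1 fun _ => P :=
    (e1.ready.holds_condConst x1 P).congr fun v => by simp
  obtain ⟨f2, e2, x2⟩ := e1.ready.canHold_topBits (B := B + 1) p (Sum.inl : _ → ValueQubits m) f1
    e1.ready fun _ h => h
  obtain ⟨f3, e3, x3⟩ := e2.ready.canHold_topBits (B := B + 1) p (Sum.inr : _ → ValueQubits m) f2
    e2.ready fun _ h => h
  have hre : ∀ v : ValueQubits m → Bool, |reBits p v| ≤ 2 ^ (p + 2) :=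
    fun v => (abs_topBits_le p _).trans hpow
  have him : ∀ v : ValueQubits m → Bool, |imBits p v| ≤ 2 ^ (p + 2) :=
    fun v => (abs_topBits_le p _).trans hpow
  have hPb : |P| ≤ 2 ^ (p + 2) := by rwa [abs_of_nonneg hP0]
  obtain ⟨f4, e4, x4, y4⟩ := e3.ready.holdsState_cordic (b := p + 2) (T := T) (B := B)
    (by omega) ((cP.mono e2).mono e3) (x2.mono e3) (fun _ => hPb) hre
  -- The digits of this run are discarded. It serves only to produce the product `cordicScale T *
  -- imBits p v` in its third component, the target of the final search at the scale of its radius.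
  obtain ⟨f5, e5, -, y5⟩ := e4.ready.holdsState_cordic (b := p + 2) (T := T) (B := B)
    (by omega) (((cP.mono e2).mono e3).mono e4) (x3.mono e4) (fun _ => hPb) him
  have him' : ∀ v : ValueQubits m → Bool,
      |(cordicState P (imBits p v) T).2.2| ≤ 2 ^ (p + 2 + 2 * T ^ 2) := by
    intro v
    rw [cordicState_target, abs_mul, abs_of_pos (cordicScale_pos T), mul_comm, pow_add, pow_mul]
    exact mul_le_mul (him v) (cordicScale_le T) (cordicScale_pos T).le (by positivity)
  obtain ⟨f6, e6, x6, -⟩ := e5.ready.holdsState_cordic (b := p + 2 + 2 * T ^ 2) (T := T) (B := B)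
    (by omega) (y4.2.1.mono e5) y5.2.2 (fun v => (abs_cordicState_le hPb T).2) him'
  refine ⟨f6, e6.ready.slp, ?_, fun k hk => ⟨e6.mono _ (e5.mono _ (x4 k hk)), ?_⟩⟩
  · have h := (((e2.trans e3 le_rfl).trans e4 le_rfl).trans e5 le_rfl).trans e6 le_rfl
    have h1 := h.len
    have h2 := e1.len
    simp only [← Nat.mul_add] at h1
    have h3 : regCost (B + 1) = 22 * (p + 5 + 4 * T ^ 2) := by unfold regCost; omega
    rw [h3] at h1
    have h4 : p + 1 + (p + 1) + T * (20 * T + 22) + T * (20 * T + 22) + T * (20 * T + 22) =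
      2 * p + 2 + 3 * (T * (20 * T + 22)) := by ring
    rw [h4] at h1
    omega
  · refine (x6 k hk).congr fun v => ?_
    rw [imDigit, cordicState_target]
    rfl

/-- The vectors found by two successive searches, for the targets `xI` and `yI`. -/
theorem cordic_amplitude {p T : ℕ} (hp : 2 ≤ p) (hT : T = p + 5) {P xI yI : ℤ} {z : ℂ} {δ : ℝ}
    (hδ0 : 0 ≤ δ) (hδ1 : δ ≤ 1) (hP1 : 1 + δ + 6 * (1 / 2) ^ p ≤ P / 2 ^ p)
    (hP2 : P / 2 ^ p ≤ 1 + δ + 7 * (1 / 2) ^ p) (hz : ‖z‖ ≤ 1 + δ) (hxI : |xI| ≤ 2 ^ p)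
    (hre : |z.re - xI / 2 ^ p| ≤ (1 / 2) ^ p) (him : |z.im - yI / 2 ^ p| ≤ (1 / 2) ^ p) :
    ‖((P / 2 ^ p : ℝ) : ℂ) *
        ⟨Real.cos (cordicSum (cordicBit P xI) T),
          Real.sin (cordicSum (cordicBit P xI) T) *
            Real.cos (cordicSum (cordicBit (cordicState P xI T).2.1 (cordicScale T * yI)) T)⟩
      - z‖ ≤ 4 * (1 / 2) ^ p := by
  set h : ℝ := (1 / 2) ^ p with hh
  set ρ : ℝ := P / 2 ^ p with hρ
  have hh0 : 0 < h := by positivity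
  have hh1 : h ≤ 1 / 4 := by
    calc h ≤ (1 / 2) ^ 2 := pow_le_pow_of_le_one (by norm_num) (by norm_num) hp
      _ = 1 / 4 := by norm_num
  have h2p : (0 : ℝ) < 2 ^ p := by positivity
  have hρP : (P : ℝ) = ρ * 2 ^ p := by rw [hρ]; field_simp
  have hP0 : 0 < P := by
    have : (0 : ℝ) < P := by rw [hρP]; apply mul_pos _ h2p; linarith
    exact_mod_cast this
  -- The five extra digits make the relative error of each search `h / 8`. As the radius `ρ` is
  -- below `4`, each component is then accurate to `h / 2`.
  have hhT : 4 * (1 / 2 : ℝ) ^ T = h / 8 := by rw [hT, pow_add, ← hh]; norm_num; ring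
  set x : ℝ := xI / 2 ^ p with hx
  set y : ℝ := yI / 2 ^ p with hy
  have hxP : (xI : ℝ) = x * 2 ^ p := by rw [hx]; field_simp
  have hyP : (yI : ℝ) = y * 2 ^ p := by rw [hy]; field_simp
  have hx1 : |x| ≤ 1 := by
    have : |(xI : ℝ)| ≤ 2 ^ p := by exact_mod_cast hxI
    rw [hx, abs_div, abs_of_pos h2p, div_le_one h2p]; exact this
  -- the first angle
  have hRt : |xI| ≤ P := by
    have : |(xI : ℝ)| ≤ P := by
      rw [hxP, hρP, abs_mul, abs_of_pos h2p]
      exact mul_le_mul_of_nonneg_right (by linarith) h2p.le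
    exact_mod_cast this
  have c1 : |P * Real.cos (cordicSum (cordicBit P xI) T) - xI| ≤ P * (4 * (1 / 2) ^ T) :=
    cordicSum_cos hP0 hRt T
  have m1 : 0 ≤ cordicSum (cordicBit P xI) T ∧ cordicSum (cordicBit P xI) T ≤ Real.pi :=
    cordicSum_mem hP0 hRt T
  have q1 : ((cordicState P (xI) T).2.1 : ℝ) =
      P * cordicScale T * Real.sin (cordicSum (cordicBit P xI) T) := (cordicState_eq P _ T).2
  set a := cordicSum (cordicBit P xI) T with ha
  have hsin : 0 ≤ Real.sin a := Real.sin_nonneg_of_nonneg_of_le_pi m1.1 m1.2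
  have c1' : |ρ * Real.cos a - x| ≤ h / 2 := by
    have e : P * Real.cos a - xI = 2 ^ p * (ρ * Real.cos a - x) := by rw [hρP, hxP]; ring
    rw [e, abs_mul, abs_of_pos h2p, hρP, hhT] at c1
    have : |ρ * Real.cos a - x| ≤ ρ * (h / 8) := by
      refine le_of_mul_le_mul_left (c1.trans_eq ?_) h2p
      ring
    nlinarith
  have hsc : (0 : ℝ) < cordicScale T := by exact_mod_cast cordicScale_pos T
  -- the gap
  have hr : x ^ 2 + y ^ 2 ≤ (1 + δ + 2 * h) ^ 2 := by
    have hn : ‖(⟨x, y⟩ : ℂ)‖ ≤ 1 + δ + 2 * h := by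
      have : ‖(⟨x, y⟩ : ℂ) - z‖ ≤ 2 * h := by
        refine (Complex.norm_le_abs_re_add_abs_im _).trans ?_
        simp only [Complex.sub_re, Complex.sub_im]
        rw [abs_sub_comm x, abs_sub_comm y]
        linarith
      have := norm_le_norm_add_norm_sub' (⟨x, y⟩ : ℂ) z
      linarith
    have hsq : x ^ 2 + y ^ 2 = ‖(⟨x, y⟩ : ℂ)‖ ^ 2 := by
      rw [← Complex.normSq_eq_norm_sq, Complex.normSq_mk]; ring
    rw [hsq]
    exact pow_le_pow_left₀ (norm_nonneg _) hn 2
  -- The second search needs a positive radius `ρ sin a` that is at least `|y|`. The radius `ρ ≥ 1 +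
  -- δ + 6h` exceeds the bound `1 + δ + 2h` for the modulus of `(x, y)`; their squares differ by
  -- more than `8h`, whereas the error in `ρ cos a` changes `x^2` by at most `2h`.
  have hgap : |y| < ρ * Real.sin a := by
    apply abs_lt_of_sq_lt_sq _ (by apply mul_nonneg _ hsin; linarith)
    have e : (ρ * Real.sin a) ^ 2 = ρ ^ 2 - (ρ * Real.cos a) ^ 2 := by
      have := Real.sin_sq_add_cos_sq a
      linear_combination ρ ^ 2 * this
    have e2 : (ρ * Real.cos a) ^ 2 ≤ x ^ 2 + 2 * h := by
      obtain ⟨l1, l2⟩ := abs_le.1 c1'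
      obtain ⟨l3, l4⟩ := abs_le.1 hx1
      set z := ρ * Real.cos a - x with hz
      have : ρ * Real.cos a = x + z := by rw [hz]; ring
      rw [this]
      have hz2 : z ^ 2 ≤ h / 2 := by
        have h3 : z ^ 2 ≤ (h / 2) ^ 2 := sq_le_sq' l1 l2
        have h4 : h * h ≤ h * (1 / 4) := mul_le_mul_of_nonneg_left hh1 hh0.le
        have h5 : (h / 2) ^ 2 = h * h / 4 := by ring
        linarith
      have hxz : x * z ≤ h / 2 := by
        have := abs_mul x z
        have h3 : |x| * |z| ≤ 1 * (h / 2) := mul_le_mul hx1 c1' (abs_nonneg _) (by norm_num)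
        linarith [le_abs_self (x * z)]
      have h3 : (x + z) ^ 2 = x ^ 2 + 2 * (x * z) + z ^ 2 := by ring
      linarith
    have e3 : (1 + δ + 6 * h) ^ 2 ≤ ρ ^ 2 := pow_le_pow_left₀ (by linarith) hP1 2
    have e4 : (1 + δ + 6 * h) ^ 2 =
      (1 + δ + 2 * h) ^ 2 + 8 * h + 8 * (h * δ) + 32 * h ^ 2 := by ring
    have e5 : 0 ≤ h * δ := by positivity
    have e6 : 0 < h ^ 2 := by positivity
    linarith
  -- the second angle
  have hY : 0 < (cordicState P (xI) T).2.1 := by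
    have h1 : 0 < ρ * Real.sin a := (abs_nonneg y).trans_lt hgap
    have : (0 : ℝ) < (cordicState P (xI) T).2.1 := by
      have e : (P : ℝ) * cordicScale T * Real.sin a =
        (ρ * Real.sin a) * (2 ^ p * cordicScale T) := by rw [hρP]; ring
      rw [q1, e]
      positivity
    exact_mod_cast this
  have hYt : |cordicScale T * yI| ≤ (cordicState P (xI) T).2.1 := by
    have : |(cordicScale T * yI : ℝ)| ≤ (cordicState P (xI) T).2.1 := by
      rw [q1, hyP, hρP, abs_mul, abs_mul, abs_of_pos hsc, abs_of_pos h2p]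
      have := mul_le_mul_of_nonneg_right hgap.le (mul_pos hsc h2p).le
      linarith
    exact_mod_cast this
  have c2 : |(cordicState P (xI) T).2.1 * Real.cos (cordicSum (cordicBit (cordicState P xI T).2.1 (cordicScale T * yI)) T) -
      (cordicScale T * yI : ℤ)| ≤
      (cordicState P (xI) T).2.1 * (4 * (1 / 2) ^ T) := cordicSum_cos hY hYt T
  set b := cordicSum (cordicBit (cordicState P xI T).2.1 (cordicScale T * yI)) T with hb
  have c2' : |ρ * (Real.sin a * Real.cos b) - y| ≤ h / 2 := by
    have hs1 := Real.sin_le_one a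
    rw [q1, hhT, hρP] at c2
    push_cast at c2
    rw [hyP] at c2
    have hpos : 0 < 2 ^ p * (cordicScale T : ℝ) := by positivity
    have e : ρ * 2 ^ p * cordicScale T * Real.sin a * Real.cos b - cordicScale T * (y * 2 ^ p) =
      (2 ^ p * cordicScale T) * (ρ * (Real.sin a * Real.cos b) - y) := by ring
    rw [e, abs_mul, abs_of_pos hpos] at c2
    have : |ρ * (Real.sin a * Real.cos b) - y| ≤ ρ * Real.sin a * (h / 8) := by
      refine le_of_mul_le_mul_left (c2.trans_eq ?_) hpos
      ring
    have h3 : ρ * Real.sin a ≤ 4 := by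
      have : ρ * Real.sin a ≤ ρ * 1 := mul_le_mul_of_nonneg_left hs1 (by linarith)
      linarith
    nlinarith
  refine (Complex.norm_le_abs_re_add_abs_im _).trans ?_
  simp only [Complex.sub_re, Complex.sub_im, Complex.re_ofReal_mul, Complex.im_ofReal_mul]
  have t1 := abs_sub_le (ρ * Real.cos a) x z.re
  have t2 := abs_sub_le (ρ * (Real.sin a * Real.cos b)) y z.im
  rw [abs_sub_comm x] at t1
  rw [abs_sub_comm y] at t2
  linarith

theorem fixedComplex_re (v : ValueQubits m → Bool) :
    (fixedComplex v).re = fixedReal fun t => v (Sum.inl t) := rfl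

theorem fixedComplex_im (v : ValueQubits m → Bool) :
    (fixedComplex v).im = fixedReal fun t => v (Sum.inr t) := rfl

/-- Since a rounded entry can leave the unit disc, it is divided by `ρ`, slightly larger than `1 +
min δ 1`. Rounding costs `δ`, the division nearly another `min δ 1`, and the searches and truncation
`O(2^(-p))`. Dividing the total by `ρ` gains a term of order `(min δ 1)^2`, which pays for the last
contribution; this is the meaning of `hpδ`. -/
theorem cordic_approx {p T : ℕ} (hp : 2 ≤ p) (hT : T = p + 5) {P : ℤ} {δ : ℝ} (hδ0 : 0 ≤ δ)
    (hpδ : 11 * (1 / 2) ^ p ≤ 2 * min δ 1 ^ 2)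
    (hP1 : 1 + min δ 1 + 6 * (1 / 2) ^ p ≤ P / 2 ^ p)
    (hP2 : P / 2 ^ p ≤ 1 + min δ 1 + 7 * (1 / 2) ^ p)
    (v : ValueQubits m → Bool) {u : ℂ} (hu : ‖u‖ ≤ 1) (hv : ‖fixedComplex v - u‖ ≤ δ) :
    ‖(⟨Real.cos (cordicSum (reDigit p P v) T),
        Real.sin (cordicSum (reDigit p P v) T) *
          Real.cos (cordicSum (imDigit p P T v) T)⟩ : ℂ) - u‖ ≤ 2 * δ := by
  have hv' : ‖fixedComplex v‖ ≤ 1 + min δ 1 := by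
    rcases le_total δ 1 with h | h
    · rw [min_eq_left h]
      have := norm_le_norm_add_norm_sub' (fixedComplex v) u
      linarith
    -- For a rounding error above `1` the modulus is controlled by the format itself: both
    -- components lie in `[-1, 1]`, so the modulus is at most `2`.
    · rw [min_eq_right h]
      refine (Complex.norm_le_abs_re_add_abs_im _).trans ?_
      rw [fixedComplex_re, fixedComplex_im]
      have h1 := abs_fixedReal_le fun t => v (Sum.inl t)
      have h2 := abs_fixedReal_le fun t => v (Sum.inr t)
      linarith
  have hm0 : 0 ≤ min δ 1 := le_min hδ0 zero_le_one
  have rp : 0 ≤ (fixedComplex v).re - reBits p v / 2 ^ p ∧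
      (fixedComplex v).re - reBits p v / 2 ^ p ≤ (1 / 2) ^ p := by
    rw [fixedComplex_re]
    exact fixedReal_sub_topBits p fun t => v (Sum.inl t)
  have ip : 0 ≤ (fixedComplex v).im - imBits p v / 2 ^ p ∧
      (fixedComplex v).im - imBits p v / 2 ^ p ≤ (1 / 2) ^ p := by
    rw [fixedComplex_im]
    exact fixedReal_sub_topBits p fun t => v (Sum.inr t)
  have key := cordic_amplitude hp hT hm0 (min_le_right δ 1) hP1 hP2 hv'
    (abs_topBits_le p fun t => v (Sum.inl t)) (by rw [abs_of_nonneg]; exacts [rp.2, rp.1])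
    (by rw [abs_of_nonneg]; exacts [ip.2, ip.1])
  change ‖_ * (⟨Real.cos (cordicSum (reDigit p P v) T), Real.sin (cordicSum (reDigit p P v) T) *
          Real.cos (cordicSum (imDigit p P T v) T)⟩ : ℂ) - _‖ ≤ _ at key
  generalize (⟨Real.cos (cordicSum (reDigit p P v) T), Real.sin (cordicSum (reDigit p P v) T) *
          Real.cos (cordicSum (imDigit p P T v) T)⟩ : ℂ) = D at key ⊢
  set ρ : ℝ := P / 2 ^ p with hρ
  have hh0 : (0 : ℝ) < (1 / 2) ^ p := by positivity
  have hρ1 : 1 ≤ ρ := by linarith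
  have e : (ρ : ℂ) * (D - u) =
      (ρ * D - fixedComplex v) + (fixedComplex v - u) - ((ρ - 1 : ℝ) : ℂ) * u := by
    push_cast; ring
  have h1 : ρ * ‖D - u‖ ≤ 4 * (1 / 2) ^ p + δ + (ρ - 1) := by
    have h2 : ‖(ρ : ℂ) * (D - u)‖ = ρ * ‖D - u‖ := by
      rw [norm_mul, Complex.norm_real, Real.norm_of_nonneg (by linarith)]
    rw [← h2, e]
    refine (norm_sub_le _ _).trans (add_le_add ((norm_add_le _ _).trans (add_le_add key hv)) ?_)
    rw [norm_mul, Complex.norm_real, Real.norm_of_nonneg (by linarith)]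
    exact mul_le_of_le_one_right (by linarith) hu
  have h3 : min δ 1 ≤ δ := min_le_left _ _
  -- With `μ = min δ 1` and `h = (1/2)^p`, the left side is at most `11h + δ + μ ≤ 2μ^2 + δ + μ`,
  -- hence at most `2δ(1 + μ) ≤ 2δρ`.
  have h4 : 4 * (1 / 2) ^ p + δ + (ρ - 1) ≤ ρ * (2 * δ) := by nlinarith
  exact le_of_mul_le_mul_left (h1.trans h4) (by linarith)

/-- A Boolean program of polylogarithmic size finds angles that represent the complex number in a
value register. -/
theorem exists_angleProgram {δ : ℝ} (hδ : 0 < δ) :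
    ∃ T : ℕ, (T : ℝ) ≤ 20 * Real.log (2 + 1 / (2 * δ)) ∧ ∀ m : ℕ,
      ∃ (fs : List ((ValueQubits m → Bool) → Bool))
        (c d : (ValueQubits m → Bool) → ℕ → Bool), IsSLP fs ∧ fs.length ≤ 15000 * T ^ 4 ∧
        (∀ k < T, Avail fs (fun v => c v k) ∧ Avail fs fun v => d v k) ∧
        ∀ (v : ValueQubits m → Bool) (u : ℂ), ‖u‖ ≤ 1 → ‖fixedComplex v - u‖ ≤ δ →
          ‖(⟨Real.cos (cordicSum (c v) T),
            Real.sin (cordicSum (c v) T) * Real.cos (cordicSum (d v) T)⟩ : ℂ) - u‖ ≤ 2 * δ := by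
  set κ : ℝ := 1 / (2 * δ) with hκ
  have hκ0 : 0 < κ := by positivity
  set Λ := Real.log (2 + κ) with hΛ
  have hl2 := Real.log_two_gt_d9
  have hΛ1 : Real.log 2 ≤ Λ := Real.log_le_log (by norm_num) (by linarith)
  -- The factor is chosen so that `11 log 2 ≥ 7`, whence `2^p ≥ (2 + κ)^7`. Two of the seven powers
  -- match `(min δ 1)^2`, and the other five supply the numerical constant `2^5 = 32`.
  set p := ⌈11 * Λ⌉₊ with hp
  have hp1 : 11 * Λ ≤ p := Nat.le_ceil _
  have hp2 : (p : ℝ) < 11 * Λ + 1 := Nat.ceil_lt_add_one (by linarith)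
  have hp3 : 2 ≤ p := by
    have : (2 : ℝ) ≤ p := by linarith
    exact_mod_cast this
  have h2p : (2 + κ) ^ 7 ≤ (2 : ℝ) ^ p := by
    rw [← Real.exp_log (by positivity : 0 < (2 + κ) ^ 7),
      ← Real.exp_log (by positivity : (0 : ℝ) < 2 ^ p), Real.log_pow, Real.log_pow]
    apply Real.exp_le_exp.2
    push_cast
    rw [← hΛ]
    nlinarith
  have hpos : (0 : ℝ) < 2 ^ p := by positivity
  have hpδ : 11 * (1 / 2) ^ p ≤ 2 * min δ 1 ^ 2 := by
    have h1 : 1 / (2 * (2 + κ)) ≤ min δ 1 := by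
      apply le_min
      · have : δ = 1 / (2 * κ) := by rw [hκ]; field_simp
        rw [this]
        apply one_div_le_one_div_of_le <;> linarith
      · rw [div_le_one (by positivity)]; linarith
    have h2 : 1 / (2 * (2 + κ)) ^ 2 ≤ min δ 1 ^ 2 := by
      rw [← one_div_pow]
      exact pow_le_pow_left₀ (by positivity) h1 2
    refine le_trans ?_ (mul_le_mul_of_nonneg_left h2 (by norm_num))
    rw [one_div_pow, mul_one_div, mul_one_div, div_le_div_iff₀ hpos (by positivity)]
    have h3 : (32 : ℝ) ≤ (2 + κ) ^ 5 := by
      calc (32 : ℝ) = 2 ^ 5 := by norm_num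
        _ ≤ _ := pow_le_pow_left₀ (by norm_num) (by linarith) 5
    have h4 : (2 + κ) ^ 7 = (2 + κ) ^ 5 * (2 + κ) ^ 2 := by ring
    have h5 : 32 * (2 + κ) ^ 2 ≤ (2 + κ) ^ 5 * (2 + κ) ^ 2 :=
      mul_le_mul_of_nonneg_right h3 (by positivity)
    nlinarith [sq_nonneg (2 + κ)]
  have hm0 : 0 ≤ min δ 1 := le_min hδ.le zero_le_one
  -- Rounding up and adding `6` places the integer radius between six and seven units above `2^p (1
  -- + min δ 1)`, the window required by the two searches.
  set P : ℤ := ⌈2 ^ p * (1 + min δ 1)⌉ + 6 with hP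
  have hPa : 2 ^ p * (1 + min δ 1) + 6 ≤ P := by
    rw [hP]; push_cast; linarith [Int.le_ceil (2 ^ p * (1 + min δ 1))]
  have hPb : (P : ℝ) ≤ 2 ^ p * (1 + min δ 1) + 7 := by
    rw [hP]; push_cast; linarith [Int.ceil_lt_add_one (2 ^ p * (1 + min δ 1))]
  have hhp : (1 / 2 : ℝ) ^ p * 2 ^ p = 1 := by rw [one_div_pow]; field_simp
  have hP1 : 1 + min δ 1 + 6 * (1 / 2) ^ p ≤ P / 2 ^ p := by
    rw [le_div_iff₀ hpos]; nlinarith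
  have hP2 : P / 2 ^ p ≤ 1 + min δ 1 + 7 * (1 / 2) ^ p := by
    rw [div_le_iff₀ hpos]; nlinarith
  have hP0 : 0 ≤ P := by
    have : (0 : ℝ) ≤ P := le_trans (by positivity) hPa
    exact_mod_cast this
  have hP3 : P ≤ 2 ^ (p + 2) := by
    have h4 : (4 : ℝ) ≤ 2 ^ p := by
      calc (4 : ℝ) = 2 ^ 2 := by norm_num
        _ ≤ _ := pow_le_pow_right₀ (by norm_num) hp3
    have : (P : ℝ) ≤ 2 ^ (p + 2) := by
      rw [pow_add]
      nlinarith [min_le_right δ 1]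
    exact_mod_cast this
  -- From `p < 11Λ + 1` one gets `p + 5 < 11Λ + 6 ≤ 20Λ`, because `9 log 2 > 6`.
  refine ⟨p + 5, by push_cast; linarith, fun m => ?_⟩
  obtain ⟨fs, h1, h2, h3⟩ := exists_digitProgram m p (p + 5) P hP0 hP3
  refine ⟨fs, reDigit p P, imDigit p P (p + 5), h1, h2.trans ?_, h3, fun v u hu hv =>
    cordic_approx hp3 rfl hδ.le hpδ hP1 hP2 v hu hv⟩
  generalize hT : p + 5 = T
  have hp5 : 5 ≤ T := by omega
  have hp6 : p ≤ T := by omega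
  clear_value p
  have hT1 : T + 4 * T ^ 2 ≤ 5 * T ^ 2 := by nlinarith
  have hT2 : 2 * p + 2 + 3 * (T * (20 * T + 22)) ≤ 128 * T ^ 2 := by nlinarith
  have hT3 : 1 ≤ T ^ 4 := Nat.one_le_pow _ _ (by omega)
  calc 4 + 22 * (T + 4 * T ^ 2) * (2 * p + 2 + 3 * (T * (20 * T + 22)))
      ≤ 4 + 22 * (5 * T ^ 2) * (128 * T ^ 2) := by gcongr
    _ = 4 + 14080 * T ^ 4 := by ring
    _ ≤ 15000 * T ^ 4 := by omega

end FixedPoint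

/-! ## Binary expansions -/

section Bits

theorem bits_ofBits {n : ℕ} (f : Fin n → Bool) : bits n (Nat.ofBits f) = f := by
  funext t
  exact Nat.testBit_ofBits_lt f t t.isLt

theorem ofBits_bits {n k : ℕ} (hk : k < 2 ^ n) : Nat.ofBits (bits n k) = k := by
  apply Nat.eq_of_testBit_eq
  intro i
  by_cases hi : i < n
  · rw [Nat.testBit_ofBits_lt _ _ hi]; rfl
  · rw [Nat.testBit_ofBits_ge _ _ (not_lt.1 hi), Nat.testBit_lt_two_pow]
    exact hk.trans_le (Nat.pow_le_pow_right (by norm_num) (not_lt.1 hi))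

theorem bits_injective {n k l : ℕ} (hk : k < 2 ^ n) (hl : l < 2 ^ n) (h : bits n k = bits n l) :
    k = l := by
  rw [← ofBits_bits hk, h, ofBits_bits hl]

theorem ofBits_castSucc {N : ℕ} (f : Fin (N + 1) → Bool) :
    Nat.ofBits f = Nat.ofBits (f ∘ Fin.castSucc) + 2 ^ N * (f (Fin.last N)).toNat := by
  induction N with
  | zero => rw [Nat.ofBits_succ]; simp
  | succ N ih =>
    rw [Nat.ofBits_succ, ih, Nat.ofBits_succ (f ∘ Fin.castSucc)]
    have h1 : (f ∘ Fin.castSucc) 0 = f 0 := rfl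
    have h2 : (f ∘ Fin.succ) (Fin.last N) = f (Fin.last (N + 1)) := rfl
    have h3 : (f ∘ Fin.succ) ∘ Fin.castSucc = (f ∘ Fin.castSucc) ∘ Fin.succ := rfl
    rw [h1, h2, h3, pow_succ]
    ring

theorem bits_succ_comp_castSucc (n k : ℕ) : bits (n + 1) k ∘ Fin.castSucc = bits n k := rfl

theorem bits_last {n k : ℕ} (hk : k < 2 ^ n) : bits (n + 1) k (Fin.last n) = false :=
  Nat.testBit_lt_two_pow hk

end Bits

/-! ## Gates from isometries -/

section Gates

variable {K Q : Type} [Fintype K] [DecidableEq K] [Fintype Q] [DecidableEq Q]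

/-- Every isometry defined on some basis states extends to a unitary operator. -/
theorem exists_unitary (S : Set (K → Bool)) (v : (K → Bool) → (K → Bool) → ℂ)
    (h : ∀ x ∈ S, ∀ y ∈ S, ∑ z, star (v x z) * v y z = if x = y then 1 else 0) :
    ∃ U : QUnitary K, ∀ x ∈ S, U.val.mulVec (ket x) = v x := by
  classical
  let w : (K → Bool) → EuclideanSpace ℂ (K → Bool) := fun x => WithLp.toLp 2 (v x)
  have hin : ∀ a b : EuclideanSpace ℂ (K → Bool), inner ℂ a b = ∑ z, star (a z) * b z := by
    intro a b
    rw [PiLp.inner_apply]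
    refine Finset.sum_congr rfl fun z _ => ?_
    rw [RCLike.inner_apply, mul_comm]
    rfl
  have hv : Orthonormal ℂ (S.domRestrict w) := by
    rw [orthonormal_iff_ite]
    rintro ⟨x, hx⟩ ⟨y, hy⟩
    rw [hin]
    simpa [Subtype.ext_iff] using h x hx y hy
  obtain ⟨b, hb⟩ := Orthonormal.exists_orthonormalBasis_extension_of_card_eq
    (by simp) hv
  -- The prescribed vectors are completed to an orthonormal basis, indexed by all basis states,
  -- whose members become the columns.
  refine ⟨⟨Matrix.of fun x y => b y x, ?_⟩, fun x hx => ?_⟩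
  · rw [Matrix.mem_unitaryGroup_iff']
    ext x y
    have := orthonormal_iff_ite.1 b.orthonormal x y
    rw [hin] at this
    rw [Matrix.one_apply, ← this]
    rfl
  · rw [mulVec_ket]
    funext z
    have := hb x hx
    change b x z = _
    rw [this]

theorem applyOn_mulVec (e : K ↪ Q) (U : Matrix (K → Bool) (K → Bool) ℂ) (ψ : (Q → Bool) → ℂ)
    (z : Q → Bool) :
    (applyOn e U).mulVec ψ z = ∑ l, U (z ∘ e) l * ψ (Function.extend e l z) := by
  have hψ : ψ = ∑ x, ψ x • ket x := by
    funext y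
    simp [Finset.sum_apply, ket_apply]
  have h1 : (applyOn e U).mulVec ψ z = ∑ x, applyOn e U z x * ψ x := rfl
  rw [h1]
  have hinj : Function.Injective fun l : K → Bool => Function.extend e l z := by
    intro l l' hl
    rw [← extend_comp_self e l z, ← extend_comp_self e l' z]
    exact congrArg (· ∘ e) hl
  rw [← Finset.sum_subset (Finset.subset_univ (Finset.univ.image
    fun l : K → Bool => Function.extend e l z)), Finset.sum_image fun _ _ _ _ h => hinj h]
  · refine Finset.sum_congr rfl fun l _ => ?_
    congr 1
    rw [applyOn, if_pos, extend_comp_self]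
    intro q hq
    rw [Function.extend_apply' _ _ _ (fun ⟨a, ha⟩ => hq ⟨a, ha⟩)]
  · intro x _ hx
    rw [applyOn, if_neg, zero_mul]
    intro h
    apply hx
    rw [Finset.mem_image]
    refine ⟨x ∘ e, Finset.mem_univ _, ((eq_extend_iff e _ _ _).2 ⟨rfl, fun q hq => ?_⟩).symm⟩
    exact (h q hq).symm

theorem sum_bool_two (f : (Fin 2 → Bool) → ℂ) :
    ∑ l, f l = f ![false, false] + f ![true, false] + f ![false, true] + f ![true, true] := by
  rw [← (finTwoArrowEquiv Bool).symm.sum_comp, Fintype.sum_prod_type, Fintype.sum_bool,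
    Fintype.sum_bool, Fintype.sum_bool]
  simp only [finTwoArrowEquiv_symm_apply]
  ring

end Gates

/-! ## Uniform superpositions -/

section Prep

/-- The state `p |u_M⟩|0⟩ + q |u_(2^N)⟩|1⟩`, where `u_M` is the uniform superposition of the numbers
below `M`. -/
noncomputable def prepState (N M : ℕ) (p q : ℝ) : (Fin (N + 1) → Bool) → ℂ := fun x =>
  if x (Fin.last N) then ((q / √(2 ^ N) : ℝ) : ℂ)
  else if Nat.ofBits (x ∘ Fin.castSucc) < M then ((p / √M : ℝ) : ℂ) else 0

/-- One step of the preparation acts on the old flag and a fresh qubit: the old flag becomes the new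
leading bit, and the fresh qubit becomes the flag. Flag `0` goes to leading bit `t`. Flag `1` splits
into leading bit `¬t` without flag, amplitude `x`, and a uniformly random leading bit with flag,
amplitude `y`. Only inputs whose fresh qubit is `0` matter. -/
theorem exists_prep_gate (t : Bool) {x y : ℝ} (h : x ^ 2 + y ^ 2 = 1) :
    ∃ U : QUnitary (Fin 2), ∀ a b : Bool,
      U.val ![a, b] ![false, false] = (if a = t ∧ b = false then 1 else 0) ∧
      U.val ![a, b] ![true, false] =
        if b then ((y / √2 : ℝ) : ℂ) else if a = t then 0 else (x : ℂ) := by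
  let v : (Fin 2 → Bool) → (Fin 2 → Bool) → ℂ := fun i z =>
    if i 0 then (if z 1 then ((y / √2 : ℝ) : ℂ) else if z 0 = t then 0 else (x : ℂ))
    else if z 0 = t ∧ z 1 = false then 1 else 0
  have hy : (y / √2) * (y / √2) = y ^ 2 / 2 := by
    rw [div_mul_div_comm, Real.mul_self_sqrt (by norm_num)]; ring
  have hyc : ((y / √2 : ℝ) : ℂ) * ((y / √2 : ℝ) : ℂ) = ((y ^ 2 / 2 : ℝ) : ℂ) := by
    rw [← hy]; push_cast; ring
  have hxy : (x : ℂ) * x + (y ^ 2 / 2 : ℝ) + (y ^ 2 / 2 : ℝ) = 1 := by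
    rw [← Complex.ofReal_mul, ← Complex.ofReal_add, ← Complex.ofReal_add, ← Complex.ofReal_one]
    congr 1; linarith
  obtain ⟨U, hU⟩ := exists_unitary {i : Fin 2 → Bool | i 1 = false} v (by
    intro i hi j hj
    have key : ∀ i : Fin 2 → Bool, i 1 = false → i = ![i 0, false] := by
      intro i hi; funext k; fin_cases k <;> simp [hi]
    rw [key i hi, key j hj, sum_bool_two]
    cases i 0 <;> cases j 0 <;> cases t <;> simp [v, hyc, -Complex.ofReal_div,
      -Complex.ofReal_pow, Complex.conj_ofReal] <;> linear_combination hxy)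
  refine ⟨U, fun a b => ⟨?_, ?_⟩⟩
  · have := congrFun (hU ![false, false] rfl) ![a, b]
    rw [mulVec_ket] at this
    cases a <;> cases b <;> cases t <;> simpa [v] using this
  · have := congrFun (hU ![true, false] rfl) ![a, b]
    rw [mulVec_ket] at this
    cases a <;> cases b <;> cases t <;> simpa [v] using this

variable {n m : ℕ}

/-- Carrying a full superposition `u_(2^N)` on the flagged branch closes the induction for every
`M`, not only for powers of two. Splitting off the leading bit of the numbers below `M` leaves at
most one incomplete range and one complete range, and the complete one is taken from the flagged
branch. Each additional bit costs one exact two-qubit gate. -/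
theorem exists_prep_chain (N : ℕ) : ∀ (M : ℕ) (p q : ℝ), 1 ≤ M → M ≤ 2 ^ N →
    p ^ 2 + q ^ 2 = 1 → ∃ gs : List (Instr n m (Fin (N + 1))), GatesOnly gs ∧
      gs.length = N + 1 ∧ ∀ O, (circuitMatrix O gs).mulVec (ket fun _ => false) =
        prepState N M p q := by
  induction N with
  | zero =>
    intro M p q hM1 hM2 hpq
    have hM : M = 1 := by simp at hM2; omega
    subst hM
    let v : (Fin 1 → Bool) → ℂ := fun z => if z 0 then (q : ℂ) else (p : ℂ)
    obtain ⟨U, hU⟩ := exists_unitary {fun _ : Fin 1 => false} (fun _ => v) (by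
      rintro x rfl y rfl
      rw [← (Equiv.funUnique (Fin 1) Bool).symm.sum_comp, Fintype.sum_bool]
      simp only [v, Equiv.funUnique_symm_apply, uniqueElim_const, if_true]
      simp only [Bool.false_eq_true, if_false, RCLike.star_def, Complex.conj_ofReal]
      rw [← Complex.ofReal_mul, ← Complex.ofReal_mul, ← Complex.ofReal_add,
        ← Complex.ofReal_one]
      congr 1; linarith)
    refine ⟨[Instr.gate1 (Function.Embedding.refl _) U], by simp [GatesOnly, Instr.isGate], rfl,
      fun O => ?_⟩
    have h1 : (applyOn (Function.Embedding.refl (Fin 1)) U.val) = U.val := by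
      ext x y
      rw [applyOn, if_pos (fun q hq => absurd ⟨q, rfl⟩ hq)]
      rfl
    simp only [circuitMatrix, Instr.matrix, Matrix.one_mul, h1]
    rw [hU _ rfl]
    funext z
    have h2 : Fin.last 0 = 0 := rfl
    simp [prepState, v, h2]
  | succ N ih =>
    intro M p q hM1 hM2 hpq
    obtain ⟨M', p', q', t, x, y, hM1', hM2', hpq', hxy, hfin⟩ :
        ∃ (M' : ℕ) (p' q' : ℝ) (t : Bool) (x y : ℝ), 1 ≤ M' ∧ M' ≤ 2 ^ N ∧
          p' ^ 2 + q' ^ 2 = 1 ∧ x ^ 2 + y ^ 2 = 1 ∧ ∀ z : Fin (N + 2) → Bool,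
          prepState (N + 1) M p q z =
            if z (Fin.last (N + 1)) then ((q' / √(2 ^ N) * (y / √2) : ℝ) : ℂ)
            else if z (Fin.last N).castSucc = t then
              (if Nat.ofBits (z ∘ Fin.castSucc ∘ Fin.castSucc) < M' then ((p' / √M' : ℝ) : ℂ)
                else 0)
            else ((q' / √(2 ^ N) * x : ℝ) : ℂ) := by
      have hval : ∀ z : Fin (N + 2) → Bool, Nat.ofBits (z ∘ Fin.castSucc) =
          Nat.ofBits (z ∘ Fin.castSucc ∘ Fin.castSucc) +
            2 ^ N * (z (Fin.last N).castSucc).toNat := fun z => ofBits_castSucc _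
      have hs : √(2 ^ (N + 1) : ℝ) = √(2 ^ N) * √2 := by
        rw [pow_succ, Real.sqrt_mul (by positivity)]
      rcases le_or_gt M (2 ^ N) with hM | hM
      -- Here all numbers below `M` have leading bit `0`: the unflagged branch is kept, and the
      -- flagged branch merely gains a uniform bit.
      · refine ⟨M, p, q, false, 0, 1, hM1, hM, hpq, by norm_num, fun z => ?_⟩
        rw [prepState, hval, hs]
        cases hz1 : z (Fin.last (N + 1))
        · cases hz2 : z (Fin.last N).castSucc
          · simp
          · have : ¬ (Nat.ofBits (z ∘ Fin.castSucc ∘ Fin.castSucc) + 2 ^ N < M) := by omega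
            simp [this]
        · simp only [if_true]
          congr 1
          field_simp
      · obtain ⟨M', rfl⟩ := Nat.exists_eq_add_of_lt hM
        set M₁ := M' + 1 with hM₁
        have hMe : 2 ^ N + M' + 1 = 2 ^ N + M₁ := by omega
        rw [hMe] at hM1 hM2 ⊢
        set M : ℕ := 2 ^ N + M₁ with hMdef
        have hMr : (M : ℝ) = 2 ^ N + M₁ := by rw [hMdef]; push_cast; ring
        have hM₁0 : (0 : ℝ) < M₁ := by rw [hM₁]; positivity
        have hM0 : (0 : ℝ) < M := by rw [hMr]; positivity
        have h2N : (0 : ℝ) < 2 ^ N := by positivity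
        -- Here `M = 2^N + M₁`. The unflagged branch becomes the `M₁` numbers with leading bit `1`,
        -- with their share of the amplitude. The flagged branch `q'` must supply both the `2^N`
        -- numbers with leading bit `0` and the new flagged branch; `M₁ < M` keeps `q'` positive, so
        -- one may divide by it.
        set p' := p * √M₁ / √M with hp'
        have hp'2 : p' ^ 2 = p ^ 2 * M₁ / M := by
          rw [hp', div_pow, mul_pow, Real.sq_sqrt hM₁0.le, Real.sq_sqrt hM0.le]
        have hq2 : 1 - p' ^ 2 = q ^ 2 + p ^ 2 * 2 ^ N / M := by
          rw [hp'2, ← hpq, hMr]; field_simp; ring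
        have hpos : 0 < 1 - p' ^ 2 := by
          rw [hq2]
          rcases eq_or_ne p 0 with h | h
          · have : q ^ 2 = 1 := by rw [← hpq, h]; ring
            rw [this, h]; norm_num
          · positivity
        set q' := √(1 - p' ^ 2) with hq'
        have hq'0 : 0 < q' := Real.sqrt_pos.2 hpos
        have hq'2 : q' ^ 2 = q ^ 2 + p ^ 2 * 2 ^ N / M := by
          rw [hq', Real.sq_sqrt hpos.le, hq2]
        refine ⟨M₁, p', q', true, p * √(2 ^ N) / (√M * q'), q / q', by omega, ?_, ?_, ?_,
          fun z => ?_⟩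
        · rw [pow_succ] at hM2; omega
        · rw [hq', Real.sq_sqrt hpos.le]; ring
        · rw [div_pow, div_pow, mul_pow, mul_pow, Real.sq_sqrt hM0.le, Real.sq_sqrt h2N.le,
            hq'2]
          have : q ^ 2 + p ^ 2 * 2 ^ N / M ≠ 0 := by rw [← hq2]; exact hpos.ne'
          rw [← div_div (p ^ 2 * 2 ^ N), ← add_div, add_comm, div_self this]
        · have hlt : Nat.ofBits (z ∘ Fin.castSucc ∘ Fin.castSucc) < 2 ^ N :=
            Nat.ofBits_lt_two_pow _
          rw [prepState, hval, hs]
          have hsM : √(M : ℝ) ≠ 0 := (Real.sqrt_pos.2 hM0).ne'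
          have hsM₁ : √(M₁ : ℝ) ≠ 0 := (Real.sqrt_pos.2 hM₁0).ne'
          have hs2 : √(2 ^ N : ℝ) ≠ 0 := (Real.sqrt_pos.2 h2N).ne'
          have hq0 := hq'0.ne'
          cases hz1 : z (Fin.last (N + 1))
          · cases hz2 : z (Fin.last N).castSucc
            · have : Nat.ofBits (z ∘ Fin.castSucc ∘ Fin.castSucc) < M := by omega
              simp only [Bool.false_eq_true, if_false, Bool.toNat_false, mul_zero, add_zero,
                this, if_true]
              congr 1
              field_simp
            · have : Nat.ofBits (z ∘ Fin.castSucc ∘ Fin.castSucc) + 2 ^ N < M ↔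
                  Nat.ofBits (z ∘ Fin.castSucc ∘ Fin.castSucc) < M₁ := by omega
              simp only [Bool.false_eq_true, if_false, Bool.toNat_true, mul_one, this, if_true]
              have h4 : p' / √M₁ = p / √M := by rw [hp']; field_simp
              rw [h4]
          · simp only [if_true]
            congr 1
            field_simp
    obtain ⟨gs, h1, h2, h3⟩ := ih M' p' q' hM1' hM2' hpq'
    obtain ⟨U, hU⟩ := exists_prep_gate t hxy
    let e : Fin 2 ↪ Fin (N + 2) :=
      ⟨![(Fin.last N).castSucc, Fin.last (N + 1)], by
        intro a b hab
        have h0 : ((Fin.last N).castSucc : Fin (N + 2)) ≠ Fin.last (N + 1) :=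
          (Fin.castSucc_lt_last _).ne
        fin_cases a <;> fin_cases b
        exacts [rfl, absurd hab h0, absurd hab h0.symm, rfl]⟩
    have he0 : e 0 = (Fin.last N).castSucc := rfl
    have he1 : e 1 = Fin.last (N + 1) := rfl
    refine ⟨gs.map (Instr.mapQubits Fin.castSuccEmb) ++ [Instr.gate2 e U],
      (h1.mapQubits _).append (by simp [GatesOnly, Instr.isGate]), by simp [h2], fun O => ?_⟩
    rw [circuitMatrix_append_mulVec, circuitMatrix_mapQubits]
    have hfirst : ∀ w, (applyOn Fin.castSuccEmb (circuitMatrix O gs)).mulVec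
        (ket fun _ => false) w = if w (Fin.last (N + 1)) then 0 else
          prepState N M' p' q' (w ∘ Fin.castSucc) := by
      intro w
      rw [mulVec_ket]
      have h4 : (∀ q, q ∉ Set.range (Fin.castSuccEmb : Fin (N + 1) ↪ Fin (N + 2)) →
          w q = false) ↔ w (Fin.last (N + 1)) = false := by
        constructor
        · intro h
          refine h _ ?_
          rintro ⟨a, ha⟩
          exact (Fin.castSucc_lt_last a).ne ha
        · intro h q hq
          rcases Fin.eq_castSucc_or_eq_last q with ⟨a, rfl⟩ | rfl
          · exact absurd ⟨a, rfl⟩ hq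
          · exact h
      have h5 := congrFun (h3 O) (w ∘ Fin.castSucc)
      rw [mulVec_ket] at h5
      simp only [applyOn, h4]
      cases hw : w (Fin.last (N + 1))
      · simp only [if_true, Bool.false_eq_true, if_false]
        exact h5
      · simp
    simp only [circuitMatrix, Matrix.one_mul, Instr.matrix]
    funext z
    rw [applyOn_mulVec, sum_bool_two, hfin]
    simp only [hfirst]
    have hz : z ∘ e = ![z (Fin.last N).castSucc, z (Fin.last (N + 1))] := by
      funext k; fin_cases k <;> rfl
    have ev : ∀ a b : Bool, Function.extend e ![a, b] z (Fin.last (N + 1)) = b := by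
      intro a b; rw [← he1, e.injective.extend_apply]; rfl
    have ep : ∀ a : Bool, prepState N M' p' q' (Function.extend e ![a, false] z ∘ Fin.castSucc) =
        if a then ((q' / √(2 ^ N) : ℝ) : ℂ)
        else if Nat.ofBits (z ∘ Fin.castSucc ∘ Fin.castSucc) < M' then ((p' / √M' : ℝ) : ℂ)
          else 0 := by
      intro a
      have h6 : (Function.extend e ![a, false] z ∘ Fin.castSucc) (Fin.last N) = a := by
        rw [Function.comp_apply, ← he0, e.injective.extend_apply]; rfl
      have h7 : (Function.extend e ![a, false] z ∘ Fin.castSucc) ∘ Fin.castSucc =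
          z ∘ Fin.castSucc ∘ Fin.castSucc := by
        funext k
        simp only [Function.comp_apply]
        rw [Function.extend_apply']
        rintro ⟨b, hb⟩
        fin_cases b
        · exact (Fin.castSucc_lt_last k).ne (Fin.castSucc_injective _ hb.symm)
        · exact (Fin.castSucc_lt_last k.castSucc).ne hb.symm
      rw [prepState, h6, h7]
    rw [ev, ev, ev, ev, ep, ep, hz, (hU _ _).1, (hU _ _).2]
    cases hz1 : z (Fin.last (N + 1)) <;> by_cases hz2 : z (Fin.last N).castSucc = t <;>
      simp [hz2] <;> ring

/-- The uniform superposition of the numbers below `M` is prepared with `N + 1` gates. -/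
theorem exists_uniform_prep {N M : ℕ} (hM1 : 1 ≤ M) (hM2 : M ≤ 2 ^ N) :
    ∃ gs : List (Instr n m (Fin (N + 1))), GatesOnly gs ∧ gs.length = N + 1 ∧
      ∀ O, (circuitMatrix O gs).mulVec (ket fun _ => false) =
        ∑ k ∈ Finset.range M, ((1 / √M : ℝ) : ℂ) • ket (bits (N + 1) k) := by
  obtain ⟨gs, h1, h2, h3⟩ := exists_prep_chain (n := n) (m := m) N M 1 0 hM1 hM2 (by norm_num)
  refine ⟨gs, h1, h2, fun O => ?_⟩
  rw [h3]
  funext z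
  rw [Finset.sum_apply]
  simp only [Pi.smul_apply, ket_apply, smul_eq_mul, mul_ite, mul_one, mul_zero]
  have hz : z (Fin.last N) = false →
      ∀ k < M, z = bits (N + 1) k ↔ k = Nat.ofBits (z ∘ Fin.castSucc) := by
    intro hz k hk
    constructor
    · rintro rfl
      rw [bits_succ_comp_castSucc, ofBits_bits (hk.trans_le hM2)]
    · rintro rfl
      have : Nat.ofBits (z ∘ Fin.castSucc) = Nat.ofBits z := by
        rw [ofBits_castSucc z, hz]; simp
      rw [this, bits_ofBits]
  rw [prepState]
  cases hl : z (Fin.last N)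
  · rw [if_neg (by simp)]
    split_ifs with h
    · rw [Finset.sum_eq_single (Nat.ofBits (z ∘ Fin.castSucc))]
      · rw [if_pos ((hz hl _ h).2 rfl)]
      · intro k hk hne
        rw [if_neg]
        intro h'
        exact hne ((hz hl k (Finset.mem_range.1 hk)).1 h')
      · intro h'
        exact absurd (Finset.mem_range.2 h) h'
    · rw [Finset.sum_eq_zero]
      intro k hk
      rw [if_neg]
      intro h'
      rw [hz hl k (Finset.mem_range.1 hk)] at h'
      exact h (h' ▸ Finset.mem_range.1 hk)
  · rw [if_pos rfl, Finset.sum_eq_zero]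
    · simp
    · intro k hk
      rw [if_neg]
      rintro rfl
      rw [bits_last ((Finset.mem_range.1 hk).trans_le hM2)] at hl
      exact absurd hl (by simp)

end Prep

/-! ## Controlled gates with a single target -/

section Controlled

variable {n m : ℕ} {Q : Type} [Fintype Q] [DecidableEq Q]

/-- The state `|x⟩` with the qubit `t` replaced by the state `ψ`. -/
noncomputable def pairState (x : Q → Bool) (t : Q) (ψ : Bool → ℂ) : (Q → Bool) → ℂ :=
  ψ false • ket (Function.update x t false) + ψ true • ket (Function.update x t true)

theorem ket_eq_pairState (x : Q → Bool) (t : Q) : ket x = pairState x t (Pi.single (x t) 1) := by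
  cases h : x t
  · have : Function.update x t false = x := by rw [← h, Function.update_eq_self]
    simp [pairState, this]
  · have : Function.update x t true = x := by rw [← h, Function.update_eq_self]
    simp [pairState, this]

theorem pairState_single (x : Q → Bool) (t : Q) (b : Bool) :
    pairState x t (Pi.single b 1) = ket (Function.update x t b) := by
  cases b <;> simp [pairState]

/-- The columns of a `2 × 2` matrix are orthonormal. -/
def IsIsometry (M : Matrix Bool Bool ℂ) : Prop :=
  ∀ a b, star (M false a) * M false b + star (M true a) * M true b = if a = b then 1 else 0

theorem exists_single_gate (t : Q) {M : Matrix Bool Bool ℂ} (hM : IsIsometry M) :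
    ∃ g : Instr n m Q, g.isGate = true ∧ ∀ O x ψ,
      (g.matrix O).mulVec (pairState x t ψ) = pairState x t (M.mulVec ψ) := by
  obtain ⟨U, hU⟩ := exists_unitary (K := Fin 1) Set.univ (fun y z => M (z 0) (y 0)) (by
    intro x _ y _
    rw [← (Equiv.funUnique (Fin 1) Bool).symm.sum_comp, Fintype.sum_bool]
    have h : x = y ↔ x 0 = y 0 :=
      ⟨fun h => by rw [h], fun h => funext fun k => by rwa [Subsingleton.elim k 0]⟩
    simp only [Equiv.funUnique_symm_apply, uniqueElim_const, h]
    rw [add_comm]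
    exact hM _ _)
  let e : Fin 1 ↪ Q := ⟨fun _ => t, fun a b _ => Subsingleton.elim a b⟩
  refine ⟨Instr.gate1 e U, rfl, fun O x ψ => ?_⟩
  have hext : ∀ (b : Bool) (x : Q → Bool), Function.extend e (fun _ => b) x =
      Function.update x t b := by
    intro b x
    refine ((eq_extend_iff e _ _ _).2 ⟨?_, fun q hq => ?_⟩).symm
    · funext k
      change b = Function.update x t b t
      simp
    · rw [Function.update_of_ne]
      rintro rfl
      exact hq ⟨0, rfl⟩
  have hket : ∀ b, ((Instr.gate1 e U : Instr n m Q).matrix O).mulVec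
      (ket (Function.update x t b)) = M false b • ket (Function.update x t false) +
        M true b • ket (Function.update x t true) := by
    intro b
    rw [Instr.matrix, applyOn_mulVec_ket, ← (Equiv.funUnique (Fin 1) Bool).symm.sum_comp,
      Fintype.sum_bool]
    have he : Function.update x t b ∘ e = fun _ => b := by
      funext k
      change Function.update x t b t = b
      simp
    have hUb : ∀ a : Bool, U.val (fun _ => a) (fun _ => b) = M a b := by
      intro a
      have := congrFun (hU (fun _ => b) trivial) (fun _ => a)
      rwa [mulVec_ket] at this
    simp only [Equiv.funUnique_symm_apply, he]
    have hc : ∀ a : Bool, (uniqueElim a : Fin 1 → Bool) = fun _ => a := fun a => by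
      funext k; simp
    rw [hc, hc, hUb, hUb, hext, hext, Function.update_idem, Function.update_idem, add_comm]
  rw [pairState, Matrix.mulVec_add, Matrix.mulVec_smul, Matrix.mulVec_smul, hket, hket, pairState]
  simp only [Matrix.mulVec, dotProduct, Fintype.sum_bool]
  module

/-- Such a gate does not change `x` away from its target, so a sequence of gates with a common
target is a product of `2 × 2` matrices whose factors are selected by the fixed control bits. -/
theorem exists_controlled_gate {c t : Q} (hct : c ≠ t) {M : Matrix Bool Bool ℂ}
    (hM : IsIsometry M) : ∃ g : Instr n m Q, g.isGate = true ∧ ∀ O x ψ,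
      (g.matrix O).mulVec (pairState x t ψ) =
        pairState x t (if x c then M.mulVec ψ else ψ) := by
  have h1 : IsIsometry (1 : Matrix Bool Bool ℂ) := by
    intro a b; cases a <;> cases b <;> simp
  let N : Bool → Matrix Bool Bool ℂ := fun b => if b then M else 1
  have hN : ∀ b, IsIsometry (N b) := by
    intro b; cases b
    exacts [h1, hM]
  obtain ⟨U, hU⟩ := exists_unitary (K := Fin 2) Set.univ
    (fun y z => if z 0 = y 0 then N (y 0) (z 1) (y 1) else 0) (by
    intro x _ y _
    rw [sum_bool_two]
    have h : x = y ↔ x 0 = y 0 ∧ x 1 = y 1 :=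
      ⟨fun h => by simp [h], fun h => funext fun k => by fin_cases k; exacts [h.1, h.2]⟩
    simp only [h]
    have key := hN (x 0) (x 1) (y 1)
    cases hx : x 0 <;> cases hy : y 0 <;> rw [hx] at key <;> simp [← key])
  let e : Fin 2 ↪ Q := ⟨![c, t], by
    intro a b hab
    fin_cases a <;> fin_cases b
    exacts [rfl, absurd hab hct, absurd hab hct.symm, rfl]⟩
  have he0 : e 0 = c := rfl
  have he1 : e 1 = t := rfl
  refine ⟨Instr.gate2 e U, rfl, fun O x ψ => ?_⟩
  have hext : ∀ (a b : Bool) (x : Q → Bool), x c = a → Function.extend e ![a, b] x =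
      Function.update x t b := by
    intro a b x hx
    refine ((eq_extend_iff e _ _ _).2 ⟨?_, fun q hq => ?_⟩).symm
    · funext k
      fin_cases k
      · change a = Function.update x t b c
        rw [Function.update_of_ne hct, hx]
      · change b = Function.update x t b t
        simp
    · rw [Function.update_of_ne]
      rintro rfl
      exact hq ⟨1, rfl⟩
  have hket : ∀ b, ((Instr.gate2 e U : Instr n m Q).matrix O).mulVec
      (ket (Function.update x t b)) = N (x c) false b • ket (Function.update x t false) +
        N (x c) true b • ket (Function.update x t true) := by
    intro b
    have hxc : Function.update x t b c = x c := Function.update_of_ne hct _ _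
    have he : Function.update x t b ∘ e = ![x c, b] := by
      funext k
      fin_cases k
      · exact hxc
      · change Function.update x t b t = b
        simp
    have hUb : ∀ a' a : Bool, U.val ![a', a] ![x c, b] = if a' = x c then N (x c) a b else 0 := by
      intro a' a
      have := congrFun (hU ![x c, b] trivial) ![a', a]
      rw [mulVec_ket] at this
      exact this
    rw [Instr.matrix, applyOn_mulVec_ket, he]
    have hsum : ∀ f : (Fin 2 → Bool) → (Q → Bool) → ℂ, ∑ l, f l =
        f ![false, false] + f ![true, false] + f ![false, true] + f ![true, true] := by
      intro f
      funext z
      rw [Finset.sum_apply, sum_bool_two]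
      rfl
    rw [hsum, hUb, hUb, hUb, hUb]
    cases hc : x c
    · rw [hc] at hxc
      simp [hext false _ _ hxc]
    · rw [hc] at hxc
      simp [hext true _ _ hxc]
  rw [pairState, Matrix.mulVec_add, Matrix.mulVec_smul, Matrix.mulVec_smul, hket, hket, pairState]
  cases hc : x c
  · simp [N]
  · simp only [N, Matrix.mulVec, dotProduct, Fintype.sum_bool, if_true]
    module

end Controlled

/-! ## Reversible evaluation of Boolean programs -/

section Compile

variable {n m : ℕ} {Q : Type} [Fintype Q] [DecidableEq Q] {V : Type}

theorem GatesOnly.cons {g : Instr n m Q} {gs : List (Instr n m Q)} (hg : g.isGate = true)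
    (h : GatesOnly gs) : GatesOnly (g :: gs) := by
  intro g' hg'
  rcases List.mem_cons.1 hg' with rfl | h'
  exacts [hg, h g' h']

theorem GatesOnly.nil : GatesOnly ([] : List (Instr n m Q)) := by simp [GatesOnly]

/-- The Hadamard gate. -/
noncomputable def hadamard : Matrix Bool Bool ℂ :=
  Matrix.of fun a b => if a && b then -((1 / √2 : ℝ) : ℂ) else ((1 / √2 : ℝ) : ℂ)

/-- The gate `Z`. -/
def pauliZ : Matrix Bool Bool ℂ :=
  Matrix.of fun a b => if a = b then (if a then -1 else 1) else 0

/-- The gate `X`. -/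
def pauliX : Matrix Bool Bool ℂ := Matrix.of fun a b => if a = b then 0 else 1

theorem inv_sqrt_two_mul_self : ((1 / √2 : ℝ) : ℂ) * ((1 / √2 : ℝ) : ℂ) = 1 / 2 := by
  rw [← Complex.ofReal_mul, div_mul_div_comm, Real.mul_self_sqrt (by norm_num)]
  norm_num

theorem isIsometry_hadamard : IsIsometry hadamard := by
  have h := inv_sqrt_two_mul_self
  intro a b
  cases a <;> cases b <;> simp only [hadamard, Matrix.of_apply, RCLike.star_def, Bool.and_self,
    Bool.and_false, Bool.false_and, Bool.false_eq_true, if_false, if_true, map_neg,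
    Complex.conj_ofReal, reduceCtorEq] <;> first | ring1 | linear_combination 2 * h

theorem isIsometry_pauliZ : IsIsometry pauliZ := by
  intro a b
  cases a <;> cases b <;> simp [pauliZ]

theorem isIsometry_pauliX : IsIsometry pauliX := by
  intro a b
  cases a <;> cases b <;> simp [pauliX]

/-- Let one control bit govern `Z` and another `H`. In the sequence `Z, H, Z, H` a single active
control leaves `Z² = 1` or `H² = 1`, while two active controls give `XZ`, which flips `|0⟩`. This
replaces a doubly controlled NOT on a fresh qubit by four two-qubit gates. -/
theorem hadamard_conj : hadamard * pauliZ * hadamard * pauliZ = pauliX * pauliZ := by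
  have h := inv_sqrt_two_mul_self
  ext a b
  cases a <;> cases b <;> simp only [hadamard, pauliZ, pauliX, Matrix.mul_apply, Matrix.of_apply,
    Fintype.sum_bool, Bool.and_self, Bool.and_false, Bool.false_and, Bool.false_eq_true, if_false,
    if_true, reduceCtorEq] <;> 
    first | ring1 | linear_combination 2 * h | linear_combination -2 * h

theorem hadamard_mul_self : hadamard * hadamard = 1 := by
  have h := inv_sqrt_two_mul_self
  ext a b
  cases a <;> cases b <;> simp only [hadamard, Matrix.mul_apply, Matrix.of_apply,
    Matrix.one_apply, Fintype.sum_bool, Bool.and_self, Bool.and_false, Bool.false_and,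
    Bool.false_eq_true, if_false, if_true, reduceCtorEq] <;>
    first | ring1 | linear_combination 2 * h

theorem pauliZ_mul_self : pauliZ * pauliZ = 1 := by
  ext a b
  cases a <;> cases b <;> simp [pauliZ, Matrix.mul_apply]

/-- Five gates compute a NAND into a fresh qubit. -/
theorem exists_nand_circuit {a b t : Q} (ha : a ≠ t) (hb : b ≠ t) :
    ∃ gs : List (Instr n m Q), GatesOnly gs ∧ gs.length = 5 ∧ ∀ O x, x t = false →
      (circuitMatrix O gs).mulVec (ket x) = ket (Function.update x t (!(x a && x b))) := by
  obtain ⟨g1, h1, k1⟩ := exists_controlled_gate (n := n) (m := m) ha isIsometry_pauliZ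
  obtain ⟨g2, h2, k2⟩ := exists_controlled_gate (n := n) (m := m) hb isIsometry_hadamard
  obtain ⟨g3, h3, k3⟩ := exists_single_gate (n := n) (m := m) t isIsometry_pauliX
  -- The first four gates write the conjunction to the target and the final `X` negates it. Each
  -- gate has only one control, so `a = b` is permitted.
  refine ⟨[g1, g2, g1, g2, g3], by simp [GatesOnly, h1, h2, h3], rfl, fun O x hx => ?_⟩
  have hXZ : pauliX.mulVec (pauliX.mulVec (pauliZ.mulVec (Pi.single false 1))) =
      Pi.single false 1 := by
    funext c; cases c <;> simp [pauliX, pauliZ, Matrix.mulVec, dotProduct]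
  have hX : pauliX.mulVec (Pi.single false 1) = Pi.single true 1 := by
    funext c; cases c <;> simp [pauliX, Matrix.mulVec, dotProduct]
  rw [ket_eq_pairState x t, hx, ← pairState_single]
  simp only [circuitMatrix_cons_mulVec, k1, k2, k3]
  simp only [circuitMatrix, Matrix.one_mulVec]
  congr 1
  cases x a <;> cases x b
  · simpa using hX
  · simp only [Bool.false_eq_true, if_false, if_true, Bool.false_and, Bool.not_false]
    rw [Matrix.mulVec_mulVec _ hadamard hadamard, hadamard_mul_self, Matrix.one_mulVec, hX]
  · simp only [Bool.false_eq_true, if_false, if_true, Bool.and_false, Bool.not_false]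
    rw [Matrix.mulVec_mulVec _ pauliZ pauliZ, pauliZ_mul_self, Matrix.one_mulVec, hX]
  · simp only [if_true, Bool.and_self, Bool.not_true]
    rw [Matrix.mulVec_mulVec _ hadamard pauliZ, Matrix.mulVec_mulVec _ (hadamard * pauliZ),
      Matrix.mulVec_mulVec _ (hadamard * pauliZ * hadamard), hadamard_conj,
      ← Matrix.mulVec_mulVec, hXZ]

/-- The basis state after the program `fs` has been evaluated on the input qubits `inp`, with its
results written to the qubits `wk`. -/
def loadProgram (inp : V → Q) (wk : ℕ → Q) (x : Q → Bool) :
    List ((V → Bool) → Bool) → Q → Bool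
  | [] => x
  | f :: fs => Function.update (loadProgram inp wk x fs) (wk fs.length) (f (x ∘ inp))

variable {inp : V → Q} {wk : ℕ → Q}

theorem loadProgram_of_ne {x : Q → Bool} {fs : List ((V → Bool) → Bool)} {q : Q}
    (hq : ∀ i < fs.length, wk i ≠ q) : loadProgram inp wk x fs q = x q := by
  induction fs with
  | nil => rfl
  | cons f fs ih =>
    rw [loadProgram, Function.update_of_ne (hq _ (by simp)).symm]
    exact ih fun i hi => hq i (by simp; omega)

/-- A program neither reads nor writes the flag, so evaluating it commutes with changing the flag.
This is what allows uncomputation after the flag has been rotated. -/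
theorem loadProgram_update {x : Q → Bool} {fs : List ((V → Bool) → Bool)} {q : Q} (b : Bool)
    (hq : ∀ i < fs.length, wk i ≠ q) (hi : ∀ k, inp k ≠ q) :
    loadProgram inp wk (Function.update x q b) fs =
      Function.update (loadProgram inp wk x fs) q b := by
  have hc : Function.update x q b ∘ inp = x ∘ inp := by
    funext k; simp [Function.update_of_ne (hi k)]
  induction fs with
  | nil => rfl
  | cons f fs ih =>
    rw [loadProgram, loadProgram, ih fun i hi => hq i (by simp; omega), hc,
      Function.update_comm (hq _ (by simp))]

theorem Avail.exists_qubit {fs : List ((V → Bool) → Bool)} {f : (V → Bool) → Bool}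
    (hf : Avail fs f) (hw : ∀ i < fs.length, ∀ j < fs.length, wk i = wk j → i = j)
    (hi : ∀ k, ∀ i < fs.length, wk i ≠ inp k) :
    ∃ q, ((∃ k, q = inp k) ∨ ∃ i < fs.length, q = wk i) ∧
      ∀ x, loadProgram inp wk x fs q = f (x ∘ inp) := by
  rcases hf with h | ⟨k, rfl⟩
  · induction fs with
    | nil => simp at h
    | cons g fs ih =>
      rcases List.mem_cons.1 h with rfl | h
      · refine ⟨wk fs.length, Or.inr ⟨fs.length, by simp, rfl⟩, fun x => ?_⟩
        rw [loadProgram, Function.update_self]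
      · obtain ⟨q, hq, hx⟩ := ih
          (fun i hi j hj => hw i (by simp; omega) j (by simp; omega))
          (fun k i h' => hi k i (by simp; omega)) h
        refine ⟨q, ?_, fun x => ?_⟩
        · rcases hq with h | ⟨i, h1, h2⟩
          exacts [Or.inl h, Or.inr ⟨i, by simp; omega, h2⟩]
        · rw [loadProgram, Function.update_of_ne, hx]
          rcases hq with ⟨k, rfl⟩ | ⟨i, h1, rfl⟩
          · exact (hi k _ (by simp)).symm
          · intro h'
            have := hw _ (by simp; omega) _ (by simp) h'
            omega
  · refine ⟨inp k, Or.inl ⟨k, rfl⟩, fun x => ?_⟩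
    rw [loadProgram_of_ne (hi k)]
    rfl

theorem IsSLP.exists_circuit {fs : List ((V → Bool) → Bool)} (hfs : IsSLP fs)
    (hw : ∀ i < fs.length, ∀ j < fs.length, wk i = wk j → i = j)
    (hi : ∀ k, ∀ i < fs.length, wk i ≠ inp k) :
    ∃ gs : List (Instr n m Q), GatesOnly gs ∧ gs.length = 5 * fs.length ∧ ∀ O x,
      (∀ i < fs.length, x (wk i) = false) →
      (circuitMatrix O gs).mulVec (ket x) = ket (loadProgram inp wk x fs) := by
  induction hfs with
  | nil => exact ⟨[], GatesOnly.nil, rfl, fun O x _ => by simp [circuitMatrix, loadProgram]⟩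
  | @nand fs f g _ hf hg ih =>
    have hw' : ∀ i < fs.length, ∀ j < fs.length, wk i = wk j → i = j :=
      fun i hi j hj => hw i (by simp; omega) j (by simp; omega)
    have hi' : ∀ k, ∀ i < fs.length, wk i ≠ inp k := fun k i h => hi k i (by simp; omega)
    obtain ⟨gs, h1, h2, h3⟩ := ih hw' hi'
    obtain ⟨a, ha, hav⟩ := hf.exists_qubit hw' hi'
    obtain ⟨b, hb, hbv⟩ := hg.exists_qubit hw' hi'
    have hne : ∀ q, ((∃ k, q = inp k) ∨ ∃ i < fs.length, q = wk i) → q ≠ wk fs.length := by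
      rintro q (⟨k, rfl⟩ | ⟨i, h, rfl⟩) h'
      · exact hi k _ (by simp) h'.symm
      · have := hw _ (by simp; omega) _ (by simp) h'
        omega
    obtain ⟨hs, k1, k2, k3⟩ := exists_nand_circuit (n := n) (m := m) (hne a ha) (hne b hb)
    refine ⟨gs ++ hs, h1.append k1, by simp [h2, k2]; ring, fun O x hx => ?_⟩
    rw [circuitMatrix_append_mulVec, h3 O x fun i h => hx i (by simp; omega), k3, hav, hbv]
    · rfl
    · rw [loadProgram_of_ne]
      · exact hx _ (by simp)
      · intro i h h'
        have := hw _ (by simp; omega) _ (by simp) h'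
        omega

/-! ## Rotations by a sum of angles -/

/-- A one-parameter group of gates, applied with the sum of the angles that are selected by
control qubits. -/
theorem exists_rotation_circuit {F : ℝ → Matrix Bool Bool ℂ} (h0 : F 0 = 1)
    (hadd : ∀ a b, F (a + b) = F a * F b) (hF : ∀ a, IsIsometry (F a)) {t : Q} (θ : ℕ → ℝ)
    (c : ℕ → Q) (T : ℕ) (hc : ∀ k < T, c k ≠ t) :
    ∃ gs : List (Instr n m Q), GatesOnly gs ∧ gs.length = T ∧ ∀ O x ψ,
      (circuitMatrix O gs).mulVec (pairState x t ψ) =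
        pairState x t ((F (∑ k ∈ Finset.range T, if x (c k) then θ k else 0)).mulVec ψ) := by
  induction T with
  | zero => exact ⟨[], GatesOnly.nil, rfl, fun O x ψ => by simp [circuitMatrix, h0]⟩
  | succ T ih =>
    obtain ⟨gs, h1, h2, h3⟩ := ih fun k hk => hc k (by omega)
    obtain ⟨g, k1, k2⟩ := exists_controlled_gate (n := n) (m := m) (hc T (by omega)) (hF (θ T))
    refine ⟨gs ++ [g], h1.append (GatesOnly.nil.cons k1), by simp [h2], fun O x ψ => ?_⟩
    rw [circuitMatrix_append_mulVec, h3, circuitMatrix_cons_mulVec, k2, Finset.sum_range_succ,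
      add_comm, hadd]
    simp only [circuitMatrix, Matrix.one_mulVec]
    congr 1
    split_ifs
    · rw [Matrix.mulVec_mulVec]
    · rw [h0, Matrix.one_mul]

/-- The rotation by the angle `a / 2`. -/
noncomputable def rotGate (a : ℝ) : Matrix Bool Bool ℂ :=
  Matrix.of fun i j => if i = j then (Real.cos (a / 2) : ℂ)
    else if i then (Real.sin (a / 2) : ℂ) else -(Real.sin (a / 2) : ℂ)

/-- The diagonal gate with phases `exp (± i a)`. -/
noncomputable def phaseGate (a : ℝ) : Matrix Bool Bool ℂ :=
  Matrix.of fun i j => if i = j then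
    (if i then (⟨Real.cos a, -Real.sin a⟩ : ℂ) else ⟨Real.cos a, Real.sin a⟩) else 0

theorem rotGate_zero : rotGate 0 = 1 := by
  ext a b; cases a <;> cases b <;> simp [rotGate]

theorem phaseGate_zero : phaseGate 0 = 1 := by
  ext a b; cases a <;> cases b <;> simp [phaseGate, Complex.ext_iff]

theorem rotGate_add (a b : ℝ) : rotGate (a + b) = rotGate a * rotGate b := by
  ext i j
  cases i <;> cases j <;> simp only [rotGate, Matrix.mul_apply, Matrix.of_apply, Fintype.sum_bool,
    add_div, Real.cos_add, Real.sin_add, Complex.ofReal_add, Complex.ofReal_mul,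
    Complex.ofReal_sub, Bool.false_eq_true, if_false, if_true, reduceCtorEq] <;> ring

theorem phaseGate_add (a b : ℝ) : phaseGate (a + b) = phaseGate a * phaseGate b := by
  ext i j
  cases i <;> cases j <;> simp [phaseGate, Matrix.mul_apply, Real.cos_add, Real.sin_add,
    Complex.ext_iff] <;> ring

theorem isIsometry_rotGate (a : ℝ) : IsIsometry (rotGate a) := by
  have h : (Real.cos (a / 2) : ℂ) ^ 2 + (Real.sin (a / 2) : ℂ) ^ 2 = 1 := by
    rw [← Complex.ofReal_pow, ← Complex.ofReal_pow, ← Complex.ofReal_add,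
      Real.cos_sq_add_sin_sq, Complex.ofReal_one]
  intro i j
  cases i <;> cases j <;> simp only [rotGate, Matrix.of_apply, RCLike.star_def,
    Bool.false_eq_true, if_false, if_true, reduceCtorEq, map_neg, Complex.conj_ofReal] <;>
    first | ring1 | linear_combination h

theorem isIsometry_phaseGate (a : ℝ) : IsIsometry (phaseGate a) := by
  have h := Real.cos_sq_add_sin_sq a
  intro i j
  cases i <;> cases j <;> simp [phaseGate, Complex.ext_iff] <;> constructor <;> nlinarith

/-- The product of gates applied for given angles. -/
noncomputable def amplitudeGate (a b : ℝ) : Matrix Bool Bool ℂ :=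
  rotGate b * phaseGate a * rotGate (-b)

/-- The phase gate is `cos a + i sin a Z`. Conjugation by the rotation turns `Z` into `cos b Z + sin
b X`, whose upper left entry is `cos b`. Every number of modulus at most one has this form: `a`
fixes the real part and `b` the imaginary part. -/
theorem amplitudeGate_apply (a b : ℝ) :
    amplitudeGate a b false false = ⟨Real.cos a, Real.sin a * Real.cos b⟩ := by
  have h1 : Real.cos b = 2 * Real.cos (b / 2) ^ 2 - 1 := by
    rw [← Real.cos_two_mul]; congr 1; ring
  have h2 := Real.cos_sq_add_sin_sq (b / 2)
  simp only [amplitudeGate, Matrix.mul_apply, Fintype.sum_bool, rotGate, phaseGate,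
    Matrix.of_apply, neg_div, Real.cos_neg, Real.sin_neg]
  rw [h1]
  generalize Real.cos (b / 2) = p at *
  generalize Real.sin (b / 2) = q at *
  apply Complex.ext
  · simp
    linear_combination Real.cos a * h2
  · simp
    linear_combination -Real.sin a * h2

/-- The value-controlled rotation of a flag qubit: compute the digits of the angles, rotate, and
uncompute. -/
theorem exists_amplitude_circuit {fs : List ((V → Bool) → Bool)} (hfs : IsSLP fs)
    {c d : (V → Bool) → ℕ → Bool} {T : ℕ}
    (hcd : ∀ k < T, Avail fs (fun v => c v k) ∧ Avail fs fun v => d v k)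
    (hw : ∀ i < fs.length, ∀ j < fs.length, wk i = wk j → i = j)
    (hi : ∀ k, ∀ i < fs.length, wk i ≠ inp k) {t : Q} (htw : ∀ i < fs.length, wk i ≠ t)
    (hti : ∀ k, inp k ≠ t) :
    ∃ gs : List (Instr n m Q), GatesOnly gs ∧ gs.length = 10 * fs.length + 3 * T ∧ ∀ O x,
      (∀ i < fs.length, x (wk i) = false) → (circuitMatrix O gs).mulVec (ket x) =
        pairState x t ((amplitudeGate (cordicSum (c (x ∘ inp)) T)
          (cordicSum (d (x ∘ inp)) T)).mulVec (Pi.single (x t) 1)) := by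
  have hq : ∀ f, Avail fs f → ∃ q, q ≠ t ∧ ∀ x, loadProgram inp wk x fs q = f (x ∘ inp) := by
    intro f hf
    obtain ⟨q, hq, h⟩ := hf.exists_qubit hw hi
    refine ⟨q, ?_, h⟩
    rcases hq with ⟨k, rfl⟩ | ⟨i, h1, rfl⟩
    exacts [hti k, htw i h1]
  have hqc : ∀ k, ∃ q, k < T → q ≠ t ∧ ∀ x, loadProgram inp wk x fs q = c (x ∘ inp) k := by
    intro k
    by_cases hk : k < T
    · obtain ⟨q, h⟩ := hq _ (hcd k hk).1
      exact ⟨q, fun _ => h⟩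
    · exact ⟨t, fun h => absurd h hk⟩
  have hqd : ∀ k, ∃ q, k < T → q ≠ t ∧ ∀ x, loadProgram inp wk x fs q = d (x ∘ inp) k := by
    intro k
    by_cases hk : k < T
    · obtain ⟨q, h⟩ := hq _ (hcd k hk).2
      exact ⟨q, fun _ => h⟩
    · exact ⟨t, fun h => absurd h hk⟩
  choose qc hqc using hqc
  choose qd hqd using hqd
  obtain ⟨g0, a0, b0, r0⟩ := hfs.exists_circuit (n := n) (m := m) hw hi
  -- The factor `rotGate (-b)` acts first, so the digits of `b` are used with negated angles here
  -- and with the original ones in `g3`.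
  obtain ⟨g1, a1, b1, r1⟩ := exists_rotation_circuit (n := n) (m := m) rotGate_zero rotGate_add
    isIsometry_rotGate (fun k => -cordicAngle k) qd T fun k hk => (hqd k hk).1
  obtain ⟨g2, a2, b2, r2⟩ := exists_rotation_circuit (n := n) (m := m) phaseGate_zero
    phaseGate_add isIsometry_phaseGate cordicAngle qc T fun k hk => (hqc k hk).1
  obtain ⟨g3, a3, b3, r3⟩ := exists_rotation_circuit (n := n) (m := m) rotGate_zero rotGate_add
    isIsometry_rotGate cordicAngle qd T fun k hk => (hqd k hk).1
  refine ⟨g0 ++ (g1 ++ (g2 ++ (g3 ++ adjCircuit g0))),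
    a0.append (a1.append (a2.append (a3.append a0.adjCircuit))),
    by simp [b0, b1, b2, b3, length_adjCircuit]; ring, fun O x hx => ?_⟩
  simp only [circuitMatrix_append_mulVec]
  rw [r0 O x hx, ket_eq_pairState _ t, r1, r2, r3, loadProgram_of_ne htw]
  have e1 : ∑ k ∈ Finset.range T, (if loadProgram inp wk x fs (qc k) then cordicAngle k else 0) =
      cordicSum (c (x ∘ inp)) T := Finset.sum_congr rfl fun k hk => by
    rw [(hqc k (Finset.mem_range.1 hk)).2]
  have e2 : ∑ k ∈ Finset.range T, (if loadProgram inp wk x fs (qd k) then cordicAngle k else 0) =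
      cordicSum (d (x ∘ inp)) T := Finset.sum_congr rfl fun k hk => by
    rw [(hqd k (Finset.mem_range.1 hk)).2]
  have e3 : ∑ k ∈ Finset.range T, (if loadProgram inp wk x fs (qd k) then -cordicAngle k else 0) =
      -cordicSum (d (x ∘ inp)) T := by
    rw [← e2, ← Finset.sum_neg_distrib]
    exact Finset.sum_congr rfl fun k _ => by split_ifs <;> simp
  rw [e1, e2, e3, Matrix.mulVec_mulVec, Matrix.mulVec_mulVec]
  rw [← amplitudeGate]
  generalize (amplitudeGate _ _).mulVec _ = ψ
  -- Instead of inverting, the program is evaluated on both flag components of the claimed final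
  -- state, whose scratch qubits are zero.
  apply circuitMatrix_adjCircuit_mulVec
  have hb : ∀ b, (circuitMatrix O g0).mulVec (ket (Function.update x t b)) =
      ket (Function.update (loadProgram inp wk x fs) t b) := by
    intro b
    rw [r0, loadProgram_update b htw hti]
    intro i h
    rw [Function.update_of_ne (htw i h)]
    exact hx i h
  rw [pairState, Matrix.mulVec_add, Matrix.mulVec_smul, Matrix.mulVec_smul, hb, hb, pairState]

end Compile

/-! ## Sparsity of the extended sparse matrix -/

section Sparsity

theorem encard_sum_le {α β : Type} (p : α ⊕ β → Prop) :
    {y | p y}.encard ≤ {a | p (Sum.inl a)}.encard + {b | p (Sum.inr b)}.encard := by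
  have h : {y | p y} = Sum.inl '' {a | p (Sum.inl a)} ∪ Sum.inr '' {b | p (Sum.inr b)} := by
    ext (a | b) <;> simp
  rw [h]
  refine (Set.encard_union_le _ _).trans ?_
  exact add_le_add (Set.encard_image_le _ _) (Set.encard_image_le _ _)

theorem encard_le_one_of_subset {α : Type} {s : Set α} (a : α) (h : ∀ x ∈ s, x = a) :
    s.encard ≤ 1 := (Set.encard_le_one_iff).2 fun x y hx hy => (h x hx).trans (h y hy).symm

/-- The number of nonzero entries in a row of the extended matrix, one level at a time. -/
theorem rowSparse_fromBlocks {ι κ σ : Type} {first : κ → σ} (hf : Function.Injective first)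
    {J : Matrix κ σ ℂ} (hJ : ∀ k z, J k z ≠ 0 → z = first k)
    {D : Matrix ι ι ℂ} {L : Matrix ι κ ℂ} {R : Matrix κ ι ℂ} {S : Matrix σ σ ℂ} {a r b : ℕ}
    (hD : RowSparse a D) (hL : RowSparse r L) (hR : RowSparse b R)
    (hS : ∀ k, {z | S (first k) z ≠ 0}.encard ≤ ((a + r : ℕ) : ℕ∞))
    (hS' : RowSparse (a + r + b + 1) S) :
    (∀ i, {y | Matrix.fromBlocks D (Matrix.fromCols L 0) (Matrix.fromRows R 0)
      (Matrix.fromBlocks 0 J J.transpose S) (Sum.inl i) y ≠ 0}.encard ≤ ((a + r : ℕ) : ℕ∞)) ∧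
    RowSparse (a + r + b + 1) (Matrix.fromBlocks D (Matrix.fromCols L 0) (Matrix.fromRows R 0)
      (Matrix.fromBlocks 0 J J.transpose S)) := by
  have h1 : ∀ i, {y | Matrix.fromBlocks D (Matrix.fromCols L 0) (Matrix.fromRows R 0)
      (Matrix.fromBlocks 0 J J.transpose S) (Sum.inl i) y ≠ 0}.encard ≤ ((a + r : ℕ) : ℕ∞) := by
    intro i
    refine (encard_sum_le _).trans ?_
    rw [Nat.cast_add]
    refine add_le_add (hD i) ((encard_sum_le _).trans ?_)
    simpa using hL i
  refine ⟨h1, ?_⟩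
  rintro (i | k | z)
  · exact (h1 i).trans (by norm_cast; omega)
  · have h : ((a + r + b + 1 : ℕ) : ℕ∞) = (b + (0 + 1) : ℕ∞) + (a + r : ℕ) := by
      push_cast; ring
    rw [h]
    refine le_trans ((encard_sum_le _).trans ?_) le_self_add
    refine add_le_add (by simpa using hR k) ((encard_sum_le _).trans (add_le_add ?_ ?_))
    · simp
    · refine encard_le_one_of_subset (first k) fun z hz => hJ k z ?_
      simpa using hz
  · refine (encard_sum_le _).trans ?_
    have h0 : {i | Matrix.fromBlocks D (Matrix.fromCols L 0) (Matrix.fromRows R 0)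
      (Matrix.fromBlocks 0 J J.transpose S) (Sum.inr (Sum.inr z)) (Sum.inl i) ≠ 0}.encard = 0 := by
      simp
    rw [h0, zero_add]
    refine (encard_sum_le _).trans ?_
    simp only [Matrix.fromBlocks_apply₂₂, Matrix.fromBlocks_apply₂₁, Matrix.transpose_apply]
    by_cases hz : ∃ k, first k = z
    · obtain ⟨k, rfl⟩ := hz
      have h : ((a + r + b + 1 : ℕ) : ℕ∞) = (1 + (a + r : ℕ)) + (b : ℕ) := by push_cast; ring
      rw [h]
      refine le_trans (add_le_add ?_ (hS k)) le_self_add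
      exact encard_le_one_of_subset k fun k' hk' => (hf (hJ k' _ hk')).symm
    · have h : {k | J k z ≠ 0} = ∅ := by
        ext k
        simp only [Set.mem_ofPred_eq, Set.mem_empty_iff_false, iff_false, not_not]
        by_contra hk
        exact hz ⟨k, (hJ k z hk).symm⟩
      rw [h, Set.encard_empty, zero_add]
      exact hS' z

/-- The block pattern is stable under transposition, with `L` and `R` exchanged, so the bound for
columns is the bound for rows. -/
theorem rowSparse_fromBlocks_transpose {ι κ σ : Type} {first : κ → σ}
    (hf : Function.Injective first) {J : Matrix κ σ ℂ} (hJ : ∀ k z, J k z ≠ 0 → z = first k)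
    {D : Matrix ι ι ℂ} {L : Matrix ι κ ℂ} {R : Matrix κ ι ℂ} {S : Matrix σ σ ℂ} {a r b : ℕ}
    (hD : RowSparse a D.transpose) (hR : RowSparse r R.transpose) (hL : RowSparse b L.transpose)
    (hS : ∀ k, {z | S.transpose (first k) z ≠ 0}.encard ≤ ((a + r : ℕ) : ℕ∞))
    (hS' : RowSparse (a + r + b + 1) S.transpose) :
    (∀ i, {y | (Matrix.fromBlocks D (Matrix.fromCols L 0) (Matrix.fromRows R 0)
      (Matrix.fromBlocks 0 J J.transpose S)).transpose (Sum.inl i) y ≠ 0}.encard ≤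
        ((a + r : ℕ) : ℕ∞)) ∧
    RowSparse (a + r + b + 1) (Matrix.fromBlocks D (Matrix.fromCols L 0) (Matrix.fromRows R 0)
      (Matrix.fromBlocks 0 J J.transpose S)).transpose := by
  have h := rowSparse_fromBlocks hf hJ hD hR hL hS hS'
  simp only [Matrix.fromBlocks_transpose, Matrix.transpose_fromCols, Matrix.transpose_fromRows,
    Matrix.transpose_zero, Matrix.transpose_transpose]
  exact h

theorem SpIndex.first_injective (d r h : ℕ) (ι : Type) :
    Function.Injective (SpIndex.first d r h ι) := by
  cases h with
  | zero => exact fun _ _ h => h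
  | succ h => exact Sum.inl_injective

theorem Cell.Near.symm {d h : ℕ} {c c' : Cell d h} (H : Cell.Near c c') : Cell.Near c' c :=
  fun t => ⟨(H t).2, (H t).1⟩

/-- In each direction a near cell is determined by a coordinate difference in `{-1, 0, 1}`, encoded
as a residue modulo `3`. -/
theorem Cell.card_near_le {d h : ℕ} (c : Cell d h) : {c' | Cell.Near c c'}.encard ≤ (3 ^ d : ℕ) := by
  have h : {c' | Cell.Near c c'}.encard ≤ (Set.univ : Set (Fin d → Fin 3)).encard := by
    refine Set.encard_le_encard_of_injOn (f := fun c' t => ⟨((c' t : ℕ) + 1 - c t) % 3,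
      Nat.mod_lt _ (by norm_num)⟩) (fun _ _ => Set.mem_univ _) ?_
    intro x hx y hy hxy
    funext t
    have := congrArg Fin.val (congrFun hxy t)
    simp only at this
    have h1 := hx t
    have h2 := hy t
    apply Fin.ext
    omega
  refine h.trans ?_
  rw [Set.encard_univ, ENat.card_eq_coe_fintype_card]
  simp

/-- A child is determined by its parent and the parities of its coordinates. -/
theorem Cell.card_parent_le {d h r : ℕ} (p : Cell d h) :
    {q : Cell d (h + 1) × Fin r | q.1.parent = p}.encard ≤ (2 ^ d * r : ℕ) := by
  have h : {q : Cell d (h + 1) × Fin r | q.1.parent = p}.encard ≤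
      (Set.univ : Set ((Fin d → Fin 2) × Fin r)).encard := by
    refine Set.encard_le_encard_of_injOn (f := fun q => (fun t => ⟨(q.1 t : ℕ) % 2,
      Nat.mod_lt _ (by norm_num)⟩, q.2)) (fun _ _ => Set.mem_univ _) ?_
    rintro ⟨x, k⟩ hx ⟨y, l⟩ hy hxy
    obtain ⟨h1, h2⟩ := Prod.ext_iff.1 hxy
    refine Prod.ext (funext fun t => Fin.ext ?_) h2
    have h3 := congrArg Fin.val (congrFun h1 t)
    have h4 := congrArg Fin.val (congrFun (hx.trans hy.symm) t)
    simp only [Cell.parent] at h3 h4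
    show (x t : ℕ) = y t
    omega
  refine h.trans ?_
  rw [Set.encard_univ, ENat.card_eq_coe_fintype_card]
  simp

theorem encard_fiber_le {α β : Type} [Finite α] {g : α → β} {b s : ℕ} {P : Set β}
    (hg : ∀ p, {a | g a = p}.encard ≤ b) (hP : P.encard ≤ s) :
    {a | g a ∈ P}.encard ≤ (s * b : ℕ) := by
  classical
  cases nonempty_fintype α
  have hfin : P.Finite := Set.finite_of_encard_le_coe hP
  have h1 : {a | g a ∈ P} = ((Finset.univ.filter fun a => g a ∈ P : Finset α) : Set α) := by
    ext; simp
  have h2 : ((Finset.univ.filter fun a => g a ∈ P).image g).card ≤ s := by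
    have : (((Finset.univ.filter fun a => g a ∈ P).image g : Finset β) : Set β).encard ≤ s := by
      refine (Set.encard_le_encard ?_).trans hP
      intro x hx
      simp only [Finset.coe_image, Finset.coe_filter, Finset.mem_univ, true_and] at hx
      obtain ⟨a, ha, rfl⟩ := hx
      exact ha
    rw [Set.encard_coe_eq_coe_finsetCard] at this
    exact_mod_cast this
  rw [h1, Set.encard_coe_eq_coe_finsetCard]
  norm_cast
  refine (Finset.card_le_mul_card_image (f := g) (Finset.univ.filter fun a => g a ∈ P) b ?_).trans ?_
  · intro p _
    have h3 := hg p
    have h4 : ((Finset.filter (fun a => g a = p) (Finset.univ.filter fun a => g a ∈ P) :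
        Finset α) : Set α).encard ≤ b := (Set.encard_le_encard (fun a ha => by simp_all)).trans h3
    rw [Set.encard_coe_eq_coe_finsetCard] at h4
    exact_mod_cast h4
  · rw [mul_comm]
    exact Nat.mul_le_mul_right b h2

theorem encard_cell_prod_le {d h r : ℕ} (p : Cell d h) {P : Cell d h × Fin r → Prop}
    (hP : ∀ q, P q → p = q.1) : {q | P q}.encard ≤ r := by
  have h : {q | P q}.encard ≤ (Set.univ : Set (Fin r)).encard := by
    refine Set.encard_le_encard_of_injOn (f := Prod.snd) (fun _ _ => Set.mem_univ _) ?_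
    intro x hx y hy hxy
    exact Prod.ext ((hP x hx).symm.trans (hP y hy)) hxy
  refine h.trans ?_
  rw [Set.encard_univ, ENat.card_eq_coe_fintype_card]
  simp

theorem couple_ne_zero {d r h : ℕ} {κ : Type} (k : κ) (z : SpIndex d r h κ)
    (hz : couple d r h κ k z ≠ 0) : z = SpIndex.first d r h κ k := by
  by_contra hne
  exact hz (if_neg hne)

/-- The induction needs the sharper bound for rows of the first block: only these rows of the
skeleton system meet the coupling `-I`, and the one entry they gain must still fit the general
bound. The general bound itself would grow by one at every level. -/
theorem extSparse_sparse {d r : ℕ} {f tol : ℝ} {b : ℕ} (hb : 2 ^ d * r ≤ b) :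
    ∀ (h : ℕ) (ι : Type) [Fintype ι] (blk : ι → Cell d h) (S : Matrix ι ι ℂ)
      (F : HBSFactors d r f tol h ι blk S), (∀ p, {i | blk i = p}.encard ≤ b) →
      ((∀ i, {y | extSparse d r f tol h ι blk S F (SpIndex.first d r h ι i) y ≠ 0}.encard ≤
        ((3 ^ d * b + r : ℕ) : ℕ∞)) ∧
        RowSparse (3 ^ d * b + r + b + 1) (extSparse d r f tol h ι blk S F)) ∧
      ((∀ i, {y | (extSparse d r f tol h ι blk S F).transpose
        (SpIndex.first d r h ι i) y ≠ 0}.encard ≤ ((3 ^ d * b + r : ℕ) : ℕ∞)) ∧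
        RowSparse (3 ^ d * b + r + b + 1) (extSparse d r f tol h ι blk S F).transpose)
  | 0, ι, _, blk, S, F => by
    intro hblk
    have h0 : ∀ s : Set ι, s.encard ≤ ((3 ^ d * b + r : ℕ) : ℕ∞) := by
      intro s
      -- At the root the grid has a single cell, so the occupancy bound limits the whole index set
      -- and the last diagonal block may be dense.
      have h1 : s.encard ≤ b := (Set.encard_le_encard (fun i _ => by
        funext t
        exact Subsingleton.elim (α := Fin 1) _ _)).trans (hblk fun _ => (0 : Fin 1))
      refine h1.trans ?_
      norm_cast
      have := Nat.le_mul_of_pos_left b (pow_pos (by norm_num : 0 < 3) d)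
      omega
    have h1 : ∀ s : Set ι, s.encard ≤ ((3 ^ d * b + r + b + 1 : ℕ) : ℕ∞) := fun s =>
      (h0 s).trans (by norm_cast; omega)
    exact ⟨⟨fun _ => h0 _, fun _ => h1 _⟩, fun _ => h0 _, fun _ => h1 _⟩
  | h + 1, ι, _, blk, S, ⟨B, F⟩ => by
    intro hblk
    obtain ⟨⟨i1, i2⟩, i3, i4⟩ := extSparse_sparse hb h (Cell d (h + 1) × Fin r)
      (fun q => q.1.parent) B.skeleton F fun p =>
        (Cell.card_parent_le p).trans (by exact_mod_cast hb)
    have hD : RowSparse (3 ^ d * b) (nearField blk S) := fun i =>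
      (Set.encard_le_encard fun j hj => by
        by_contra hne
        exact hj (if_neg hne)).trans (encard_fiber_le hblk (Cell.card_near_le (blk i)))
    have hD' : RowSparse (3 ^ d * b) (nearField blk S).transpose := fun i =>
      (Set.encard_le_encard fun j hj => by
        by_contra hne
        exact hj (if_neg fun hn => hne (Cell.Near.symm hn))).trans
          (encard_fiber_le hblk (Cell.card_near_le (blk i)))
    have hL : RowSparse r B.L := fun i => encard_cell_prod_le (blk i) fun q hq => by
      by_contra hne
      exact hq (dif_neg hne)
    have hL' : RowSparse b B.L.transpose := fun q => (Set.encard_le_encard fun i hi => by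
      by_contra hne
      exact hi (dif_neg hne)).trans (hblk q.1)
    have hR : RowSparse b B.R := fun q => (Set.encard_le_encard fun i hi => by
      by_contra hne
      exact hi (dif_neg hne)).trans (hblk q.1)
    have hR' : RowSparse r B.R.transpose := fun i => encard_cell_prod_le (blk i) fun q hq => by
      by_contra hne
      exact hq (dif_neg hne)
    have hf := SpIndex.first_injective d r h (Cell d (h + 1) × Fin r)
    refine ⟨rowSparse_fromBlocks hf couple_ne_zero hD hL hR i1 i2, ?_⟩
    exact rowSparse_fromBlocks_transpose hf couple_ne_zero hD' hR' hL' i3 i4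

/-- Skeletonization only selects entries of `S` or replaces near-field ones by zero, so no bound is
lost in the recursion. The factors `L` and `R` are bounded by `f`, and the couplings by `1 ≤ f`. -/
theorem norm_extSparse_le {d r : ℕ} {f tol c : ℝ} (hf : 1 ≤ f) (hc : f ≤ c) :
    ∀ (h : ℕ) (ι : Type) [Fintype ι] (blk : ι → Cell d h) (S : Matrix ι ι ℂ)
      (F : HBSFactors d r f tol h ι blk S), (∀ i j, ‖S i j‖ ≤ c) →
      ∀ x y, ‖extSparse d r f tol h ι blk S F x y‖ ≤ c
  | 0, ι, _, blk, S, F => fun hS => hS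
  | h + 1, ι, _, blk, S, ⟨B, F⟩ => by
    intro hS
    have h0 : ‖(0 : ℂ)‖ ≤ c := by rw [norm_zero]; linarith
    have hD : ∀ i j, ‖nearField blk S i j‖ ≤ c := fun i j => by
      unfold nearField
      split_ifs
      exacts [hS i j, h0]
    have hJ : ∀ k z, ‖couple d r h (Cell d (h + 1) × Fin r) k z‖ ≤ c := fun k z => by
      unfold couple
      split_ifs
      · rw [norm_neg, norm_one]; linarith
      · exact h0
    have ih := norm_extSparse_le hf hc h (Cell d (h + 1) × Fin r)
      (fun q => q.1.parent) B.skeleton F fun p q => by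
        have : B.skeleton p q = S (B.rowSkel p.1 p.2) (B.colSkel q.1 q.2) -
          nearField blk S (B.rowSkel p.1 p.2) (B.colSkel q.1 q.2) := rfl
        rw [this, nearField]
        split_ifs
        · rw [sub_self]; exact h0
        · rw [sub_zero]; exact hS _ _
    rintro (i | k | z) (j | l | y)
    · exact hD i j
    · show ‖B.L i l‖ ≤ c
      unfold HBSLevel.L
      split_ifs with hi
      · exact ((B.rowID l.1).2.2.1 l.2 ⟨i, hi⟩).trans hc
      · exact h0
    · exact h0
    · show ‖B.R k j‖ ≤ c
      unfold HBSLevel.R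
      split_ifs with hi
      · exact ((B.colID k.1).2.2.1 k.2 ⟨j, hi⟩).trans hc
      · exact h0
    · exact h0
    · exact hJ k y
    · exact h0
    · exact hJ l z
    · exact ih z y

/-- A level adds a `y` block and a `z` block of size `r 2^(d(h+1))` each, and the number of cells at
least halves from one level to the next because `d ≥ 1`. The factor `4` is twice the sum `1 + 1/2 +
1/4 + ⋯`. -/
theorem card_spIndex_le {d r : ℕ} (hd : 1 ≤ d) : ∀ (h : ℕ) (ι : Type) [Finite ι],
    Finite (SpIndex d r h ι) ∧ Nat.card (SpIndex d r h ι) ≤ Nat.card ι + 4 * r * 2 ^ (d * h)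
  | 0, ι, hι => ⟨hι, Nat.le_add_right _ _⟩
  | h + 1, ι, hι => by
    obtain ⟨h1, h2⟩ := card_spIndex_le (r := r) hd h (Cell d (h + 1) × Fin r)
    have h3 : Nat.card (Cell d (h + 1) × Fin r) = 2 ^ (d * (h + 1)) * r := by
      simp [Nat.card_eq_fintype_card, ← pow_mul, mul_comm]
    have h4 : 2 * 2 ^ (d * h) ≤ 2 ^ (d * (h + 1)) := by
      have h5 : 2 ≤ 2 ^ d := Nat.le_self_pow (by omega) 2
      rw [mul_add, mul_one, pow_add, mul_comm 2]
      exact Nat.mul_le_mul_left _ h5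
    refine ⟨inferInstanceAs (Finite (ι ⊕ (Cell d (h + 1) × Fin r ⊕ SpIndex d r h _))), ?_⟩
    have h5 : Nat.card (SpIndex d r (h + 1) ι) = Nat.card ι + (2 ^ (d * (h + 1)) * r +
        Nat.card (SpIndex d r h (Cell d (h + 1) × Fin r))) := by
      rw [← h3, ← Nat.card_sum, ← Nat.card_sum]
      rfl
    rw [h5]
    nlinarith [Nat.mul_le_mul_left r h4]

theorem numNonzero_le_of_rowSparse {ι : Type} [Finite ι] {M : Matrix ι ι ℂ} {s : ℕ}
    (h : RowSparse s M) : numNonzero M ≤ (Nat.card ι * s : ℕ) := by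
  cases nonempty_fintype ι
  have h1 := encard_fiber_le (α := {p : ι × ι // M p.1 p.2 ≠ 0}) (g := fun p => p.1.1) (b := s)
    (P := Set.univ) (s := Nat.card ι) (fun i => ?_) ?_
  · have h2 : numNonzero M = ENat.card {p : ι × ι // M p.1 p.2 ≠ 0} := rfl
    rw [h2, ← Set.encard_univ]
    simpa using h1
  · refine le_trans ?_ (h i)
    refine Set.encard_le_encard_of_injOn (f := fun p => p.1.2) ?_ ?_
    · rintro ⟨⟨x, y⟩, hp⟩ rfl
      exact hp
    · rintro ⟨⟨x, y⟩, hp⟩ hx ⟨⟨x', y'⟩, hp'⟩ hx' hy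
      simp only [Set.mem_ofPred_eq] at hx hx' hy
      subst hx hx' hy
      rfl
  · rw [Set.encard_univ, ENat.card_eq_coe_natCard]

theorem numNonzero_padMatrix_le {ι : Type} {n : ℕ} (e : ι ↪ Fin (2 ^ n)) (M : Matrix ι ι ℂ) :
    numNonzero (padMatrix e M) ≤ numNonzero M := by
  refine le_trans (Set.encard_le_encard (t := Prod.map e e '' {p | M p.1 p.2 ≠ 0}) ?_)
    (Set.encard_image_le _ _)
  rintro ⟨i, j⟩ hp
  by_cases h : ∃ q, Prod.map e e q = (i, j)
  · obtain ⟨q, hq⟩ := h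
    refine ⟨q, ?_, hq⟩
    simp only [Set.mem_ofPred_eq, padMatrix, ← hq,
      (e.injective.prodMap e.injective).extend_apply] at hp
    exact hp
  · simp [padMatrix, Function.extend_apply' _ _ _ h] at hp

theorem HBSRep.card_eq {d n₁ r depth N : ℕ} {f tol : ℝ} {A : Matrix (Fin N) (Fin N) ℂ}
    (H : HBSRep d n₁ r depth N f tol A) : N = 2 ^ (d * depth) * n₁ := by
  have h : Nat.card (Fin N) = Nat.card ((c : Cell d depth) × {i // H.leaf i = c}) :=
    Nat.card_congr (Equiv.sigmaFiberEquiv H.leaf).symm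
  rw [Nat.card_sigma] at h
  simp only [H.leaf_card] at h
  simpa [← pow_mul, mul_comm depth d] using h

theorem HBSRep.encard_leaf {d n₁ r depth N : ℕ} {f tol : ℝ} {A : Matrix (Fin N) (Fin N) ℂ}
    (H : HBSRep d n₁ r depth N f tol A) (p : Cell d depth) : {i | H.leaf i = p}.encard = n₁ := by
  refine (ENat.card_eq_coe_natCard {i // H.leaf i = p}).trans ?_
  exact congrArg Nat.cast (H.leaf_card p)

theorem HBSRep.norm_Asp_le {d n₁ r depth N : ℕ} {f tol c : ℝ} {A : Matrix (Fin N) (Fin N) ℂ}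
    (H : HBSRep d n₁ r depth N f tol A) (hf : 1 ≤ f) (hc : f ≤ c) (hA : ∀ i j, ‖A i j‖ ≤ c) :
    ∀ i j, ‖H.Asp i j‖ ≤ c :=
  norm_extSparse_le hf hc depth (Fin N) H.leaf A H.factors hA

theorem exists_sparsity_bound (d n₁ r : ℕ) (hd : 1 ≤ d) (hn : 1 ≤ n₁) : ∃ K : ℕ,
    ∀ (depth N : ℕ) (f tol : ℝ) (A : Matrix (Fin N) (Fin N) ℂ)
      (H : HBSRep d n₁ r depth N f tol A),
      ENat.card (SpIndex d r depth (Fin N)) ≤ ((K * N : ℕ) : ℕ∞) ∧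
      RowSparse K H.Asp ∧ ColSparse K H.Asp ∧
      numNonzero H.Asp ≤ ((K * N : ℕ) : ℕ∞) ∧
      (∀ (n : ℕ) (e : SpIndex d r depth (Fin N) ↪ Fin (2 ^ n)),
        numNonzero (padMatrix e H.Asp) ≤ ((K * N : ℕ) : ℕ∞)) ∧
      ∀ c : ℝ, 1 ≤ f → f ≤ c → (∀ i j, ‖A i j‖ ≤ c) → ∀ i j, ‖H.Asp i j‖ ≤ c := by
  -- A finest cell holds `n₁` indices; any coarser cell holds the `r` skeleton indices of each of
  -- its `2^d` children. The extra factor `4 * r + 1` in `K` bounds the dimension per index of `A`.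
  set b := max n₁ (2 ^ d * r) with hb
  set s := 3 ^ d * b + r + b + 1 with hs
  refine ⟨(4 * r + 1) * s, fun depth N f tol A H => ?_⟩
  obtain ⟨⟨-, h1⟩, -, h2⟩ := extSparse_sparse (f := f) (tol := tol) (le_max_right n₁ (2 ^ d * r))
    depth (Fin N) H.leaf A H.factors fun p => by
      rw [H.encard_leaf]
      exact_mod_cast le_max_left _ _
  obtain ⟨hfin, h3⟩ := card_spIndex_le (r := r) hd depth (Fin N)
  have h4 : Nat.card (SpIndex d r depth (Fin N)) ≤ (4 * r + 1) * N := by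
    have h5 := H.card_eq
    have h6 : 2 ^ (d * depth) ≤ N := by
      rw [h5]; exact Nat.le_mul_of_pos_right _ hn
    rw [Nat.card_eq_fintype_card (α := Fin N), Fintype.card_fin] at h3
    nlinarith [Nat.mul_le_mul_left (4 * r) h6]
  have h7 : numNonzero H.Asp ≤ (((4 * r + 1) * s * N : ℕ) : ℕ∞) := by
    refine (numNonzero_le_of_rowSparse h1).trans ?_
    norm_cast
    rw [mul_right_comm]
    exact Nat.mul_le_mul_right _ h4
  have h8 : s ≤ (4 * r + 1) * s := Nat.le_mul_of_pos_left _ (by omega)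
  refine ⟨?_, fun i => (h1 i).trans (by exact_mod_cast h8),
    fun i => (h2 i).trans (by exact_mod_cast h8), h7,
    fun n e => (numNonzero_padMatrix_le e _).trans h7,
    fun c hf hc hA => H.norm_Asp_le hf hc hA⟩
  rw [ENat.card_eq_coe_natCard]
  norm_cast
  refine h4.trans ?_
  rw [mul_right_comm]
  exact Nat.le_mul_of_pos_right _ (by omega)

end Sparsity

/-! ## Norms of sparse matrices -/

section SparseNorm

/-! ### The Schur-type bound and its behaviour under padding -/

theorem RowSparse.card_filter_le {ι κ : Type} [Fintype κ] {s : ℕ} {M : Matrix ι κ ℂ}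
    (h : RowSparse s M) (i : ι) [DecidablePred fun j => M i j ≠ 0] :
    (Finset.univ.filter fun j => M i j ≠ 0).card ≤ s := by
  have h1 := h i
  rw [show {j | M i j ≠ 0} = ((Finset.univ.filter fun j => M i j ≠ 0 : Finset κ) : Set κ) by
    ext; simp, Set.encard_coe_eq_coe_finsetCard] at h1
  exact_mod_cast h1

-- Cauchy–Schwarz on the support of a row costs a factor `sr`; after summing over the rows, each `‖x
-- j‖²` occurs at most `sc` times.
open scoped Matrix.Norms.L2Operator in
theorem specNorm_le_of_sparse {ι : Type} [Fintype ι] [DecidableEq ι] {M : Matrix ι ι ℂ}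
    {sr sc : ℕ} {c : ℝ} (hc : 0 ≤ c) (hr : RowSparse sr M) (hs : ColSparse sc M)
    (hM : ∀ i j, ‖M i j‖ ≤ c) : specNorm M ≤ c * √(sr * sc) := by
  classical
  rw [specNorm, ← Matrix.l2_opNorm_toEuclideanCLM]
  refine ContinuousLinearMap.opNorm_le_bound _ (by positivity) fun x => ?_
  refine le_of_sq_le_sq ?_ (by positivity)
  rw [mul_pow, mul_pow, Real.sq_sqrt (by positivity), EuclideanSpace.norm_sq_eq,
    EuclideanSpace.norm_sq_eq]
  have hrow : ∀ i, ‖(M.mulVec x.ofLp) i‖ ^ 2 ≤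
      c ^ 2 * sr * ∑ j ∈ Finset.univ.filter (fun j => M i j ≠ 0), ‖x j‖ ^ 2 := by
    intro i
    have h1 : ‖(M.mulVec x.ofLp) i‖ ≤
        c * ∑ j ∈ Finset.univ.filter (fun j => M i j ≠ 0), ‖x j‖ := by
      rw [Matrix.mulVec, dotProduct, Finset.mul_sum]
      refine (norm_sum_le _ _).trans ?_
      rw [Finset.sum_filter]
      refine Finset.sum_le_sum fun j _ => ?_
      split_ifs with hj
      · rw [norm_mul]
        exact mul_le_mul_of_nonneg_right (hM i j) (norm_nonneg _)
      · rw [not_not.1 hj, zero_mul, norm_zero]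
    have h2 := sq_sum_le_card_mul_sum_sq (s := Finset.univ.filter fun j => M i j ≠ 0)
      (f := fun j => ‖x j‖)
    have h3 : ((Finset.univ.filter fun j => M i j ≠ 0).card : ℝ) ≤ sr := by
      exact_mod_cast hr.card_filter_le i
    calc _ ≤ (c * ∑ j ∈ Finset.univ.filter (fun j => M i j ≠ 0), ‖x j‖) ^ 2 :=
          pow_le_pow_left₀ (norm_nonneg _) h1 2
      _ = c ^ 2 * (∑ j ∈ Finset.univ.filter (fun j => M i j ≠ 0), ‖x j‖) ^ 2 := by ring
      _ ≤ c ^ 2 * (sr * ∑ j ∈ Finset.univ.filter (fun j => M i j ≠ 0), ‖x j‖ ^ 2) := by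
          refine mul_le_mul_of_nonneg_left (h2.trans ?_) (sq_nonneg c)
          exact mul_le_mul_of_nonneg_right h3 (Finset.sum_nonneg fun _ _ => sq_nonneg _)
      _ = _ := by ring
  refine (Finset.sum_le_sum fun i _ => hrow i).trans ?_
  rw [← Finset.mul_sum, mul_assoc, mul_assoc, mul_assoc]
  refine mul_le_mul_of_nonneg_left (mul_le_mul_of_nonneg_left ?_ (by positivity)) (by positivity)
  simp only [Finset.sum_filter]
  rw [Finset.sum_comm, Finset.mul_sum]
  refine Finset.sum_le_sum fun j _ => ?_
  rw [← Finset.sum_filter, Finset.sum_const, nsmul_eq_mul]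
  refine mul_le_mul_of_nonneg_right ?_ (sq_nonneg _)
  exact_mod_cast RowSparse.card_filter_le (M := M.transpose) hs j

theorem padMatrix_apply_apply {ι : Type} {n : ℕ} (e : ι ↪ Fin (2 ^ n)) (M : Matrix ι ι ℂ)
    (x y : ι) : padMatrix e M (e x) (e y) = M x y :=
  (e.injective.prodMap e.injective).extend_apply (fun p => M p.1 p.2) 0 (x, y)

theorem exists_of_padMatrix_ne_zero {ι : Type} {n : ℕ} {e : ι ↪ Fin (2 ^ n)} {M : Matrix ι ι ℂ}
    {i j : Fin (2 ^ n)} (h : padMatrix e M i j ≠ 0) : ∃ x y, e x = i ∧ e y = j := by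
  by_contra hne
  refine h (Function.extend_apply' _ _ _ ?_)
  rintro ⟨⟨x, y⟩, hxy⟩
  exact hne ⟨x, y, (Prod.ext_iff.1 hxy).1, (Prod.ext_iff.1 hxy).2⟩

theorem RowSparse.padMatrix {ι : Type} {n s : ℕ} (e : ι ↪ Fin (2 ^ n)) {M : Matrix ι ι ℂ}
    (h : RowSparse s M) : RowSparse s (padMatrix e M) := by
  intro i
  by_cases hi : ∃ x, e x = i
  · obtain ⟨x, rfl⟩ := hi
    refine le_trans (Set.encard_le_encard (t := e '' {y | M x y ≠ 0}) ?_)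
      ((Set.encard_image_le _ _).trans (h x))
    intro j hj
    obtain ⟨-, y, -, rfl⟩ := exists_of_padMatrix_ne_zero hj
    exact ⟨y, by rwa [Set.mem_ofPred_eq, padMatrix_apply_apply] at hj, rfl⟩
  · rw [Set.encard_eq_zero.2]
    · exact zero_le
    · refine Set.eq_empty_iff_forall_notMem.2 fun j hj => hi ?_
      obtain ⟨x, -, hx, -⟩ := exists_of_padMatrix_ne_zero hj
      exact ⟨x, hx⟩

theorem padMatrix_transpose {ι : Type} {n : ℕ} (e : ι ↪ Fin (2 ^ n)) (M : Matrix ι ι ℂ) :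
    (padMatrix e M).transpose = padMatrix e M.transpose := by
  ext i j
  by_cases h : (∃ x, e x = i) ∧ ∃ y, e y = j
  · obtain ⟨⟨x, rfl⟩, y, rfl⟩ := h
    rw [Matrix.transpose_apply, padMatrix_apply_apply, padMatrix_apply_apply,
      Matrix.transpose_apply]
  · have h1 : padMatrix e M j i = 0 := by
      by_contra h'
      obtain ⟨x, y, hx, hy⟩ := exists_of_padMatrix_ne_zero h'
      exact h ⟨⟨y, hy⟩, x, hx⟩
    have h2 : padMatrix e M.transpose i j = 0 := by
      by_contra h'
      obtain ⟨x, y, hx, hy⟩ := exists_of_padMatrix_ne_zero h'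
      exact h ⟨⟨x, hx⟩, y, hy⟩
    rw [Matrix.transpose_apply, h1, h2]

theorem ColSparse.padMatrix {ι : Type} {n s : ℕ} (e : ι ↪ Fin (2 ^ n)) {M : Matrix ι ι ℂ}
    (h : ColSparse s M) : ColSparse s (padMatrix e M) := by
  have h1 : RowSparse s (_root_.padMatrix e M).transpose := by
    rw [padMatrix_transpose]
    exact RowSparse.padMatrix e (M := M.transpose) h
  exact h1

theorem norm_padMatrix_le {ι : Type} {n : ℕ} (e : ι ↪ Fin (2 ^ n)) {M : Matrix ι ι ℂ} {c : ℝ}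
    (hc : 0 ≤ c) (h : ∀ i j, ‖M i j‖ ≤ c) (i j : Fin (2 ^ n)) : ‖padMatrix e M i j‖ ≤ c := by
  by_cases h0 : padMatrix e M i j = 0
  · rwa [h0, norm_zero]
  · obtain ⟨x, y, rfl, rfl⟩ := exists_of_padMatrix_ne_zero h0
    rw [padMatrix_apply_apply]
    exact h x y

/-! ## The positions of the nonzero entries -/

theorem rowIndex_lt {n s k : ℕ} {A : Matrix (Fin (2 ^ n)) (Fin (2 ^ n)) ℂ} (i : Fin (2 ^ n))
    (hs : s ≤ 2 ^ n) (hk : k < s) : rowIndex A i k < 2 ^ (n + 1) := by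
  rw [rowIndex, pow_succ]
  split_ifs
  · exact lt_of_lt_of_le (Fin.is_lt _) (by omega)
  · omega

/-- The filler values `2^n + k` lie outside the range of column indices, so they never match a
genuine position. -/
theorem rowIndex_ne_zero {n k : ℕ} {A : Matrix (Fin (2 ^ n)) (Fin (2 ^ n)) ℂ}
    {i j : Fin (2 ^ n)} (h : rowIndex A i k = j) : A i j ≠ 0 := by
  classical
  rw [rowIndex] at h
  split_ifs at h with hk
  · have h1 := Finset.orderEmbOfFin_mem (Finset.univ.filter fun j => A i j ≠ 0) rfl ⟨k, hk⟩
    rw [Fin.ext h] at h1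
    simpa using h1
  · have := j.isLt
    omega

theorem existsUnique_rowIndex {n s : ℕ} {A : Matrix (Fin (2 ^ n)) (Fin (2 ^ n)) ℂ}
    (hA : RowSparse s A) {i j : Fin (2 ^ n)} (hij : A i j ≠ 0) :
    ∃! k, k ∈ Finset.range s ∧ rowIndex A i k = j := by
  classical
  have hex : ∃ k, k ∈ Finset.range s ∧ rowIndex A i k = j := by
    have h1 : j ∈ Set.range ((Finset.univ.filter fun j => A i j ≠ 0).orderEmbOfFin rfl) := by
      rw [Finset.range_orderEmbOfFin]
      simpa using hij
    obtain ⟨k, hk⟩ := h1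
    refine ⟨k, Finset.mem_range.2 (k.isLt.trans_le (hA.card_filter_le i)), ?_⟩
    exact (dif_pos k.isLt).trans (congrArg Fin.val hk)
  obtain ⟨k, hk, h⟩ := hex
  refine ⟨k, ⟨hk, h⟩, ?_⟩
  rintro k' ⟨-, h'⟩
  rw [← h] at h'
  have hj := j.isLt
  rw [rowIndex, rowIndex] at h'
  rw [rowIndex] at h
  split_ifs at h' h
  · have := (Finset.orderEmbOfFin _ _).injective (Fin.ext h')
    simpa using this
  · omega
  · omega
  · omega

end SparseNorm

/-! ## Circuits on parts of a register -/

section Registers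

variable {n m : ℕ} {K Q S W : Type} [Fintype K] [DecidableEq K] [Fintype Q] [DecidableEq Q]
  [Fintype S] [DecidableEq S] [Fintype W] [DecidableEq W]

theorem applyOn_mulVec_ket_sum {ι : Type} (e : K ↪ Q) {U : Matrix (K → Bool) (K → Bool) ℂ}
    {x : Q → Bool} {s : Finset ι} {c : ι → ℂ} {f : ι → K → Bool}
    (h : U.mulVec (ket (x ∘ e)) = ∑ i ∈ s, c i • ket (f i)) :
    (applyOn e U).mulVec (ket x) = ∑ i ∈ s, c i • ket (Function.extend e (f i) x) := by
  rw [mulVec_ket] at h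
  rw [applyOn_mulVec_ket]
  have h1 : ∀ k, U k (x ∘ e) = ∑ i ∈ s, if k = f i then c i else 0 := fun k => by
    rw [congrFun h k]
    simp [ket_apply]
  simp only [h1, Finset.sum_smul]
  rw [Finset.sum_comm]
  refine Finset.sum_congr rfl fun i _ => ?_
  simp [ite_smul]

/-- An entry after an inverse preparation is the overlap of the prepared state with `ψ`. The
amplitudes are real, so no conjugate appears. -/
theorem conjTranspose_mulVec_apply {ι : Type} {B : Matrix (Q → Bool) (Q → Bool) ℂ}
    {y : Q → Bool} {s : Finset ι} {c : ι → ℝ} {f : ι → Q → Bool}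
    (h : B.mulVec (ket y) = ∑ i ∈ s, (c i : ℂ) • ket (f i)) (ψ : (Q → Bool) → ℂ) :
    (B.conjTranspose.mulVec ψ) y = ∑ i ∈ s, (c i : ℂ) * ψ (f i) := by
  rw [mulVec_ket] at h
  have h1 : ∀ k, B k y = ∑ i ∈ s, if k = f i then (c i : ℂ) else 0 := fun k => by
    rw [congrFun h k]
    simp [ket_apply]
  simp only [Matrix.mulVec, dotProduct, Matrix.conjTranspose_apply, h1, star_sum, Finset.sum_mul]
  rw [Finset.sum_comm]
  refine Finset.sum_congr rfl fun i _ => ?_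
  rw [Finset.sum_eq_single (f i)]
  · simp
  · intro z _ hz
    simp [hz]
  · simp

theorem extend_inl_elim (x y : S → Bool) (w : W → Bool) :
    Function.extend (Function.Embedding.inl : S ↪ S ⊕ W) x (Sum.elim y w) = Sum.elim x w := by
  symm
  rw [eq_extend_iff]
  refine ⟨rfl, ?_⟩
  rintro (q | q) hq
  · exact absurd ⟨q, rfl⟩ hq
  · rfl

theorem extend_inr_elim (x : W → Bool) (y : S → Bool) (w : W → Bool) :
    Function.extend (Function.Embedding.inr : W ↪ S ⊕ W) x (Sum.elim y w) = Sum.elim y x := by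
  symm
  rw [eq_extend_iff]
  refine ⟨rfl, ?_⟩
  rintro (q | q) hq
  · rfl
  · exact absurd ⟨q, rfl⟩ hq

/-- The operator maps states with workspace `|0⟩` to states with workspace `|0⟩`. -/
def PreservesWorkspace (M : Matrix (S ⊕ W → Bool) (S ⊕ W → Bool) ℂ) : Prop :=
  ∀ (x y : S → Bool) (u : W → Bool), u ≠ (fun _ => false) →
    M (Sum.elim x u) (Sum.elim y fun _ => false) = 0

theorem sum_sumElim (F : (S ⊕ W → Bool) → ℂ) :
    ∑ z, F z = ∑ x : S → Bool, ∑ u : W → Bool, F (Sum.elim x u) := by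
  rw [← Fintype.sum_prod_type']
  exact (Equiv.sum_comp (Equiv.sumArrowEquivProdArrow S W Bool).symm F).symm

theorem PreservesWorkspace.mul {M N : Matrix (S ⊕ W → Bool) (S ⊕ W → Bool) ℂ}
    (hM : PreservesWorkspace M) (hN : PreservesWorkspace N) : PreservesWorkspace (M * N) := by
  intro x y u hu
  rw [Matrix.mul_apply, sum_sumElim]
  refine Finset.sum_eq_zero fun z _ => Finset.sum_eq_zero fun v _ => ?_
  by_cases hv : v = fun _ => false
  · rw [hv, hM x z u hu, zero_mul]
  · rw [hN z y v hv, mul_zero]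

theorem preservesWorkspace_applyOn (e : K ↪ S) (U : Matrix (K → Bool) (K → Bool) ℂ) :
    PreservesWorkspace (applyOn (e.trans (Function.Embedding.inl : S ↪ S ⊕ W)) U) := by
  intro x y u hu
  rw [applyOn, if_neg]
  intro h
  refine hu (funext fun w => h (Sum.inr w) ?_)
  rintro ⟨k, hk⟩
  cases hk

/-- If a zero workspace always returns to zero, the compression of `M` to zero workspace loses no
norm: it is a square isometry, hence unitary. -/
theorem exists_implements {w : ℕ} {M : Matrix (Q ⊕ Fin w → Bool) (Q ⊕ Fin w → Bool) ℂ}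
    (hM : M.conjTranspose * M = 1) (hp : PreservesWorkspace M) :
    ∃ U : QUnitary Q, Implements M U ∧ ∀ x y,
      U.val x y = M (Sum.elim x fun _ => false) (Sum.elim y fun _ => false) := by
  set V : Matrix (Q → Bool) (Q → Bool) ℂ := Matrix.of fun x y =>
    M (Sum.elim x fun _ => false) (Sum.elim y fun _ => false) with hV
  have hu : star V * V = 1 := by
    ext x y
    have h1 := congrFun (congrFun hM (Sum.elim x fun _ => false)) (Sum.elim y fun _ => false)
    rw [Matrix.mul_apply, sum_sumElim] at h1
    rw [Matrix.mul_apply]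
    have h2 : (1 : Matrix (Q ⊕ Fin w → Bool) (Q ⊕ Fin w → Bool) ℂ)
        (Sum.elim x fun _ => false) (Sum.elim y fun _ => false) =
        (1 : Matrix (Q → Bool) (Q → Bool) ℂ) x y := by
      simp only [Matrix.one_apply]
      congr 1
      refine propext ⟨fun h => funext fun q => congrFun h (Sum.inl q), fun h => by rw [h]⟩
    rw [← h2, ← h1]
    refine Finset.sum_congr rfl fun z _ => ?_
    rw [Finset.sum_eq_single fun _ => false]
    · rfl
    · intro u _ hu
      rw [hp z y u hu, mul_zero]
    · simp
  refine ⟨⟨V, Matrix.mem_unitaryGroup_iff'.2 hu⟩, fun x y u => ?_, fun x y => rfl⟩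
  split_ifs with h
  · rw [h]; rfl
  · exact hp x y u h

theorem pairState_apply_of_eq_false {x y : Q → Bool} {t : Q} {ψ : Bool → ℂ} (hx : x t = false)
    (hy : y t = false) : pairState x t ψ y = if y = x then ψ false else 0 := by
  have h1 : Function.update x t false = x := by rw [← hx, Function.update_eq_self]
  have h2 : y ≠ Function.update x t true := fun h => by
    rw [h, Function.update_self] at hy
    exact Bool.noConfusion hy
  simp [pairState, ket_apply, h1, h2]

end Registers

/-! ## Preparation of the states of the sparse-access oracles -/

section Preparation

variable {n m : ℕ}

theorem exists_swap_unitary :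
    ∃ U : QUnitary (Fin 2), ∀ x, U.val.mulVec (ket x) = ket (x ∘ Equiv.swap 0 1) := by
  obtain ⟨U, hU⟩ := exists_unitary (K := Fin 2) Set.univ
    (fun x => ket (x ∘ Equiv.swap 0 1)) fun x _ y _ => by
      have h : (x ∘ Equiv.swap 0 1 = y ∘ Equiv.swap (0 : Fin 2) 1) ↔ x = y :=
        (Equiv.surjective _).injective_comp_right.eq_iff
      simp [ket_apply, ← h, eq_comm]
  exact ⟨U, fun x => hU x (Set.mem_univ x)⟩

/-- The first `k` qubits of two registers exchanged. -/
def swapBelow (k : ℕ) (x : IndexQubits n → Bool) : IndexQubits n → Bool :=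
  Sum.elim (fun t => if (t : ℕ) < k then x (Sum.inr t) else x (Sum.inl t))
    fun t => if (t : ℕ) < k then x (Sum.inl t) else x (Sum.inr t)

theorem exists_swap_circuit : ∃ gs : List (Instr n m (IndexQubits n)), GatesOnly gs ∧
    gs.length = n + 1 ∧ ∀ O x y, (circuitMatrix O gs).mulVec (ket (Sum.elim x y)) =
      ket (Sum.elim y x) := by
  obtain ⟨U, hU⟩ := exists_swap_unitary
  have key : ∀ k ≤ n + 1, ∃ gs : List (Instr n m (IndexQubits n)), GatesOnly gs ∧
      gs.length = k ∧ ∀ O x, (circuitMatrix O gs).mulVec (ket x) = ket (swapBelow k x) := by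
    intro k
    induction k with
    | zero =>
      refine fun _ => ⟨[], GatesOnly.nil, rfl, fun O x => ?_⟩
      have : swapBelow 0 x = x := by funext q; rcases q with q | q <;> simp [swapBelow]
      simp [circuitMatrix, this]
    | succ k ih =>
      intro hk
      obtain ⟨gs, h1, h2, h3⟩ := ih (by omega)
      have hinj : Function.Injective
          (![Sum.inl ⟨k, hk⟩, Sum.inr ⟨k, hk⟩] : Fin 2 → IndexQubits n) := by
        intro a b
        fin_cases a <;> fin_cases b <;> simp
      refine ⟨gs ++ [Instr.gate2 ⟨_, hinj⟩ U], h1.append (GatesOnly.nil.cons rfl), by simp [h2],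
        fun O x => ?_⟩
      rw [circuitMatrix_append_mulVec, h3, circuitMatrix_cons_mulVec]
      simp only [circuitMatrix, Matrix.one_mulVec, Instr.matrix]
      rw [applyOn_mulVec_ket_of _ (hU _)]
      congr 1
      symm
      rw [eq_extend_iff]
      constructor
      · funext a
        fin_cases a <;> simp [swapBelow]
      · rintro (q | q) hq
        · have : (q : ℕ) ≠ k := fun h => hq ⟨0, by simp [← h]⟩
          simp only [swapBelow, Sum.elim_inl]
          congr 1
          exact propext (by omega)
        · have : (q : ℕ) ≠ k := fun h => hq ⟨1, by simp [← h]⟩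
          simp only [swapBelow, Sum.elim_inr]
          congr 1
          exact propext (by omega)
  obtain ⟨gs, h1, h2, h3⟩ := key (n + 1) le_rfl
  refine ⟨gs, h1, h2, fun O x y => ?_⟩
  rw [h3]
  congr 1
  funext q
  rcases q with q | q <;> exact if_pos q.isLt

theorem exists_column_circuit {sc : ℕ} (h1 : 1 ≤ sc) (h2 : sc ≤ 2 ^ n) :
    ∃ gs : List (Instr n m (IndexQubits n)), gs.countP Instr.isGate = n + 1 ∧
      gs.countP Instr.isQueryR = 0 ∧ gs.countP Instr.isQueryC = 1 ∧
      gs.countP Instr.isQueryA = 0 ∧ ∀ (O : Oracles n m)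
      (A : Matrix (Fin (2 ^ n)) (Fin (2 ^ n)) ℂ), IsColOracle sc A O.Oc → ∀ j : Fin (2 ^ n),
        (circuitMatrix O gs).mulVec (ket (Sum.elim (fun _ => false) (bits (n + 1) j))) =
          ∑ l ∈ Finset.range sc, ((1 / √sc : ℝ) : ℂ) •
            ket (Sum.elim (bits (n + 1) (colIndex A l j)) (bits (n + 1) j)) := by
  obtain ⟨gs, k1, k2, k3⟩ := exists_uniform_prep (n := n) (m := m) h1 h2
  obtain ⟨c1, c2, c3, c4⟩ :=
    (k1.mapQubits (Function.Embedding.inl : _ ↪ IndexQubits n)).countP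
  refine ⟨gs.map (Instr.mapQubits Function.Embedding.inl) ++
    [Instr.queryC false (Function.Embedding.refl _)], ?_, ?_, ?_, ?_, fun O A hO j => ?_⟩
  · rw [List.countP_append, c1, List.length_map, k2]; rfl
  · rw [List.countP_append, c2]; rfl
  · rw [List.countP_append, c3]; rfl
  · rw [List.countP_append, c4]; rfl
  rw [circuitMatrix_append_mulVec, circuitMatrix_mapQubits,
    applyOn_mulVec_ket_sum (x := Sum.elim (fun _ => false) (bits (n + 1) j))
      Function.Embedding.inl (k3 O), mulVec_finsetSum]
  refine Finset.sum_congr rfl fun l hl => ?_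
  rw [extend_inl_elim, circuitMatrix_cons_mulVec]
  simp only [circuitMatrix, Matrix.one_mulVec, Instr.matrix, Bool.false_eq_true, if_false]
  rw [applyOn_mulVec_ket_of _ (k := Sum.elim (bits (n + 1) (colIndex A l j)) (bits (n + 1) j))]
  · congr 2
    symm
    rw [eq_extend_iff]
    exact ⟨rfl, fun q hq => absurd ⟨q, rfl⟩ hq⟩
  · exact hO j l (Finset.mem_range.1 hl)

/-- The system index enters in the second register, but the row oracle expects it in the first,
whence the exchange. Afterwards the row state and the column state both hold a row index on the left
and a column index on the right and can be compared. -/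
theorem exists_row_circuit {sr : ℕ} (h1 : 1 ≤ sr) (h2 : sr ≤ 2 ^ n) :
    ∃ gs : List (Instr n m (IndexQubits n)), gs.countP Instr.isGate = 2 * (n + 1) ∧
      gs.countP Instr.isQueryR = 1 ∧ gs.countP Instr.isQueryC = 0 ∧
      gs.countP Instr.isQueryA = 0 ∧ ∀ (O : Oracles n m)
      (A : Matrix (Fin (2 ^ n)) (Fin (2 ^ n)) ℂ), IsRowOracle sr A O.Or → ∀ i : Fin (2 ^ n),
        (circuitMatrix O gs).mulVec (ket (Sum.elim (fun _ => false) (bits (n + 1) i))) =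
          ∑ k ∈ Finset.range sr, ((1 / √sr : ℝ) : ℂ) •
            ket (Sum.elim (bits (n + 1) i) (bits (n + 1) (rowIndex A i k))) := by
  obtain ⟨gs, k1, k2, k3⟩ := exists_uniform_prep (n := n) (m := m) h1 h2
  obtain ⟨sw, s1, s2, s3⟩ := exists_swap_circuit (n := n) (m := m)
  obtain ⟨c1, c2, c3, c4⟩ :=
    (s1.append (k1.mapQubits (Function.Embedding.inr : _ ↪ IndexQubits n))).countP
  refine ⟨(sw ++ gs.map (Instr.mapQubits Function.Embedding.inr)) ++
    [Instr.queryR false (Function.Embedding.refl _)], ?_, ?_, ?_, ?_, fun O A hO i => ?_⟩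
  · rw [List.countP_append, c1, List.length_append, List.length_map, s2, k2, two_mul]; rfl
  · rw [List.countP_append, c2]; rfl
  · rw [List.countP_append, c3]; rfl
  · rw [List.countP_append, c4]; rfl
  rw [circuitMatrix_append_mulVec, circuitMatrix_append_mulVec, s3, circuitMatrix_mapQubits,
    applyOn_mulVec_ket_sum (x := Sum.elim (bits (n + 1) i) fun _ => false)
      Function.Embedding.inr (k3 O), mulVec_finsetSum]
  refine Finset.sum_congr rfl fun l hl => ?_
  rw [extend_inr_elim, circuitMatrix_cons_mulVec]
  simp only [circuitMatrix, Matrix.one_mulVec, Instr.matrix, Bool.false_eq_true, if_false]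
  rw [applyOn_mulVec_ket_of _ (k := Sum.elim (bits (n + 1) i) (bits (n + 1) (rowIndex A i l)))]
  · congr 2
    symm
    rw [eq_extend_iff]
    exact ⟨rfl, fun q hq => absurd ⟨q, rfl⟩ hq⟩
  · exact hO i l (Finset.mem_range.1 hl)

end Preparation

/-! ## The block encoding -/

section Encoding

variable {n m : ℕ}

/-- The index registers and a flag qubit. -/
abbrev MainQubits (n : ℕ) : Type := IndexQubits n ⊕ Fin 1

/-- All qubits of the circuit: the main qubits, a value register and `s` scratch qubits. -/
abbrev WorkQubits (n m s : ℕ) : Type := MainQubits n ⊕ (ValueQubits m ⊕ Fin s)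

/-- The qubits of the entry oracle. -/
def entryQubits (n m s : ℕ) : EntryQubits n m ↪ WorkQubits n m s where
  toFun := Sum.elim (Sum.elim (fun t => Sum.inl (Sum.inl (Sum.inl t.castSucc)))
    fun t => Sum.inl (Sum.inl (Sum.inr t.castSucc))) fun t => Sum.inr (Sum.inl t)
  inj' := by
    rintro ((a | a) | a) ((b | b) | b) h <;> simp at h ⊢ <;> exact h

/-- The circuit that rotates the flag by the entry of the matrix whose position is held by the
index registers. -/
theorem exists_entry_circuit {fs : List ((ValueQubits m → Bool) → Bool)} (hfs : IsSLP fs)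
    {c d : (ValueQubits m → Bool) → ℕ → Bool} {T : ℕ}
    (hcd : ∀ k < T, Avail fs (fun v => c v k) ∧ Avail fs fun v => d v k) :
    ∃ gs : List (Instr n m (WorkQubits n m fs.length)),
      gs.countP Instr.isGate = 10 * fs.length + 3 * T ∧ gs.countP Instr.isQueryR = 0 ∧
      gs.countP Instr.isQueryC = 0 ∧ gs.countP Instr.isQueryA = 2 ∧
      ∀ (O : Oracles n m) (v : Fin (2 ^ n) → Fin (2 ^ n) → ValueQubits m → Bool),
      (∀ i j : Fin (2 ^ n),
        O.OA.val.mulVec (ket (Sum.elim (Sum.elim (bits n i) (bits n j)) fun _ => false)) =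
        ket (Sum.elim (Sum.elim (bits n i) (bits n j)) (v i j))) →
      ∀ (y : MainQubits n → Bool) (i j : Fin (2 ^ n)),
        (∀ t : Fin n, y (Sum.inl (Sum.inl t.castSucc)) = bits n i t) →
        (∀ t : Fin n, y (Sum.inl (Sum.inr t.castSucc)) = bits n j t) →
        (circuitMatrix O gs).mulVec (ket (Sum.elim y fun _ => false)) =
          pairState (Sum.elim y fun _ => false) (Sum.inl (Sum.inr 0))
            ((amplitudeGate (cordicSum (c (v i j)) T) (cordicSum (d (v i j)) T)).mulVec
              (Pi.single (y (Sum.inr 0)) 1)) := by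
  set t : WorkQubits n m fs.length := Sum.inl (Sum.inr 0) with ht
  let wk : ℕ → WorkQubits n m fs.length := fun i =>
    if h : i < fs.length then Sum.inr (Sum.inr ⟨i, h⟩) else t
  have hwk : ∀ i (h : i < fs.length), wk i = Sum.inr (Sum.inr ⟨i, h⟩) := fun i h => dif_pos h
  obtain ⟨V, hV, hlen, hVx⟩ := exists_amplitude_circuit (n := n) (m := m)
    (inp := fun q => (Sum.inr (Sum.inl q) : WorkQubits n m fs.length)) (wk := wk) (t := t)
    hfs hcd
    (fun i hi j hj h => by
      rw [hwk i hi, hwk j hj] at h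
      simpa using h)
    (fun k i hi h => by
      rw [hwk i hi] at h
      simp at h)
    (fun i hi h => by
      rw [hwk i hi] at h
      simp [ht] at h)
    (fun k h => by simp [ht] at h)
  obtain ⟨c1, c2, c3, c4⟩ := hV.countP
  refine ⟨[Instr.queryA false (entryQubits n m fs.length)] ++ (V ++
    adjCircuit [Instr.queryA false (entryQubits n m fs.length)]), ?_, ?_, ?_, ?_,
    fun O v hO y i j hi hj => ?_⟩
  · rw [List.countP_append, List.countP_append, c1, (countP_adjCircuit _).1, hlen]
    simp [Instr.isGate]
  · rw [List.countP_append, List.countP_append, c2, (countP_adjCircuit _).2.1]; rfl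
  · rw [List.countP_append, List.countP_append, c3, (countP_adjCircuit _).2.2.1]; rfl
  · rw [List.countP_append, List.countP_append, c4, (countP_adjCircuit _).2.2.2]; rfl
  have hq : ∀ y : MainQubits n → Bool,
      (∀ t : Fin n, y (Sum.inl (Sum.inl t.castSucc)) = bits n i t) →
      (∀ t : Fin n, y (Sum.inl (Sum.inr t.castSucc)) = bits n j t) →
      (circuitMatrix O [Instr.queryA false (entryQubits n m fs.length)]).mulVec
        (ket (Sum.elim y fun _ => false)) =
      ket (Sum.elim y (Sum.elim (v i j) fun _ => false)) := by
    intro y hi hj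
    rw [circuitMatrix_cons_mulVec]
    simp only [circuitMatrix, Matrix.one_mulVec, Instr.matrix, Bool.false_eq_true, if_false]
    have hx : (Sum.elim y fun _ => false : WorkQubits n m fs.length → Bool) ∘
        entryQubits n m fs.length = Sum.elim (Sum.elim (bits n i) (bits n j)) fun _ => false := by
      funext q
      rcases q with (q | q) | q
      exacts [hi q, hj q, rfl]
    rw [applyOn_mulVec_ket_of _ (k := Sum.elim (Sum.elim (bits n i) (bits n j)) (v i j))]
    · congr 1
      symm
      rw [eq_extend_iff]
      constructor
      · funext q
        rcases q with (q | q) | q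
        exacts [(hi q).symm, (hj q).symm, rfl]
      · rintro (q | q | q) h
        · rfl
        · exact absurd ⟨Sum.inr q, rfl⟩ h
        · rfl
    · rw [hx]
      exact hO i j
  rw [circuitMatrix_append_mulVec, circuitMatrix_append_mulVec, hq y hi hj, hVx]
  -- The flag is not among the queried qubits, so the second query erases the value on both
  -- components of the rotated state.
  · apply circuitMatrix_adjCircuit_mulVec
    have hu : ∀ b (w : ValueQubits m ⊕ Fin fs.length → Bool), Function.update (Sum.elim y w) t b =
        Sum.elim (Function.update y (Sum.inr 0) b) w := fun b w => Sum.update_elim_inl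
    have hb : ∀ b, (circuitMatrix O [Instr.queryA false (entryQubits n m fs.length)]).mulVec
        (ket (Function.update (Sum.elim y fun _ => false) t b)) =
        ket (Function.update (Sum.elim y (Sum.elim (v i j) fun _ => false)) t b) := by
      intro b
      rw [hu, hu, hq]
      · intro q
        rw [Function.update_of_ne (by simp), hi]
      · intro q
        rw [Function.update_of_ne (by simp), hj]
    rw [pairState, Matrix.mulVec_add, Matrix.mulVec_smul, Matrix.mulVec_smul, hb, hb, pairState]
    rfl
  · intro i hi
    rw [hwk i hi]
    rfl

/-- A nonzero entry occurs exactly once in the list of its row and once in the list of its column; a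
zero entry occurs in neither. -/
theorem sum_sum_ite_rowIndex {sr sc : ℕ} {A : Matrix (Fin (2 ^ n)) (Fin (2 ^ n)) ℂ}
    (hr : RowSparse sr A) (hc : ColSparse sc A) (i j : Fin (2 ^ n)) (a : ℂ) :
    ∑ k ∈ Finset.range sr, ∑ l ∈ Finset.range sc,
      (if rowIndex A i k = j ∧ colIndex A l j = i then a else 0) = if A i j = 0 then 0 else a := by
  split_ifs with h
  · refine Finset.sum_eq_zero fun k _ => Finset.sum_eq_zero fun l _ => if_neg ?_
    rintro ⟨h1, -⟩
    exact rowIndex_ne_zero h1 h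
  · obtain ⟨k, ⟨hk, h1⟩, h2⟩ := existsUnique_rowIndex hr h
    obtain ⟨l, ⟨hl, h3⟩, h4⟩ := existsUnique_rowIndex (A := A.transpose) hc h
    rw [Finset.sum_eq_single_of_mem k hk, Finset.sum_eq_single_of_mem l hl]
    · exact if_pos ⟨h1, h3⟩
    · exact fun l' hl' hne => if_neg fun h' => hne (h4 l' ⟨hl', h'.2⟩)
    · exact fun k' hk' hne => Finset.sum_eq_zero fun l' _ =>
        if_neg fun h' => hne (h2 k' ⟨hk', h'.1⟩)

theorem bits_eq_of_lt {k : ℕ} (t : Fin n) : bits (n + 1) k t.castSucc = bits n (k % 2 ^ n) t := by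
  simp [bits, Nat.testBit_mod_two_pow]

/-- The circuit is the column preparation, the flag rotation and the inverse row preparation. Its
relevant entries are overlaps of two uniform superpositions, weighted by the flag amplitude. The
inverse preparation explains the single, inverted query to the row oracle. -/
theorem exists_encoding_circuit {sr sc : ℕ} (hr1 : 1 ≤ sr) (hr2 : sr ≤ 2 ^ n) (hc1 : 1 ≤ sc)
    (hc2 : sc ≤ 2 ^ n) {fs : List ((ValueQubits m → Bool) → Bool)} (hfs : IsSLP fs)
    {c d : (ValueQubits m → Bool) → ℕ → Bool} {T : ℕ}
    (hcd : ∀ k < T, Avail fs (fun v => c v k) ∧ Avail fs fun v => d v k) :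
    ∃ gs : List (Instr n m (WorkQubits n m fs.length)),
      gs.countP Instr.isGate = 3 * (n + 1) + (10 * fs.length + 3 * T) ∧
      gs.countP Instr.isQueryR = 1 ∧ gs.countP Instr.isQueryC = 1 ∧
      gs.countP Instr.isQueryA = 2 ∧
      ∀ (O : Oracles n m) (A : Matrix (Fin (2 ^ n)) (Fin (2 ^ n)) ℂ)
        (v : Fin (2 ^ n) → Fin (2 ^ n) → ValueQubits m → Bool),
      RowSparse sr A → ColSparse sc A → IsRowOracle sr A O.Or → IsColOracle sc A O.Oc →
      (∀ i j : Fin (2 ^ n),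
        O.OA.val.mulVec (ket (Sum.elim (Sum.elim (bits n i) (bits n j)) fun _ => false)) =
        ket (Sum.elim (Sum.elim (bits n i) (bits n j)) (v i j))) →
      PreservesWorkspace (circuitMatrix O gs) ∧ ∀ i j : Fin (2 ^ n),
        circuitMatrix O gs
          (Sum.elim (Sum.elim (Sum.elim (fun _ => false) (bits (n + 1) i)) fun _ => false)
            fun _ => false)
          (Sum.elim (Sum.elim (Sum.elim (fun _ => false) (bits (n + 1) j)) fun _ => false)
            fun _ => false) =
          if A i j = 0 then 0 else ((1 / √sr : ℝ) : ℂ) * ((1 / √sc : ℝ) : ℂ) *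
            amplitudeGate (cordicSum (c (v i j)) T) (cordicSum (d (v i j)) T) false false := by
  obtain ⟨g1, a1, a2, a3, a4, a5⟩ := exists_column_circuit (m := m) hc1 hc2
  obtain ⟨g2, b1, b2, b3, b4, b5⟩ := exists_row_circuit (m := m) hr1 hr2
  obtain ⟨g3, d1, d2, d3, d4, d5⟩ := exists_entry_circuit (n := n) hfs hcd
  let e : IndexQubits n ↪ WorkQubits n m fs.length :=
    (Function.Embedding.inl : _ ↪ MainQubits n).trans Function.Embedding.inl
  have he : ∀ (x y : IndexQubits n → Bool) (z : Fin 1 → Bool) (w : ValueQubits m ⊕ Fin fs.length →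
      Bool), Function.extend e x (Sum.elim (Sum.elim y z) w) = Sum.elim (Sum.elim x z) w := by
    intro x y z w
    symm
    rw [eq_extend_iff]
    refine ⟨rfl, ?_⟩
    rintro ((q | q) | q) hq
    · exact absurd ⟨q, rfl⟩ hq
    · rfl
    · rfl
  have hm1 := countP_mapQubits e g1
  have hm2 := countP_mapQubits e g2
  have hm3 := countP_adjCircuit (g2.map (Instr.mapQubits e))
  refine ⟨g1.map (Instr.mapQubits e) ++ (g3 ++ adjCircuit (g2.map (Instr.mapQubits e))),
    ?_, ?_, ?_, ?_, fun O A v hr hc hOr hOc hOA => ⟨?_, fun i j => ?_⟩⟩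
  · rw [List.countP_append, List.countP_append, hm1.1, hm3.1, hm2.1, a1, b1, d1]; ring
  · rw [List.countP_append, List.countP_append, hm1.2.1, hm3.2.1, hm2.2.1, a2, b2, d2]
  · rw [List.countP_append, List.countP_append, hm1.2.2.1, hm3.2.2.1, hm2.2.2.1, a3, b3, d3]
  · rw [List.countP_append, List.countP_append, hm1.2.2.2, hm3.2.2.2, hm2.2.2.2, a4, b4, d4]
  · rw [circuitMatrix_append, circuitMatrix_append, circuitMatrix_adjCircuit,
      circuitMatrix_mapQubits, circuitMatrix_mapQubits, ← applyOn_conjTranspose]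
    refine ((preservesWorkspace_applyOn _ _).mul ?_).mul (preservesWorkspace_applyOn _ _)
    intro x y u hu
    have hlt : ∀ f : Fin n → Bool, Nat.ofBits f < 2 ^ n := fun f => Nat.ofBits_lt_two_pow f
    -- The low `n` bits of the two registers always name some pair of indices, so the entry circuit
    -- is controlled on every basis state with zero workspace, including the fillers.
    have h := d5 O v hOA y
      ⟨_, hlt fun t => y (Sum.inl (Sum.inl t.castSucc))⟩
      ⟨_, hlt fun t => y (Sum.inl (Sum.inr t.castSucc))⟩
      (fun t => (congrFun (bits_ofBits fun t => y (Sum.inl (Sum.inl t.castSucc))) t).symm)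
      fun t => (congrFun (bits_ofBits fun t => y (Sum.inl (Sum.inr t.castSucc))) t).symm
    rw [mulVec_ket] at h
    rw [congrFun h]
    have hne : ∀ b, Sum.elim x u ≠ Function.update (Sum.elim y fun _ => false)
        (Sum.inl (Sum.inr 0)) b := by
      intro b hb
      rw [Sum.update_elim_inl] at hb
      exact hu (funext fun q => congrFun hb (Sum.inr q))
    rw [pairState, Pi.add_apply, Pi.smul_apply, Pi.smul_apply, ket_apply, ket_apply,
      if_neg (hne _), if_neg (hne _), smul_zero, smul_zero, add_zero]
  · have hent : ∀ (M : Matrix (WorkQubits n m fs.length → Bool) (WorkQubits n m fs.length → Bool) ℂ)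
        x y, M x y = M.mulVec (ket y) x := fun M x y => by rw [mulVec_ket]
    refine (hent _ _ _).trans ?_
    rw [circuitMatrix_append_mulVec, circuitMatrix_append_mulVec,
      circuitMatrix_adjCircuit, circuitMatrix_mapQubits, circuitMatrix_mapQubits,
      applyOn_mulVec_ket_sum (x := Sum.elim (Sum.elim (Sum.elim (fun _ => false)
        (bits (n + 1) j)) fun _ => false) fun _ => false) e (a5 O A hOc j),
      conjTranspose_mulVec_apply (applyOn_mulVec_ket_sum (x := Sum.elim (Sum.elim (Sum.elim
        (fun _ => false) (bits (n + 1) i)) fun _ => false) fun _ => false) e (b5 O A hOr i))]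
    simp only [he]
    rw [mulVec_finsetSum, ← sum_sum_ite_rowIndex hr hc]
    refine Finset.sum_congr rfl fun k hk => ?_
    rw [Finset.sum_apply, Finset.mul_sum]
    refine Finset.sum_congr rfl fun l hl => ?_
    -- For a filler row index the entry oracle is queried at its residue modulo `2^n`. The value
    -- found there is irrelevant, since the extra qubit makes the overlap with any row state vanish.
    rw [d5 O v hOA _ ⟨colIndex A l j % 2 ^ n, Nat.mod_lt _ (by positivity)⟩ j
      (fun t => bits_eq_of_lt t) fun t => congrFun (bits_succ_comp_castSucc n j) t,
      Pi.smul_apply, pairState_apply_of_eq_false rfl rfl]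
    have hiff : (Sum.elim (Sum.elim (Sum.elim (bits (n + 1) i) (bits (n + 1) (rowIndex A i k)))
        fun _ => false) (fun _ => false) : WorkQubits n m fs.length → Bool) =
        Sum.elim (Sum.elim (Sum.elim (bits (n + 1) (colIndex A l j)) (bits (n + 1) j))
        fun _ => false) (fun _ => false) ↔ rowIndex A i k = j ∧ colIndex A l j = i := by
      have hi : (i : ℕ) < 2 ^ (n + 1) := i.isLt.trans (Nat.pow_lt_pow_right (by norm_num) (by simp))
      have hj : (j : ℕ) < 2 ^ (n + 1) := j.isLt.trans (Nat.pow_lt_pow_right (by norm_num) (by simp))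
      constructor
      · intro h
        exact ⟨bits_injective (rowIndex_lt i hr2 (Finset.mem_range.1 hk)) hj
          (funext fun t => congrFun h (Sum.inl (Sum.inl (Sum.inr t)))),
          bits_injective (rowIndex_lt j hc2 (Finset.mem_range.1 hl)) hi
          (funext fun t => (congrFun h (Sum.inl (Sum.inl (Sum.inl t)))).symm)⟩
      · rintro ⟨h1, h2⟩
        rw [h1, h2]
    simp only [hiff]
    split_ifs with h
    · have hv : (⟨colIndex A l j % 2 ^ n, Nat.mod_lt _ (by positivity)⟩ : Fin (2 ^ n)) = i :=
        Fin.ext (by rw [h.2]; exact Nat.mod_eq_of_lt i.isLt)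
      rw [hv]
      simp [Matrix.mulVec, dotProduct, mul_assoc]
    · simp

end Encoding

/-! ### Numbering of the qubits, error and cost of the block encoding -/

section Main

/-- The main qubits, split into the ancillas of the block encoding and its system register. -/
def mainEquiv (n : ℕ) : MainQubits n ≃ Fin ((n + 1) + 1 + 1) ⊕ Fin n where
  toFun := Sum.elim (Sum.elim (fun t => Sum.inl (Fin.castAdd 1 (Fin.castAdd 1 t)))
    fun t => Fin.lastCases (Sum.inl (Fin.castAdd 1 (Fin.natAdd (n + 1) (0 : Fin 1)))) (fun t => Sum.inr t) t)
    fun t => Sum.inl (Fin.natAdd (n + 1 + 1) t)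
  invFun := Sum.elim (fun t => Fin.addCases (fun t => Fin.addCases
      (fun t => Sum.inl (Sum.inl t)) (fun _ => Sum.inl (Sum.inr (Fin.last n))) t)
      (fun t => Sum.inr t) t)
    fun t => Sum.inl (Sum.inr t.castSucc)
  left_inv := by
    rintro ((t | t) | t)
    · simp
    · refine Fin.lastCases ?_ (fun t => ?_) t <;> simp
    · simp
  right_inv := by
    rintro (t | t)
    · refine Fin.addCases (fun t => ?_) (fun t => ?_) t
      · refine Fin.addCases (fun t => ?_) (fun t => ?_) t
        · simp
        · simp [Subsingleton.elim t 0]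
      · simp
    · simp

theorem elim_comp_mainEquiv {n k : ℕ} (hk : k < 2 ^ n) :
    (Sum.elim (fun _ => false) (bits n k) : Fin ((n + 1) + 1 + 1) ⊕ Fin n → Bool) ∘ mainEquiv n =
      Sum.elim (Sum.elim (fun _ => false) (bits (n + 1) k)) fun _ => false := by
  funext q
  rcases q with (t | t) | t
  · rfl
  · refine Fin.lastCases ?_ (fun t => ?_) t
    · simp [mainEquiv, bits_last hk]
    · simp [mainEquiv, bits]
  · rfl

/-- The numbering of the scratch qubits. -/
def workEquiv (m s : ℕ) : ValueQubits m ⊕ Fin s ≃ Fin ((m + 1) + (m + 1) + s) :=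
  (Equiv.sumCongr finSumFinEquiv (Equiv.refl _)).trans finSumFinEquiv

theorem amplitudeGate_scaled_error {α c s ε : ℝ} {a D : ℂ} (hα : α = c * s) (hc : 0 < c)
    (hs : 0 < s) (hD : ‖D - a / (c : ℂ)‖ ≤ ε / α) :
    ‖a - (α : ℂ) * ((1 / s : ℝ) * D)‖ ≤ ε / s := by
  have hc' : (c : ℂ) ≠ 0 := by exact_mod_cast hc.ne'
  have hs' : (s : ℂ) ≠ 0 := by exact_mod_cast hs.ne'
  have h : a - (α : ℂ) * ((1 / s : ℝ) * D) = -(c : ℂ) * (D - a / (c : ℂ)) := by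
    rw [hα]
    push_cast
    field_simp
    ring
  rw [h, norm_mul, norm_neg, Complex.norm_real, Real.norm_of_nonneg hc.le]
  calc c * ‖D - a / (c : ℂ)‖ ≤ c * (ε / α) := mul_le_mul_of_nonneg_left hD hc.le
    _ = ε / s := by rw [hα]; field_simp

/-- Oracle rounding and angle search together give `‖D - A i j / c‖ ≤ 2 · ε / (2α)` at a nonzero
entry. After multiplication by `c` this is `ε / √(sr sc)`, exactly the entrywise size that the
sparse norm bound turns into `ε`. -/
theorem exists_blockEncoding {n m sr sc : ℕ} {c ε : ℝ} (hr1 : 1 ≤ sr) (hr2 : sr ≤ 2 ^ n)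
    (hc1 : 1 ≤ sc) (hc2 : sc ≤ 2 ^ n) (hc : 1 ≤ c) (hε : 0 < ε) :
    ∃ (T s : ℕ) (circ : List (Instr n m ((Fin ((n + 1) + 1 + 1) ⊕ Fin n) ⊕
        Fin ((m + 1) + (m + 1) + s)))),
      (T : ℝ) ≤ 20 * Real.log (2 + c * √(sr * sc) / ε) ∧ s ≤ 15000 * T ^ 4 ∧
      circ.countP Instr.isQueryR = 1 ∧ circ.countP Instr.isQueryC = 1 ∧
      circ.countP Instr.isQueryA = 2 ∧
      circ.countP Instr.isGate = 3 * (n + 1) + (10 * s + 3 * T) ∧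
      ∀ (P : Matrix (Fin (2 ^ n)) (Fin (2 ^ n)) ℂ) (O : Oracles n m),
        RowSparse sr P → ColSparse sc P → (∀ i j, ‖P i j‖ ≤ c) →
        IsRowOracle sr P O.Or → IsColOracle sc P O.Oc →
        IsEntryOracle c (ε / (2 * (c * √(sr * sc)))) P O.OA →
        ∃ U : QUnitary (Fin ((n + 1) + 1 + 1) ⊕ Fin n),
          Implements (circuitMatrix O circ) U ∧
          IsBlockEncoding (c * √(sr * sc)) ((n + 1) + 1 + 1) ε P U := by
  have hsr : (0 : ℝ) < sr := by exact_mod_cast hr1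
  have hsc : (0 : ℝ) < sc := by exact_mod_cast hc1
  have hs : 0 < √((sr : ℝ) * sc) := Real.sqrt_pos.2 (mul_pos hsr hsc)
  have hc0 : 0 < c := by linarith
  set α := c * √((sr : ℝ) * sc) with hα
  have hα0 : 0 < α := mul_pos hc0 hs
  obtain ⟨T, hT, hprog⟩ := exists_angleProgram (δ := ε / (2 * α)) (by positivity)
  obtain ⟨fs, cb, db, hfs, hlen, hcd, happ⟩ := hprog m
  obtain ⟨gs, h1, h2, h3, h4, h5⟩ := exists_encoding_circuit (m := m) hr1 hr2 hc1 hc2 hfs hcd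
  let σ : WorkQubits n m fs.length ≃ _ := Equiv.sumCongr (mainEquiv n) (workEquiv m fs.length)
  obtain ⟨k1, k2, k3, k4⟩ := countP_mapQubits σ.toEmbedding gs
  have e1 : 1 / (2 * (ε / (2 * α))) = α / ε := by field_simp
  have e2 : 2 * (ε / (2 * α)) = ε / α := by field_simp
  rw [e1] at hT
  rw [e2] at happ
  refine ⟨T, fs.length, gs.map (Instr.mapQubits σ.toEmbedding), hT, hlen, k2.trans h2,
    k3.trans h3, k4.trans h4, k1.trans h1, fun P O hr hcs hP hOr hOc hOA => ?_⟩
  choose v hv hvO using hOA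
  obtain ⟨hpres, hent⟩ := h5 O P v hr hcs hOr hOc hvO
  have hσ : ∀ (x : Fin ((n + 1) + 1 + 1) ⊕ Fin n → Bool) (u : Fin ((m + 1) + (m + 1) + fs.length) →
      Bool), Sum.elim x u ∘ σ = Sum.elim (x ∘ mainEquiv n) (u ∘ workEquiv m fs.length) := by
    intro x u
    funext q
    rcases q with q | q <;> rfl
  obtain ⟨U, hU, hUval⟩ := exists_implements
    (circuitMatrix_conjTranspose_mul O (gs.map (Instr.mapQubits σ.toEmbedding))) (by
      intro x y u hu
      rw [circuitMatrix_mapQubits, applyOn_equiv, hσ, hσ]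
      refine hpres _ _ _ fun h => hu (funext fun q => ?_)
      have := congrFun h ((workEquiv m fs.length).symm q)
      simpa using this)
  have htop : ∀ i j, topBlock U i j = if P i j = 0 then 0 else
      ((1 / √((sr : ℝ) * sc) : ℝ) : ℂ) *
        amplitudeGate (cordicSum (cb (v i j)) T) (cordicSum (db (v i j)) T) false false := by
    intro i j
    rw [topBlock, hUval, circuitMatrix_mapQubits, applyOn_equiv, hσ, hσ,
      elim_comp_mainEquiv i.isLt, elim_comp_mainEquiv j.isLt]
    refine (hent i j).trans ?_
    rw [Real.sqrt_mul hsr.le, ← Complex.ofReal_mul, one_div_mul_one_div]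
  refine ⟨U, hU, specNorm_le_of_sparse hc0.le hr hcs hP, ?_⟩
  have hz : ∀ i j, P i j = 0 → (P - (α : ℂ) • topBlock U) i j = 0 := by
    intro i j h
    rw [Matrix.sub_apply, Matrix.smul_apply, htop, if_pos h, h, smul_zero, sub_zero]
  have hent' : ∀ i j, ‖(P - (α : ℂ) • topBlock U) i j‖ ≤ ε / √((sr : ℝ) * sc) := by
    intro i j
    by_cases h : P i j = 0
    · rw [hz i j h, norm_zero]
      positivity
    · rw [Matrix.sub_apply, Matrix.smul_apply, htop, if_neg h, smul_eq_mul, amplitudeGate_apply]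
      refine amplitudeGate_scaled_error hα hc0 hs (happ (v i j) _ ?_ (hv i j))
      rw [norm_div, Complex.norm_real, Real.norm_of_nonneg hc0.le]
      exact (div_le_one hc0).2 (hP i j)
  -- The encoding is exactly zero where `P` is, whatever the entry oracle returns there, so the
  -- error matrix has the sparsities of `P`.
  have hfin := specNorm_le_of_sparse (c := ε / √((sr : ℝ) * sc)) (by positivity)
    (fun i => (Set.encard_le_encard fun j (hj : _ ≠ _) (h : P i j = 0) => hj (hz i j h)).trans (hr i))
    (fun j => (Set.encard_le_encard fun i (hi : _ ≠ _) (h : P i j = 0) => hi (hz i j h)).trans (hcs j)) hent'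
  rwa [div_mul_cancel₀ _ hs.ne'] at hfin

/-- Everything is expressed by the fourth power of the logarithm, with `15000 · 20^4 = 2.4 · 10^9`.
As `log 2 > 0.69`, this power is bounded below and absorbs the linear term and additive constants.
-/
theorem log_cost_bounds {x : ℝ} (hx : 0 ≤ x) {T s : ℕ} (hT : (T : ℝ) ≤ 20 * Real.log (2 + x))
    (hs : s ≤ 15000 * T ^ 4) :
    (s : ℝ) ≤ 2400000000 * Real.log (2 + x) ^ 4 ∧ (T : ℝ) ≤ 80 * Real.log (2 + x) ^ 4 ∧
      1 ≤ 5 * Real.log (2 + x) ^ 4 := by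
  have h2 : (0.69 : ℝ) ≤ Real.log (2 + x) := by
    have := Real.log_two_gt_d9
    have := Real.log_le_log (by norm_num : (0 : ℝ) < 2) (by linarith : 2 ≤ 2 + x)
    linarith
  set Λ := Real.log (2 + x)
  have h3 : (0.69 : ℝ) ^ 3 ≤ Λ ^ 3 := pow_le_pow_left₀ (by norm_num) h2 3
  have h4 : (0.69 : ℝ) ^ 4 ≤ Λ ^ 4 := pow_le_pow_left₀ (by norm_num) h2 4
  have hΛ : 0 ≤ Λ := by linarith
  refine ⟨?_, ?_, ?_⟩
  · have h5 : (s : ℝ) ≤ 15000 * (T : ℝ) ^ 4 := by exact_mod_cast hs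
    have h6 : (T : ℝ) ^ 4 ≤ (20 * Λ) ^ 4 := pow_le_pow_left₀ (Nat.cast_nonneg T) hT 4
    nlinarith
  · have h7 : Λ * 1 ≤ Λ * (4 * Λ ^ 3) :=
      mul_le_mul_of_nonneg_left (by norm_num at h3 ⊢; linarith) hΛ
    nlinarith
  · norm_num at h4
    linarith

end Main

theorem mainTheorem1 :
    -- dimension, sparsities, number of nonzeros and entries of the extended sparse matrix
    (∀ d n₁ r : ℕ, 1 ≤ d → 1 ≤ n₁ → ∃ K : ℕ,
      ∀ (depth N : ℕ) (f tol : ℝ) (A : Matrix (Fin N) (Fin N) ℂ)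
        (H : HBSRep d n₁ r depth N f tol A),
        ENat.card (SpIndex d r depth (Fin N)) ≤ ((K * N : ℕ) : ℕ∞) ∧
        RowSparse K H.Asp ∧ ColSparse K H.Asp ∧
        numNonzero H.Asp ≤ ((K * N : ℕ) : ℕ∞) ∧
        (∀ (n : ℕ) (e : SpIndex d r depth (Fin N) ↪ Fin (2 ^ n)),
          numNonzero (padMatrix e H.Asp) ≤ ((K * N : ℕ) : ℕ∞)) ∧
        ∀ c : ℝ, 1 ≤ f → f ≤ c → (∀ i j, ‖A i j‖ ≤ c) → ∀ i j, ‖H.Asp i j‖ ≤ c) ∧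
    -- block encoding from sparse access, with its cost
    (∃ (C : ℝ) (k : ℕ), ∀ (n m sr sc : ℕ) (c ε : ℝ),
      1 ≤ sr → sr ≤ 2 ^ n → 1 ≤ sc → sc ≤ 2 ^ n → 1 ≤ c → 0 < ε →
      ∃ (a w : ℕ) (circ : List (Instr n m ((Fin a ⊕ Fin n) ⊕ Fin w))),
        circ.countP Instr.isQueryR = 1 ∧
        circ.countP Instr.isQueryC = 1 ∧
        circ.countP Instr.isQueryA = 2 ∧
        (circ.countP Instr.isGate : ℝ) ≤
          C * (n + Real.log (2 + c * √(sr * sc) / ε) ^ k) ∧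
        (a : ℝ) ≤ C * (n + 1) ∧
        (w : ℝ) ≤ C * ((2 * (m + 1)) + Real.log (2 + c * √(sr * sc) / ε) ^ k) ∧
        ∀ (d n₁ r depth N : ℕ) (f tol : ℝ) (A : Matrix (Fin N) (Fin N) ℂ)
          (H : HBSRep d n₁ r depth N f tol A)
          (e : SpIndex d r depth (Fin N) ↪ Fin (2 ^ n)) (O : Oracles n m),
          1 ≤ f → f ≤ c → (∀ i j, ‖A i j‖ ≤ c) →
          RowSparse sr H.Asp → ColSparse sc H.Asp →
          IsRowOracle sr (padMatrix e H.Asp) O.Or →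
          IsColOracle sc (padMatrix e H.Asp) O.Oc →
          IsEntryOracle c (ε / (2 * (c * √(sr * sc)))) (padMatrix e H.Asp) O.OA →
          ∃ U : QUnitary (Fin a ⊕ Fin n),
            Implements (circuitMatrix O circ) U ∧
            IsBlockEncoding (c * √(sr * sc)) a ε (padMatrix e H.Asp) U) := by
  -- Each NAND costs ten gates, five to compute and five to uncompute, which gives the leading term
  -- `2.4 · 10^10`; the remainder leaves room for the rotations and preparations.
  refine ⟨exists_sparsity_bound, 30000000000, 4, ?_⟩
  intro n m sr sc c ε hr1 hr2 hc1 hc2 hc hε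
  obtain ⟨T, s, circ, hT, hs, q1, q2, q3, q4, hcirc⟩ :=
    exists_blockEncoding (m := m) hr1 hr2 hc1 hc2 hc hε
  obtain ⟨b1, b2, b3⟩ := log_cost_bounds (by positivity) hT hs
  have hn : (0 : ℝ) ≤ n := Nat.cast_nonneg n
  have hm : (0 : ℝ) ≤ m := Nat.cast_nonneg m
  refine ⟨_, _, circ, q1, q2, q3, ?_, ?_, ?_, ?_⟩
  · rw [q4]
    push_cast
    linarith
  · push_cast
    linarith
  · push_cast
    linarith
  · intro d n₁ r depth N f tol A H e O hf hfc hA hr hcs hOr hOc hOA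
    exact hcirc _ O (hr.padMatrix e) (hcs.padMatrix e)
      (norm_padMatrix_le e (by linarith) (H.norm_Asp_le hf hfc hA)) hOr hOc hOA
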